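/- **Setting.** Let $\mathbf k$ be a field of characteristic $0$ and $N\ge 1$. A *perfect cylindrical network* $\Gamma$ with $N$ sources and $N$ sinks is a finite directed graph embedded in an oriented cylinder, without oriented cycles, such that: there are $N$ sources on one boundary circle and $N$ sinks on the other, all univalent; all other vertices are interior, trivalent, and neither sources nor sinks. So an interior vertex is either *white* (one incoming edge) or *black* (one outgoing edge). Fix a *cut*: an oriented curve from the source circle to the sink circle that avoids the vertices and is transversal to the edges. Cutting along it turns the cylinder into a rectangle with the sources on the left and the sinks on the right side, both numbered $1,\dots,N$ from top to bottom. Glue the two boundary circles, matching sink $i$ with source $i$ for every $i$. Let $\mathcal C$ be the $\mathbf k$-linear category whose objects are the $N$ glued points and whose morphisms are the $\mathbf k$-linear combinations of directed paths of the resulting network on the torus which start and end at glued points; $fg$ denotes concatenation, first $f$ and then $g$. *Boundary measurements.* $B_\Gamma(\lambda)$ is the $N\times N$ matrix with entries $$B_\Gamma(\lambda)_{ij}=\sum_{p\colon i\to j}\lambda^{d(p)}\,p ,$$ where the sum is over the directed paths $p$ of $\Gamma$ on the cylinder from source $i$ to sink $j$, and $d(p)\in\mathbb Z$ is the oriented intersection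 index of $p$ with the cut. *Double bracket.* $\{\!\{-,-\}\!\}$ is the family of bilinear maps $\mathrm{Hom}(A,B)\times\mathrm{Hom}(C,D)\to\mathrm{Hom}(C,B)\otimes\mathrm{Hom}(A,D)$ on paths that satisfies the double Leibniz identities $$\{\!\{fg,h\}\!\}=(1\otimes f)\{\!\{g,h\}\!\}+\{\!\{f,h\}\!\}(g\otimes 1),\qquad \{\!\{f,gh\}\!\}=(g\otimes 1)\{\!\{f,h\}\!\}+\{\!\{f,g\}\!\}(1\otimes h)$$ and whose value on a pair of edges is the sum of the following contributions of the interior vertices. At a white vertex whose edges are, in counterclockwise order, $x_1,x_2$ (outgoing) and $x_3$ (incoming): $\{\!\{x_1,x_2\}\!\}=\tfrac12 x_1\otimes x_2$ and $\{\!\{x_2,x_1\}\!\}=-\tfrac12x_2\otimes x_1$. At a black vertex whose edges are, in counterclockwise order, $y_1,y_2$ (incoming) and $y_3$ (outgoing): $\{\!\{y_1,y_2\}\!\}=-\tfrac12 y_2\otimes y_1$ and $\{\!\{y_2,y_1\}\!\}=\tfrac12 y_1\otimes y_2$. All other contributions are $0$. It restricts to a double bracket on $\mathcal C$. *Cyclic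 space.* $\mathcal C_\natural=\big(\bigoplus_{X}\mathrm{Hom}_{\mathcal C}(X,X)\big)/[\mathcal C,\mathcal C]$, where $[\mathcal C,\mathcal C]$ is the span of all $fg-gf$ with $f\colon X\to Y$, $g\colon Y\to X$; $\overline f$ is the class of $f$. The double bracket induces a bilinear map $\langle-,-\rangle\colon\mathcal C_\natural\times\mathcal C_\natural\to\mathcal C_\natural$, $\langle\overline f,\overline g\rangle=\overline{\mu(\{\!\{f,g\}\!\})}$, where $\mu(x\otimes y)=xy$. **Theorem.** Define $H_{ij}\in\bigoplus_X\mathrm{Hom}_{\mathcal C}(X,X)$, for integers $i\ge 0$ and $j\in\mathbb Z$, by $$\mathrm{tr}\big(B_\Gamma(\lambda)^i\big)=\sum_j H_{ij}\,\lambda^j .$$ Then $\langle\,\overline{H_{ij}},\,\overline{H_{k\ell}}\,\rangle=0$ for all $i,j,k,\ell$. -/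

import Mathlib

open scoped TensorProduct

noncomputable section

/-! ### The linear category of paths in a quiver -/

/-- The space of `𝕜`-linear combinations of directed paths from `a` to `b`: the morphism space
`Hom(a, b)` of the `𝕜`-linear category of paths. -/
abbrev LinPath (𝕜 : Type*) [CommRing 𝕜] {V : Type*} [Quiver V] (a b : V) : Type _ :=
  Quiver.Path a b →₀ 𝕜

/-- The bilinear extension of a map defined on pairs of basis elements. -/
def bilinearExt (𝕜 : Type*) [CommRing 𝕜] {α β M : Type*} [AddCommMonoid M] [Module 𝕜 M]
    (φ : α → β → M) : (α →₀ 𝕜) →ₗ[𝕜] (β →₀ 𝕜) →ₗ[𝕜] M :=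
  Finsupp.linearCombination 𝕜 fun p => Finsupp.linearCombination 𝕜 (φ p)

theorem bilinearExt_single (𝕜 : Type*) [CommRing 𝕜] {α β M : Type*} [AddCommMonoid M]
    [Module 𝕜 M] (φ : α → β → M) (p : α) (q : β) :
    bilinearExt 𝕜 φ (Finsupp.single p 1) (Finsupp.single q 1) = φ p q := by
  simp [bilinearExt]

/-- Concatenation of paths, `x ⊗ y ↦ xy` (first `x`, then `y`), extended bilinearly. -/
def concat (𝕜 : Type*) [CommRing 𝕜] {V : Type*} [Quiver V] {a b c : V} :
    LinPath 𝕜 a b →ₗ[𝕜] LinPath 𝕜 b c →ₗ[𝕜] LinPath 𝕜 a c :=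
  bilinearExt 𝕜 fun p q => Finsupp.single (p.comp q) 1

section Bracket

variable {𝕜 : Type*} [CommRing 𝕜] {V : Type*} [Quiver V]

theorem concat_single {a b c : V} (p : Quiver.Path a b) (q : Quiver.Path b c) :
    concat 𝕜 (Finsupp.single p 1) (Finsupp.single q 1) = Finsupp.single (p.comp q) 1 :=
  bilinearExt_single ..

theorem concat_assoc {a b c d : V} (x : LinPath 𝕜 a b) (y : LinPath 𝕜 b c)
    (z : LinPath 𝕜 c d) : concat 𝕜 (concat 𝕜 x y) z = concat 𝕜 x (concat 𝕜 y z) := by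
  induction x using Finsupp.induction_linear with
  | zero => simp
  | add x x' h h' => simp [h, h']
  | single p r =>
  induction y using Finsupp.induction_linear with
  | zero => simp
  | add x x' h h' => simp [h, h']
  | single q s =>
  induction z using Finsupp.induction_linear with
  | zero => simp
  | add x x' h h' => simp [h, h']
  | single u t =>
  rw [← mul_one r, ← mul_one s, ← mul_one t, ← smul_eq_mul, ← smul_eq_mul, ← smul_eq_mul,
    ← Finsupp.smul_single, ← Finsupp.smul_single, ← Finsupp.smul_single]
  simp only [map_smul, LinearMap.smul_apply, concat_single, Quiver.Path.comp_assoc]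

/-- `(f ⊗ 1) t`. -/
def lmul₁ {a b c d e : V} (f : LinPath 𝕜 a b) :
    LinPath 𝕜 b c ⊗[𝕜] LinPath 𝕜 d e →ₗ[𝕜] LinPath 𝕜 a c ⊗[𝕜] LinPath 𝕜 d e :=
  LinearMap.rTensor _ (concat 𝕜 f)

/-- `(1 ⊗ f) t`. -/
def lmul₂ {a b c d e : V} (f : LinPath 𝕜 a b) :
    LinPath 𝕜 d e ⊗[𝕜] LinPath 𝕜 b c →ₗ[𝕜] LinPath 𝕜 d e ⊗[𝕜] LinPath 𝕜 a c :=
  LinearMap.lTensor _ (concat 𝕜 f)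

/-- `t (g ⊗ 1)`. -/
def rmul₁ {a b c d e : V} (g : LinPath 𝕜 b c) :
    LinPath 𝕜 a b ⊗[𝕜] LinPath 𝕜 d e →ₗ[𝕜] LinPath 𝕜 a c ⊗[𝕜] LinPath 𝕜 d e :=
  LinearMap.rTensor _ ((concat 𝕜).flip g)

/-- `t (1 ⊗ g)`. -/
def rmul₂ {a b c d e : V} (g : LinPath 𝕜 b c) :
    LinPath 𝕜 d e ⊗[𝕜] LinPath 𝕜 a b →ₗ[𝕜] LinPath 𝕜 d e ⊗[𝕜] LinPath 𝕜 a c :=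
  LinearMap.lTensor _ ((concat 𝕜).flip g)

/-- The concatenation map `μ : Hom(a, b) ⊗ Hom(b, c) → Hom(a, c)`. -/
def concatTensor {a b c : V} :
    LinPath 𝕜 a b ⊗[𝕜] LinPath 𝕜 b c →ₗ[𝕜] LinPath 𝕜 a c :=
  TensorProduct.lift (concat 𝕜)

variable (𝕜 V) in
/-- A biderivation on the linear path category: bilinear maps
`Hom(a, b) × Hom(c, d) → Hom(c, b) ⊗ Hom(a, d)` satisfying both double Leibniz identities. -/
structure Biderivation where
  /-- The double bracket `⦃f, g⦄`. -/
  br : ∀ {a b c d : V}, LinPath 𝕜 a b →ₗ[𝕜] LinPath 𝕜 c d →ₗ[𝕜]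
    LinPath 𝕜 c b ⊗[𝕜] LinPath 𝕜 a d
  leibniz_left : ∀ {a b b' c d : V} (f : LinPath 𝕜 a b) (g : LinPath 𝕜 b b')
    (h : LinPath 𝕜 c d),
    br (concat 𝕜 f g) h = lmul₂ f (br g h) + rmul₁ g (br f h)
  leibniz_right : ∀ {a b c d d' : V} (f : LinPath 𝕜 a b) (g : LinPath 𝕜 c d)
    (h : LinPath 𝕜 d d'),
    br f (concat 𝕜 g h) = lmul₁ g (br f h) + rmul₂ h (br f g)

/-! ### The biderivation determined by its values on arrows -/

/-- A prescription `⦃e, f⦄` of the values of a biderivation on pairs of arrows. -/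
abbrev ArrowBracket (𝕜 : Type*) [CommRing 𝕜] (V : Type*) [Quiver V] : Type _ :=
  ∀ {a b c d : V}, (a ⟶ b) → (c ⟶ d) → LinPath 𝕜 c b ⊗[𝕜] LinPath 𝕜 a d

/-- The linear path consisting of a single path. -/
abbrev pathElt (𝕜 : Type*) [CommRing 𝕜] {V : Type*} [Quiver V] {a b : V}
    (p : Quiver.Path a b) : LinPath 𝕜 a b :=
  Finsupp.single p 1

/-- `⦃p, f⦄` for a path `p` and an arrow `f`, by the Leibniz identity in the first argument. -/
def pathArrowBracket (ε : ArrowBracket 𝕜 V) {a c d : V} (f : c ⟶ d) :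
    ∀ {b : V}, Quiver.Path a b → LinPath 𝕜 c b ⊗[𝕜] LinPath 𝕜 a d
  | _, .nil => 0
  | _, .cons p e => lmul₂ (pathElt 𝕜 p) (ε e f) +
      rmul₁ (pathElt 𝕜 e.toPath) (pathArrowBracket ε f p)

/-- `⦃p, q⦄` for paths `p` and `q`, by the Leibniz identity in the second argument. -/
def pathBracket (ε : ArrowBracket 𝕜 V) {a b c : V} (p : Quiver.Path a b) :
    ∀ {d : V}, Quiver.Path c d → LinPath 𝕜 c b ⊗[𝕜] LinPath 𝕜 a d
  | _, .nil => 0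
  | _, .cons q f => lmul₁ (pathElt 𝕜 q) (pathArrowBracket ε f p) +
      rmul₂ (pathElt 𝕜 f.toPath) (pathBracket ε p q)

theorem tensor_ext_single {α β M : Type*} [AddCommMonoid M] [Module 𝕜 M]
    {F G : (α →₀ 𝕜) ⊗[𝕜] (β →₀ 𝕜) →ₗ[𝕜] M}
    (h : ∀ p q, F (Finsupp.single p 1 ⊗ₜ Finsupp.single q 1) =
      G (Finsupp.single p 1 ⊗ₜ Finsupp.single q 1)) : F = G := by
  apply TensorProduct.ext
  ext p q
  exact h p q

theorem lmul₁_comp {a b b' c d e : V} (f : LinPath 𝕜 a b) (g : LinPath 𝕜 b b')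
    (t : LinPath 𝕜 b' c ⊗[𝕜] LinPath 𝕜 d e) :
    lmul₁ (concat 𝕜 f g) t = lmul₁ f (lmul₁ g t) := by
  induction t with
  | zero => simp
  | add x y hx hy => simp [hx, hy]
  | tmul x y => simp [lmul₁, concat_assoc]

theorem lmul₂_comp {a b b' c d e : V} (f : LinPath 𝕜 a b) (g : LinPath 𝕜 b b')
    (t : LinPath 𝕜 d e ⊗[𝕜] LinPath 𝕜 b' c) :
    lmul₂ (concat 𝕜 f g) t = lmul₂ f (lmul₂ g t) := by
  induction t with
  | zero => simp
  | add x y hx hy => simp [hx, hy]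
  | tmul x y => simp [lmul₂, concat_assoc]

theorem rmul₁_comp {a b c c' d e : V} (f : LinPath 𝕜 b c) (g : LinPath 𝕜 c c')
    (t : LinPath 𝕜 a b ⊗[𝕜] LinPath 𝕜 d e) :
    rmul₁ (concat 𝕜 f g) t = rmul₁ g (rmul₁ f t) := by
  induction t with
  | zero => simp
  | add x y hx hy => simp [hx, hy]
  | tmul x y => simp [rmul₁, concat_assoc]

theorem rmul₂_comp {a b c c' d e : V} (f : LinPath 𝕜 b c) (g : LinPath 𝕜 c c')
    (t : LinPath 𝕜 d e ⊗[𝕜] LinPath 𝕜 a b) :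
    rmul₂ (concat 𝕜 f g) t = rmul₂ g (rmul₂ f t) := by
  induction t with
  | zero => simp
  | add x y hx hy => simp [hx, hy]
  | tmul x y => simp [rmul₂, concat_assoc]

theorem lmul₂_rmul₁ {a b c d e d' : V} (f : LinPath 𝕜 a b) (g : LinPath 𝕜 d e)
    (t : LinPath 𝕜 d' d ⊗[𝕜] LinPath 𝕜 b c) :
    lmul₂ f (rmul₁ g t) = rmul₁ g (lmul₂ f t) := by
  induction t with
  | zero => simp
  | add x y hx hy => simp [hx, hy]
  | tmul x y => simp [lmul₂, rmul₁]

theorem lmul₁_rmul₂ {a b c d e d' : V} (f : LinPath 𝕜 a b) (g : LinPath 𝕜 d e)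
    (t : LinPath 𝕜 b c ⊗[𝕜] LinPath 𝕜 d' d) :
    lmul₁ f (rmul₂ g t) = rmul₂ g (lmul₁ f t) := by
  induction t with
  | zero => simp
  | add x y hx hy => simp [hx, hy]
  | tmul x y => simp [lmul₁, rmul₂]

theorem lmul₁_lmul₂ {a b c d e d' : V} (f : LinPath 𝕜 a b) (g : LinPath 𝕜 d e)
    (t : LinPath 𝕜 b c ⊗[𝕜] LinPath 𝕜 e d') :
    lmul₁ f (lmul₂ g t) = lmul₂ g (lmul₁ f t) := by
  induction t with
  | zero => simp
  | add x y hx hy => simp [hx, hy]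
  | tmul x y => simp [lmul₁, lmul₂]

theorem lmul₁_rmul₁ {a b c d e d' : V} (f : LinPath 𝕜 a b) (g : LinPath 𝕜 c d)
    (t : LinPath 𝕜 b c ⊗[𝕜] LinPath 𝕜 e d') :
    lmul₁ f (rmul₁ g t) = rmul₁ g (lmul₁ f t) := by
  induction t with
  | zero => simp
  | add x y hx hy => simp [hx, hy]
  | tmul x y => simp [lmul₁, rmul₁, concat_assoc]

theorem lmul₂_rmul₂ {a b c d e d' : V} (f : LinPath 𝕜 a b) (g : LinPath 𝕜 c d)
    (t : LinPath 𝕜 e d' ⊗[𝕜] LinPath 𝕜 b c) :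
    lmul₂ f (rmul₂ g t) = rmul₂ g (lmul₂ f t) := by
  induction t with
  | zero => simp
  | add x y hx hy => simp [hx, hy]
  | tmul x y => simp [lmul₂, rmul₂, concat_assoc]

theorem rmul₁_rmul₂ {a b c d e d' : V} (f : LinPath 𝕜 a b) (g : LinPath 𝕜 c d)
    (t : LinPath 𝕜 e a ⊗[𝕜] LinPath 𝕜 d' c) :
    rmul₁ f (rmul₂ g t) = rmul₂ g (rmul₁ f t) := by
  induction t with
  | zero => simp
  | add x y hx hy => simp [hx, hy]
  | tmul x y => simp [rmul₁, rmul₂]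

theorem lmul₁_nil {a c d e : V} (t : LinPath 𝕜 a c ⊗[𝕜] LinPath 𝕜 d e) :
    lmul₁ (pathElt 𝕜 (.nil : Quiver.Path a a)) t = t := by
  have : (lmul₁ (pathElt 𝕜 (.nil : Quiver.Path a a)) :
      LinPath 𝕜 a c ⊗[𝕜] LinPath 𝕜 d e →ₗ[𝕜] _) = LinearMap.id :=
    tensor_ext_single fun p q => by
      simp [lmul₁, pathElt, concat_single]
  rw [this]; rfl

theorem lmul₂_nil {a c d e : V} (t : LinPath 𝕜 d e ⊗[𝕜] LinPath 𝕜 a c) :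
    lmul₂ (pathElt 𝕜 (.nil : Quiver.Path a a)) t = t := by
  have : (lmul₂ (pathElt 𝕜 (.nil : Quiver.Path a a)) :
      LinPath 𝕜 d e ⊗[𝕜] LinPath 𝕜 a c →ₗ[𝕜] _) = LinearMap.id :=
    tensor_ext_single fun p q => by
      simp [lmul₂, pathElt, concat_single]
  rw [this]; rfl

theorem rmul₁_nil {a c d e : V} (t : LinPath 𝕜 c a ⊗[𝕜] LinPath 𝕜 d e) :
    rmul₁ (pathElt 𝕜 (.nil : Quiver.Path a a)) t = t := by
  have : (rmul₁ (pathElt 𝕜 (.nil : Quiver.Path a a)) :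
      LinPath 𝕜 c a ⊗[𝕜] LinPath 𝕜 d e →ₗ[𝕜] _) = LinearMap.id :=
    tensor_ext_single fun p q => by
      simp [rmul₁, pathElt, concat_single]
  rw [this]; rfl

theorem rmul₂_nil {a c d e : V} (t : LinPath 𝕜 d e ⊗[𝕜] LinPath 𝕜 c a) :
    rmul₂ (pathElt 𝕜 (.nil : Quiver.Path a a)) t = t := by
  have : (rmul₂ (pathElt 𝕜 (.nil : Quiver.Path a a)) :
      LinPath 𝕜 d e ⊗[𝕜] LinPath 𝕜 c a →ₗ[𝕜] _) = LinearMap.id :=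
    tensor_ext_single fun p q => by
      simp [rmul₂, pathElt, concat_single]
  rw [this]; rfl

theorem pathElt_comp {a b c : V} (p : Quiver.Path a b) (q : Quiver.Path b c) :
    pathElt 𝕜 (p.comp q) = concat 𝕜 (pathElt 𝕜 p) (pathElt 𝕜 q) :=
  (concat_single p q).symm

theorem pathArrowBracket_comp (ε : ArrowBracket 𝕜 V) {a b b' c d : V} (f : c ⟶ d)
    (p : Quiver.Path a b) (q : Quiver.Path b b') :
    pathArrowBracket ε f (p.comp q) =
      lmul₂ (pathElt 𝕜 p) (pathArrowBracket ε f q) +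
        rmul₁ (pathElt 𝕜 q) (pathArrowBracket ε f p) := by
  induction q with
  | nil => simp [pathArrowBracket, rmul₁_nil]
  | cons q e ih =>
    have hq : pathElt 𝕜 (q.cons e) = concat 𝕜 (pathElt 𝕜 q) (pathElt 𝕜 e.toPath) :=
      pathElt_comp q e.toPath
    rw [Quiver.Path.comp_cons, pathArrowBracket, pathArrowBracket, ih, hq]
    simp only [map_add, pathElt_comp p q, lmul₂_comp, rmul₁_comp, lmul₂_rmul₁]
    abel

theorem pathBracket_comp_right (ε : ArrowBracket 𝕜 V) {a b c d d' : V} (p : Quiver.Path a b)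
    (q : Quiver.Path c d) (r : Quiver.Path d d') :
    pathBracket ε p (q.comp r) =
      lmul₁ (pathElt 𝕜 q) (pathBracket ε p r) + rmul₂ (pathElt 𝕜 r) (pathBracket ε p q) := by
  induction r with
  | nil => simp [pathBracket, rmul₂_nil]
  | cons r e ih =>
    have hr : pathElt 𝕜 (r.cons e) = concat 𝕜 (pathElt 𝕜 r) (pathElt 𝕜 e.toPath) :=
      pathElt_comp r e.toPath
    rw [Quiver.Path.comp_cons, pathBracket, pathBracket, ih, hr]
    simp only [map_add, pathElt_comp q r, lmul₁_comp, rmul₂_comp, lmul₁_rmul₂]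
    abel

theorem pathBracket_comp_left (ε : ArrowBracket 𝕜 V) {a b b' c d : V} (p : Quiver.Path a b)
    (q : Quiver.Path b b') (r : Quiver.Path c d) :
    pathBracket ε (p.comp q) r =
      lmul₂ (pathElt 𝕜 p) (pathBracket ε q r) + rmul₁ (pathElt 𝕜 q) (pathBracket ε p r) := by
  induction r with
  | nil => simp [pathBracket]
  | cons r e ih =>
    rw [pathBracket, pathBracket, pathBracket, ih, pathArrowBracket_comp]
    simp only [map_add, lmul₁_lmul₂, lmul₁_rmul₁, lmul₂_rmul₂, rmul₁_rmul₂]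
    abel

/-- The unique biderivation with prescribed values on arrows. -/
def Biderivation.ofArrows (ε : ArrowBracket 𝕜 V) : Biderivation 𝕜 V where
  br := bilinearExt 𝕜 fun p q => pathBracket ε p q
  leibniz_left f g h := by
    induction f using Finsupp.induction_linear with
    | zero => simp [lmul₂]
    | add x x' h h' => simp [h, h', lmul₂, LinearMap.lTensor_add]; abel
    | single p r =>
    induction g using Finsupp.induction_linear with
    | zero => simp [rmul₁]
    | add x x' h h' => simp [h, h', rmul₁, LinearMap.rTensor_add]; abel
    | single q s =>
    induction h using Finsupp.induction_linear with
    | zero => simp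
    | add x x' h h' => simp [h, h']; abel
    | single u t =>
    rw [← mul_one r, ← mul_one s, ← mul_one t, ← smul_eq_mul, ← smul_eq_mul, ← smul_eq_mul,
      ← Finsupp.smul_single, ← Finsupp.smul_single, ← Finsupp.smul_single]
    simp only [map_smul, LinearMap.smul_apply, concat_single, bilinearExt_single,
      pathBracket_comp_left, lmul₂, rmul₁, LinearMap.lTensor_smul, LinearMap.rTensor_smul,
      smul_add]
    simp only [smul_smul, mul_comm, mul_left_comm]
  leibniz_right f g h := by
    induction f using Finsupp.induction_linear with
    | zero => simp
    | add x x' h h' => simp [h, h']; abel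
    | single p r =>
    induction g using Finsupp.induction_linear with
    | zero => simp [lmul₁]
    | add x x' h h' => simp [h, h', lmul₁, LinearMap.rTensor_add]; abel
    | single q s =>
    induction h using Finsupp.induction_linear with
    | zero => simp [rmul₂]
    | add x x' h h' => simp [h, h', rmul₂, LinearMap.lTensor_add]; abel
    | single u t =>
    rw [← mul_one r, ← mul_one s, ← mul_one t, ← smul_eq_mul, ← smul_eq_mul, ← smul_eq_mul,
      ← Finsupp.smul_single, ← Finsupp.smul_single, ← Finsupp.smul_single]
    simp only [map_smul, LinearMap.smul_apply, concat_single, bilinearExt_single,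
      pathBracket_comp_right, lmul₁, rmul₂, LinearMap.lTensor_smul, LinearMap.rTensor_smul,
      smul_add]
    simp only [smul_smul, mul_comm, mul_left_comm]

/-- On single arrows `Biderivation.ofArrows ε` takes the prescribed values. -/
theorem Biderivation.ofArrows_apply (ε : ArrowBracket 𝕜 V) {a b c d : V} (e : a ⟶ b)
    (f : c ⟶ d) : (Biderivation.ofArrows ε).br (pathElt 𝕜 e.toPath) (pathElt 𝕜 f.toPath) =
      ε e f := by
  change bilinearExt 𝕜 (fun p q => pathBracket ε p q) _ _ = _
  rw [bilinearExt_single]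
  simp [Quiver.Hom.toPath, pathBracket, pathArrowBracket, lmul₁_nil, lmul₂_nil]

/-! ### The cyclic space and the induced bracket -/

/-- `⨁ Hom(X, X)` over the objects `X` of the full subcategory on the objects `pt i`:
linear combinations of based loops. -/
abbrev Loops (𝕜 : Type*) [CommRing 𝕜] {V : Type*} [Quiver V] {ι : Type*} (pt : ι → V) :
    Type _ :=
  (Σ i : ι, Quiver.Path (pt i) (pt i)) →₀ 𝕜

variable {ι : Type*}

/-- The inclusion of `Hom(pt i, pt i)` as a direct summand of `Loops 𝕜 pt`. -/
def loop (pt : ι → V) (i : ι) : LinPath 𝕜 (pt i) (pt i) →ₗ[𝕜] Loops 𝕜 pt :=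
  Finsupp.lmapDomain 𝕜 𝕜 fun p => ⟨i, p⟩

variable (𝕜) in
/-- `[𝒞, 𝒞]`: the span of all `fg - gf`, where `f : X → Y` and `g : Y → X`. -/
def commutators (pt : ι → V) : Submodule 𝕜 (Loops 𝕜 pt) :=
  Submodule.span 𝕜 {x | ∃ (i j : ι) (f : LinPath 𝕜 (pt i) (pt j))
    (g : LinPath 𝕜 (pt j) (pt i)),
    x = loop pt i (concat 𝕜 f g) - loop pt j (concat 𝕜 g f)}

variable (𝕜) in
/-- The cyclic space `𝒞_♮` of the full subcategory on the objects `pt i`. -/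
abbrev CyclicSpace (pt : ι → V) : Type _ :=
  Loops 𝕜 pt ⧸ commutators 𝕜 pt

/-- The class in the cyclic space of a linear combination of loops. -/
abbrev cyclicClass (pt : ι → V) : Loops 𝕜 pt →ₗ[𝕜] CyclicSpace 𝕜 pt :=
  (commutators 𝕜 pt).mkQ

/-- The bracket `(f, g) ↦ class of μ ⦃f, g⦄`, before passing to the quotient. -/
def loopBracket (D : Biderivation 𝕜 V) (pt : ι → V) :
    Loops 𝕜 pt →ₗ[𝕜] Loops 𝕜 pt →ₗ[𝕜] CyclicSpace 𝕜 pt :=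
  bilinearExt 𝕜 fun p q => cyclicClass pt
    (loop pt q.1 (concatTensor (D.br (pathElt 𝕜 p.2) (pathElt 𝕜 q.2))))

theorem loopBracket_apply (D : Biderivation 𝕜 V) (pt : ι → V) (i j : ι)
    (f : LinPath 𝕜 (pt i) (pt i)) (g : LinPath 𝕜 (pt j) (pt j)) :
    loopBracket D pt (loop pt i f) (loop pt j g) =
      cyclicClass pt (loop pt j (concatTensor (D.br f g))) := by
  induction f using Finsupp.induction_linear with
  | zero => simp
  | add x x' h h' => simp only [map_add, LinearMap.add_apply, h, h']
  | single p r =>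
  induction g using Finsupp.induction_linear with
  | zero => simp
  | add x x' h h' => simp only [map_add, h, h']
  | single q s =>
  rw [← mul_one r, ← mul_one s, ← smul_eq_mul, ← smul_eq_mul, ← Finsupp.smul_single,
    ← Finsupp.smul_single]
  simp only [map_smul, LinearMap.smul_apply]
  congr 2
  simp only [loop, Finsupp.lmapDomain_apply, Finsupp.mapDomain_single]
  exact bilinearExt_single ..

theorem concatTensor_lmul₂ {a b c d : V} (f : LinPath 𝕜 b c)
    (t : LinPath 𝕜 a b ⊗[𝕜] LinPath 𝕜 c d) :
    concatTensor (lmul₂ f t) = concatTensor (rmul₁ f t) := by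
  induction t with
  | zero => simp
  | add x y hx hy => simp [hx, hy]
  | tmul x y => simp [lmul₂, rmul₁, concatTensor, concat_assoc]

theorem concatTensor_lmul₁ {a b c d : V} (f : LinPath 𝕜 a b)
    (t : LinPath 𝕜 b c ⊗[𝕜] LinPath 𝕜 c d) :
    concatTensor (lmul₁ f t) = concat 𝕜 f (concatTensor t) := by
  induction t with
  | zero => simp
  | add x y hx hy => simp [hx, hy]
  | tmul x y => simp [lmul₁, concatTensor, concat_assoc]

theorem concatTensor_rmul₂ {a b c d : V} (f : LinPath 𝕜 c d)
    (t : LinPath 𝕜 a b ⊗[𝕜] LinPath 𝕜 b c) :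
    concatTensor (rmul₂ f t) = concat 𝕜 (concatTensor t) f := by
  induction t with
  | zero => simp
  | add x y hx hy => simp [hx, hy]
  | tmul x y => simp [rmul₂, concatTensor, concat_assoc]

theorem cyclicClass_comm (pt : ι → V) {i j : ι} (f : LinPath 𝕜 (pt i) (pt j))
    (g : LinPath 𝕜 (pt j) (pt i)) :
    cyclicClass pt (loop pt i (concat 𝕜 f g)) = cyclicClass pt (loop pt j (concat 𝕜 g f)) :=
  (Submodule.Quotient.eq _).2 (Submodule.subset_span ⟨i, j, f, g, rfl⟩)

theorem loopBracket_comm_left (D : Biderivation 𝕜 V) (pt : ι → V) {i j k : ι}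
    (f : LinPath 𝕜 (pt i) (pt j)) (g : LinPath 𝕜 (pt j) (pt i)) (h : LinPath 𝕜 (pt k) (pt k)) :
    loopBracket D pt (loop pt i (concat 𝕜 f g)) (loop pt k h) =
      loopBracket D pt (loop pt j (concat 𝕜 g f)) (loop pt k h) := by
  rw [loopBracket_apply, loopBracket_apply, D.leibniz_left f g, D.leibniz_left g f,
    map_add concatTensor, map_add concatTensor, concatTensor_lmul₂ f, concatTensor_lmul₂ g,
    add_comm]

theorem loopBracket_comm_right (D : Biderivation 𝕜 V) (pt : ι → V) {i j k : ι}
    (f : LinPath 𝕜 (pt i) (pt j)) (g : LinPath 𝕜 (pt j) (pt i)) (h : LinPath 𝕜 (pt k) (pt k)) :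
    loopBracket D pt (loop pt k h) (loop pt i (concat 𝕜 f g)) =
      loopBracket D pt (loop pt k h) (loop pt j (concat 𝕜 g f)) := by
  rw [loopBracket_apply, loopBracket_apply, D.leibniz_right h f g, D.leibniz_right h g f,
    map_add concatTensor, map_add concatTensor, concatTensor_lmul₁, concatTensor_lmul₁,
    concatTensor_rmul₂, concatTensor_rmul₂, map_add (loop pt i), map_add (loop pt j),
    map_add (cyclicClass pt), map_add (cyclicClass pt), cyclicClass_comm pt f,
    cyclicClass_comm pt _ g, add_comm]

theorem lsingle_eq_loop (pt : ι → V) (k : ι) (u : Quiver.Path (pt k) (pt k)) :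
    (Finsupp.single ⟨k, u⟩ 1 : Loops 𝕜 pt) = loop pt k (pathElt 𝕜 u) := by
  simp [loop]

theorem loopBracket_left (D : Biderivation 𝕜 V) (pt : ι → V) :
    commutators 𝕜 pt ≤ LinearMap.ker (loopBracket D pt) := by
  refine Submodule.span_le.2 ?_
  rintro _ ⟨i, j, f, g, rfl⟩
  rw [SetLike.mem_coe, LinearMap.mem_ker, map_sub, sub_eq_zero]
  refine Finsupp.lhom_ext' fun u => LinearMap.ext_ring ?_
  rw [LinearMap.comp_apply, LinearMap.comp_apply, Finsupp.lsingle_apply, lsingle_eq_loop]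
  exact loopBracket_comm_left D pt f g _

theorem loopBracket_right (D : Biderivation 𝕜 V) (pt : ι → V) :
    commutators 𝕜 pt ≤ LinearMap.ker (loopBracket D pt).flip := by
  refine Submodule.span_le.2 ?_
  rintro _ ⟨i, j, f, g, rfl⟩
  rw [SetLike.mem_coe, LinearMap.mem_ker, map_sub, sub_eq_zero]
  refine Finsupp.lhom_ext' fun u => LinearMap.ext_ring ?_
  rw [LinearMap.comp_apply, LinearMap.comp_apply, Finsupp.lsingle_apply, lsingle_eq_loop,
    LinearMap.flip_apply, LinearMap.flip_apply]
  exact loopBracket_comm_right D pt f g _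

/-- The bracket `⟨-, -⟩ : 𝒞_♮ × 𝒞_♮ → 𝒞_♮` induced by a biderivation: on classes of loops it is
the class of `μ ⦃f, g⦄`. -/
def cyclicBracket (D : Biderivation 𝕜 V) (pt : ι → V) :
    CyclicSpace 𝕜 pt →ₗ[𝕜] CyclicSpace 𝕜 pt →ₗ[𝕜] CyclicSpace 𝕜 pt :=
  (commutators 𝕜 pt).liftQ
    (LinearMap.flip ((commutators 𝕜 pt).liftQ (loopBracket D pt).flip (loopBracket_right D pt)))
    (fun x hx => by
      have h0 : loopBracket D pt x = 0 := loopBracket_left D pt hx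
      refine LinearMap.mem_ker.2 (LinearMap.ext fun y => ?_)
      obtain ⟨y, rfl⟩ := Submodule.mkQ_surjective _ y
      change loopBracket D pt x y = 0
      rw [h0]; rfl)

theorem cyclicBracket_mk (D : Biderivation 𝕜 V) (pt : ι → V) (i j : ι)
    (f : LinPath 𝕜 (pt i) (pt i)) (g : LinPath 𝕜 (pt j) (pt j)) :
    cyclicBracket D pt (cyclicClass pt (loop pt i f))
        (cyclicClass pt (loop pt j g)) =
      cyclicClass pt (loop pt j (concatTensor (D.br f g))) :=
  loopBracket_apply D pt i j f g

end Bracket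

/-! ### Perfect cylindrical networks -/

/-- The vertices of a network with `m` sources, `n` sinks and set `V` of internal vertices. -/
inductive NetVertex (m n : ℕ) (V : Type) : Type
  | source (i : Fin m) : NetVertex m n V
  | sink (j : Fin n) : NetVertex m n V
  | inner (v : V) : NetVertex m n V

/-- A finite acyclic perfect network on a cylinder, with `m` sources on one boundary circle and
`n` sinks on the other.

The cylinder is drawn as a rectangle whose top and bottom sides are glued, with the sources
`0, …, m - 1` on the left side and the sinks `0, …, n - 1` on the right side, both numbered from
top to bottom. The embedding is recorded combinatorially. Each edge `e` has two half-edges: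
`Sum.inl e` at its tail and `Sum.inr e` at its head. Collapsing each boundary circle to a point
turns the cylinder into a sphere, and `rot` sends each half-edge to the next one in
counterclockwise order around its vertex on that oriented sphere. Every vertex of an acyclic
network is joined to both boundary circles, so the collapsed graph is connected and, by Euler's
formula, the rotation system comes from an embedding in the cylinder exactly when the number of
faces is `2 - #vertices + #edges`. -/
structure PerfectCylindricalNetwork (m n : ℕ) [NeZero m] [NeZero n] where
  /-- internal vertices -/
  V : Type
  /-- edges -/
  E : Type
  [fintypeV : Fintype V]
  [fintypeE : Fintype E]
  /-- the tail of an edge -/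
  src : E → NetVertex m n V
  /-- the head of an edge -/
  tgt : E → NetVertex m n V
  /-- the unique edge at a source -/
  sourceEdge : Fin m → E
  /-- the unique edge at a sink -/
  sinkEdge : Fin n → E
  src_eq_source : ∀ e i, src e = .source i ↔ e = sourceEdge i
  tgt_ne_source : ∀ e i, tgt e ≠ .source i
  tgt_eq_sink : ∀ e j, tgt e = .sink j ↔ e = sinkEdge j
  src_ne_sink : ∀ e j, src e ≠ .sink j
  /-- internal vertices are trivalent -/
  trivalent : ∀ v : V, Nat.card {h : E ⊕ E // Sum.elim src tgt h = .inner v} = 3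
  /-- internal vertices are not sources -/
  exists_in : ∀ v : V, ∃ e, tgt e = .inner v
  /-- internal vertices are not sinks -/
  exists_out : ∀ v : V, ∃ e, src e = .inner v
  /-- there are no oriented cycles -/
  acyclic : ∀ x : NetVertex m n V,
    ¬ Relation.TransGen (fun a b => ∃ e, src e = a ∧ tgt e = b) x x
  /-- the counterclockwise rotation of half-edges -/
  rot : Equiv.Perm (E ⊕ E)
  rot_inner : ∀ h v, Sum.elim src tgt h = .inner v → Sum.elim src tgt (rot h) = .inner v
  rot_cyclic : ∀ h h' v, Sum.elim src tgt h = .inner v → Sum.elim src tgt h' = .inner v →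
    rot.SameCycle h h'
  /-- On the left boundary circle the next source counterclockwise is the previous one. -/
  rot_source : ∀ i, rot (.inl (sourceEdge (i + 1))) = .inl (sourceEdge i)
  /-- On the right boundary circle the next sink counterclockwise is the following one. -/
  rot_sink : ∀ j, rot (.inr (sinkEdge j)) = .inr (sinkEdge (j + 1))
  /-- Euler's formula; the faces are the orbits of the face permutation, which sends a half-edge
  `h`, viewed as the edge directed away from `h`, to the next directed edge along the boundary of
  the face on its left. -/
  euler : Nat.card (Quotient (⟨Equiv.Perm.SameCycle ((Equiv.sumComm E E).trans rot.symm),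
    Equiv.Perm.SameCycle.equivalence _⟩ : Setoid (E ⊕ E))) + Fintype.card V = Fintype.card E

namespace PerfectCylindricalNetwork

attribute [instance] fintypeV fintypeE

section Cylinder

variable {m n : ℕ} [NeZero m] [NeZero n] (Γ : PerfectCylindricalNetwork m n)

/-- The opposite end of a half-edge. -/
def opp : Equiv.Perm (Γ.E ⊕ Γ.E) := Equiv.sumComm Γ.E Γ.E

/-- The face permutation: along the edge directed away from `h`, then sharp left. -/
def facePerm : Equiv.Perm (Γ.E ⊕ Γ.E) := Γ.opp.trans Γ.rot.symm

/-- `Γ.IsDualWalk h l h'`: a curve which starts in the face on the left of `h`, ends in the face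
on the left of `h'`, avoids the vertices, and crosses transversally, one after the other, the
directed edges in `l`, each of them from its left to its right. -/
def IsDualWalk : Γ.E ⊕ Γ.E → List (Γ.E ⊕ Γ.E) → Γ.E ⊕ Γ.E → Prop
  | h, [], h' => Γ.facePerm.SameCycle h h'
  | h, x :: l, h' => Γ.facePerm.SameCycle h x ∧ IsDualWalk (Γ.opp x) l h'

/-- A cut: a curve from the left to the right boundary circle which avoids the vertices and is
transversal to the edges, up to isotopy. Its left end lies between the last and the first source,
that is, just above source `0`, and its right end just above sink `0`. -/
structure Cut where
  /-- the directed edges crossed by the cut, each from its left to its right -/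
  crossings : List (Γ.E ⊕ Γ.E)
  isDualWalk : Γ.IsDualWalk (.inl (Γ.sourceEdge 0)) crossings (.inl (Γ.sinkEdge 0))

variable {Γ} in
open Classical in
/-- The oriented intersection number of an edge with the cut: an edge which goes from the right
to the left of the cut counts `+1`. -/
def Cut.index (κ : Γ.Cut) (e : Γ.E) : ℤ :=
  (κ.crossings.count (.inl e) : ℤ) - κ.crossings.count (.inr e)

/-- The vertices of `Γ`, as a quiver with the edges of `Γ` as arrows. -/
def Vertex : Type := NetVertex m n Γ.V

/-- The `i`-th source as a vertex. -/
def source (i : Fin m) : Γ.Vertex := NetVertex.source i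

/-- The `j`-th sink as a vertex. -/
def sink (j : Fin n) : Γ.Vertex := NetVertex.sink j

instance : Quiver Γ.Vertex := ⟨fun a b => {e : Γ.E // Γ.src e = a ∧ Γ.tgt e = b}⟩

theorem finite_path (a b : Γ.Vertex) : Finite (Quiver.Path a b) := by
  have hfin : Finite Γ.Vertex :=
    Finite.of_surjective (fun x : Fin m ⊕ Fin n ⊕ Γ.V =>
      (match x with
        | .inl i => NetVertex.source i
        | .inr (.inl j) => NetVertex.sink j
        | .inr (.inr v) => NetVertex.inner v : NetVertex m n Γ.V)) (by
      rintro (i | j | v)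
      exacts [⟨.inl i, rfl⟩, ⟨.inr (.inl j), rfl⟩, ⟨.inr (.inr v), rfl⟩])
  let R : Γ.Vertex → Γ.Vertex → Prop :=
    Relation.TransGen (fun a b => ∃ e, Γ.src e = a ∧ Γ.tgt e = b)
  have : Std.Irrefl R := ⟨Γ.acyclic⟩
  have : IsTrans Γ.Vertex R := ⟨fun _ _ _ => Relation.TransGen.trans⟩
  have wf : WellFounded R := Finite.wellFounded_of_trans_of_irrefl R
  induction b using wf.induction with
  | _ b ih =>
  have : ∀ c : Γ.Vertex, Finite (Quiver.Path a c × (c ⟶ b)) := by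
    intro c
    rcases isEmpty_or_nonempty (c ⟶ b) with h | ⟨⟨e, he⟩⟩
    · infer_instance
    · have := ih c (Relation.TransGen.single ⟨e, he⟩)
      have : Finite (c ⟶ b) := inferInstanceAs (Finite {e : Γ.E // Γ.src e = c ∧ Γ.tgt e = b})
      infer_instance
  let F : PLift (a = b) ⊕ (Σ c : Γ.Vertex, Quiver.Path a c × (c ⟶ b)) → Quiver.Path a b :=
    Sum.elim (fun h => Quiver.Path.nil.cast rfl h.down) (fun x => x.2.1.cons x.2.2)
  refine Finite.of_surjective F fun p => ?_
  cases p with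
  | nil => exact ⟨.inl ⟨rfl⟩, rfl⟩
  | cons p e => exact ⟨.inr ⟨_, p, e⟩, rfl⟩

instance (a b : Γ.Vertex) : Fintype (Quiver.Path a b) :=
  @Fintype.ofFinite _ (Γ.finite_path a b)

variable {Γ} in
/-- The oriented intersection index of a path with the cut. -/
def Cut.pathIndex (κ : Γ.Cut) {a : Γ.Vertex} : ∀ {b : Γ.Vertex}, Quiver.Path a b → ℤ
  | _, .nil => 0
  | _, .cons p e => κ.pathIndex p + κ.index e.1

end Cylinder

/-! ### The network on the torus and its double bracket -/

section Torus

variable {N : ℕ} [NeZero N] (Γ : PerfectCylindricalNetwork N N)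

/-- The vertices of the network on the torus obtained from `Γ` by gluing sink `i` to source `i`:
the `N` marked points, and the internal vertices. -/
def TorusVertex : Type := Fin N ⊕ Γ.V

/-- The image of a vertex of the cylinder on the torus. -/
def glue : Γ.Vertex → Γ.TorusVertex
  | .source i => .inl i
  | .sink j => .inl j
  | .inner v => .inr v

instance : Quiver Γ.TorusVertex :=
  ⟨fun a b => {e : Γ.E // Γ.glue (Γ.src e) = a ∧ Γ.glue (Γ.tgt e) = b}⟩

/-- The gluing map, on vertices and edges. -/
def gluing : Γ.Vertex ⥤q Γ.TorusVertex where
  obj := Γ.glue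
  map e := ⟨e.1, congrArg Γ.glue e.2.1, congrArg Γ.glue e.2.2⟩

/-- The marked points: the objects of the category `𝒞` of paths on the torus. -/
def marked (i : Fin N) : Γ.TorusVertex := .inl i

open Classical in
/-- The coefficient of `e ⊗ f` in `⦃e, f⦄` for edges `e`, `f` going out of the same internal
vertex. At a white vertex, with outgoing edges `x₁`, `x₂` and incoming edge `x₃` in
counterclockwise order, `⦃x₁, x₂⦄ = ½ x₁ ⊗ x₂` and `⦃x₂, x₁⦄ = -½ x₂ ⊗ x₁`. -/
def whiteCoeff (𝕜 : Type*) [Field 𝕜] (e f : Γ.E) : 𝕜 :=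
  if ∃ v, Γ.src e = .inner v ∧ Γ.src f = .inner v then
    if Γ.rot (.inl e) = .inl f then 1 / 2 else if Γ.rot (.inl f) = .inl e then -1 / 2 else 0
  else 0

open Classical in
/-- The coefficient of `f ⊗ e` in `⦃e, f⦄` for edges `e`, `f` going into the same internal
vertex. At a black vertex, with incoming edges `y₁`, `y₂` and outgoing edge `y₃` in
counterclockwise order, `⦃y₁, y₂⦄ = -½ y₂ ⊗ y₁` and `⦃y₂, y₁⦄ = ½ y₁ ⊗ y₂`. -/
def blackCoeff (𝕜 : Type*) [Field 𝕜] (e f : Γ.E) : 𝕜 :=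
  if ∃ v, Γ.tgt e = .inner v ∧ Γ.tgt f = .inner v then
    if Γ.rot (.inr e) = .inr f then -1 / 2 else if Γ.rot (.inr f) = .inr e then 1 / 2 else 0
  else 0

open Classical in
/-- The double brackets of the edges: the sum of the contributions of the white and the black
vertices that `e` and `f` have in common; all other local brackets are zero. -/
def edgeBracket (𝕜 : Type*) [Field 𝕜] : ArrowBracket 𝕜 Γ.TorusVertex :=
  fun {a b c d} e f =>
    (if h : a = c then Γ.whiteCoeff 𝕜 e.1 f.1 •
      (pathElt 𝕜 (e.toPath.cast h rfl) ⊗ₜ[𝕜] pathElt 𝕜 (f.toPath.cast h.symm rfl)) else 0) +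
    (if h : b = d then Γ.blackCoeff 𝕜 e.1 f.1 •
      (pathElt 𝕜 (f.toPath.cast rfl h.symm) ⊗ₜ[𝕜] pathElt 𝕜 (e.toPath.cast rfl h)) else 0)

/-- The double bracket on paths of the network. -/
def doubleBracket (𝕜 : Type*) [Field 𝕜] : Biderivation 𝕜 Γ.TorusVertex :=
  Biderivation.ofArrows (Γ.edgeBracket 𝕜)

/-! ### Boundary measurements and Hamiltonians -/

/-- `N × N` matrices with entry `(i, j)` in the Laurent polynomials in `λ` with coefficients in
`Hom(i, j)`; the coefficient of `λ ^ d` is the value at `d : ℤ`. -/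
abbrev LaurentMatrix (𝕜 : Type*) [Field 𝕜] : Type _ :=
  ∀ i j : Fin N, ℤ →₀ LinPath 𝕜 (Γ.marked i) (Γ.marked j)

namespace LaurentMatrix

variable {Γ} {𝕜 : Type*} [Field 𝕜]

/-- Matrix multiplication; the entries are multiplied by concatenation, `λ` is central. -/
def mul (X Y : Γ.LaurentMatrix 𝕜) : Γ.LaurentMatrix 𝕜 := fun i k =>
  ∑ j, (X i j).sum fun a x => (Y j k).sum fun b y => Finsupp.single (a + b) (concat 𝕜 x y)

/-- The identity matrix. -/
def one : Γ.LaurentMatrix 𝕜 := fun i j =>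
  if h : i = j then
    Finsupp.single 0 (pathElt 𝕜 (Quiver.Path.nil.cast rfl (congrArg Γ.marked h)))
  else 0

/-- Powers of a matrix. -/
def pow (X : Γ.LaurentMatrix 𝕜) : ℕ → Γ.LaurentMatrix 𝕜
  | 0 => one
  | k + 1 => mul (pow X k) X

/-- The coefficient of `λ ^ d` in the trace, a combination of loops. -/
def traceCoeff (X : Γ.LaurentMatrix 𝕜) (d : ℤ) : Loops 𝕜 Γ.marked :=
  ∑ i, loop Γ.marked i (X i i d)

end LaurentMatrix

/-- The boundary measurement matrix `B(λ)`: its entry `(i, j)` is the sum of `λ ^ d wt(p)` over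
the paths `p` on the cylinder from source `i` to sink `j`, where `d` is the intersection index of
`p` with the cut and `wt(p)` is `p`, viewed on the torus. -/
def boundaryMeasurement (𝕜 : Type*) [Field 𝕜] (κ : Γ.Cut) : Γ.LaurentMatrix 𝕜 := fun i j =>
  ∑ p : Quiver.Path (Γ.source i) (Γ.sink j),
    Finsupp.single (κ.pathIndex p) (pathElt 𝕜 (Γ.gluing.mapPath p))

/-- The Hamiltonian `H_{ij}`: the coefficient of `λ ^ j` in `tr (B(λ) ^ i)`. -/
def hamiltonian (𝕜 : Type*) [Field 𝕜] (κ : Γ.Cut) (i : ℕ) (j : ℤ) : Loops 𝕜 Γ.marked :=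
  ((Γ.boundaryMeasurement 𝕜 κ).pow i).traceCoeff j

end Torus

end PerfectCylindricalNetwork

end

/-! The class of a Hamiltonian is a sum over cyclic words in boundary paths whose indices add up to
a given integer. The double Leibniz rules and cyclicity reduce the bracket of two such sums to
brackets of single boundary paths `p` and `q`, closed up by complementary words `P` and `Q`
(`Cut.pairSum_eq_zero`). The bracket of `p` and `q` is local. At a white vertex where they part, or
a black vertex where they merge, it produces `r ⊗ r'`, where `r` starts like `q` and ends like `p`,
and `r'` starts like `p` and ends like `q`. For a given pair `(r, r')`, the signs of all places
where the exchange can be undone with prescribed indices add up to an intersection number of `r`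
with one particular lift of `r'` to the universal cover of the cylinder
(`sum_closeUp_doubleBracket`).

The universal cover is a strip, so this number depends only on the order of the end points: it is
half the difference of two signs, one for the sinks and one for the sources (`Cut.crossing_eq`). The
loop `r P r' Q` thus carries a weight attached to its two sinks minus the same weight attached to
its two sources. Since sink `i` is source `i`, both are weights at two marked points of a cyclic
word, and after summation over all words the two parts cancel (`sum_signTerm_left`,
`sum_signTerm_right`, `pairSum_one_bracketTerm`).

Planarity enters through the existence of levels (`Cut.nonempty_levels`): the lifts of a path divide
the strip into regions numbered by height. A numbering is a potential with prescribed increments. It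
exists because the first cohomology of the sphere vanishes, which follows from Euler's formula by a
dimension count (`exists_edge_potential`). A second path changes its level with respect to the first
only at vertices where the double bracket contributes, and by exactly that contribution, so the
contributions telescope along it. -/

/-! ### Vanishing first cohomology of a rotation system of genus zero -/

/-- The edge underlying a half-edge. -/
def edgeOf {E : Type*} : E ⊕ E → E := Sum.elim id id

@[simp] theorem edgeOf_inl {E : Type*} (e : E) : edgeOf (.inl e : E ⊕ E) = e := rfl

@[simp] theorem edgeOf_inr {E : Type*} (e : E) : edgeOf (.inr e : E ⊕ E) = e := rfl

/-- The functions which are invariant under a permutation. -/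
def invariantFunctions {D : Type*} (σ : Equiv.Perm D) : Submodule ℚ (D → ℚ) where
  carrier := {x | ∀ h, x (σ h) = x h}
  add_mem' hx hy h := by simp [hx h, hy h]
  zero_mem' _ := rfl
  smul_mem' c x hx h := by simp [hx h]

theorem eq_of_sameCycle {D α : Type*} {σ : Equiv.Perm D} {x : D → α} (hx : ∀ h, x (σ h) = x h)
    {a b : D} (hab : σ.SameCycle a b) : x a = x b := by
  obtain ⟨k, rfl⟩ := hab
  induction k generalizing a with
  | zero => rfl
  | succ k ih => rw [zpow_add_one, Equiv.Perm.mul_apply, ← ih, hx]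
  | pred k ih =>
    rw [zpow_sub_one, Equiv.Perm.mul_apply, ← ih, ← hx (σ⁻¹ a)]
    exact congrArg x (σ.apply_symm_apply a).symm

theorem card_le_finrank_invariantFunctions {D X : Type*} [Finite D] [Fintype X]
    (σ : Equiv.Perm D) (π : D → X) (hπ : Function.Surjective π) (hσ : ∀ h, π (σ h) = π h) :
    Fintype.card X ≤ Module.finrank ℚ (invariantFunctions σ) := by
  let F : (X → ℚ) →ₗ[ℚ] invariantFunctions σ :=
    { toFun := fun u => ⟨u ∘ π, fun h => by simp [hσ h]⟩
      map_add' := fun _ _ => rfl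
      map_smul' := fun _ _ => rfl }
  have hF : Function.Injective F := fun u v huv => by
    have h : u ∘ π = v ∘ π := congrArg Subtype.val huv
    exact hπ.injective_comp_right h
  have := LinearMap.finrank_le_finrank_of_injective hF
  rwa [Module.finrank_fintype_fun_eq_card] at this

/-- A connected rotation system of genus zero has trivial first cohomology: a prescription `b` of
the increments of a function on the edges around the vertices can be integrated as soon as it is
orthogonal to the functions on the vertices and to the functions on the faces. -/
theorem exists_edge_potential {E X Y : Type*} [Fintype E] [Fintype X] [Fintype Y]
    (rot face : Equiv.Perm (E ⊕ E)) (hface : ∀ h, rot (face h) = h.swap)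
    (hconn : ∀ u : E → ℚ, (∀ h, u (edgeOf (rot h)) = u (edgeOf h)) → ∃ c, ∀ e, u e = c)
    (π : E ⊕ E → X) (hπ : Function.Surjective π) (hπ' : ∀ h, π (rot h) = π h)
    (ρ : E ⊕ E → Y) (hρ : Function.Surjective ρ) (hρ' : ∀ h, ρ (face h) = ρ h)
    (hcard : Fintype.card E + 2 ≤ Fintype.card X + Fintype.card Y) (b : E ⊕ E → ℚ)
    (hvert : ∀ x : E ⊕ E → ℚ, (∀ h, x (rot h) = x h) → ∑ h, b h * x h = 0)
    (hfc : ∀ x : E ⊕ E → ℚ, (∀ h, x (face h) = x h) → ∑ h, b h * x h = 0) :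
    ∃ u : E → ℚ, ∀ h, u (edgeOf (rot h)) - u (edgeOf h) = b h := by
  classical
  -- This is the boundary map of the medial graph: its vertices are the edges, and each corner
  -- between `h` and `rot h` joins `edgeOf h` to `edgeOf (rot h)`. Its transpose sends `u` to the
  -- increments to be prescribed. The cells cut out by the medial graph are the vertices and the
  -- faces, and their boundaries span the cycles.
  let f : (E ⊕ E → ℚ) →ₗ[ℚ] (E → ℚ) :=
    { toFun := fun x e => x (rot.symm (.inl e)) + x (rot.symm (.inr e)) - x (.inl e) - x (.inr e)
      map_add' := fun x y => by ext e; simp; ring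
      map_smul' := fun c x => by ext e; simp; ring }
  have hf (h : E ⊕ E) : f (Pi.single h 1) =
      Pi.single (edgeOf (rot h)) 1 - Pi.single (edgeOf h) 1 := by
    ext e
    have h1 : ∀ k, (Pi.single h (1 : ℚ) : E ⊕ E → ℚ) (rot.symm k) =
        (Pi.single (rot h) (1 : ℚ) : E ⊕ E → ℚ) k := fun k => by
      simp only [Pi.single_apply, Equiv.symm_apply_eq]
    have h2 : ∀ k : E ⊕ E, (Pi.single k (1 : ℚ) : E ⊕ E → ℚ) (.inl e) +
        (Pi.single k (1 : ℚ) : E ⊕ E → ℚ) (.inr e) = (Pi.single (edgeOf k) (1 : ℚ) : E → ℚ) e := by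
      rintro (k | k) <;> simp [Pi.single_apply]
    have h3 := h2 (rot h)
    have h4 := h2 h
    simp only [Pi.sub_apply, ← h3, ← h4, ← h1]
    exact sub_sub _ _ _
  let U := invariantFunctions rot
  let W := invariantFunctions face
  have hUW : U ⊔ W ≤ LinearMap.ker f := by
    refine sup_le (fun x hx => ?_) (fun x hx => ?_)
    · have hx' : ∀ h, x (rot.symm h) = x h := fun h => by
        have := hx (rot.symm h); rw [Equiv.apply_symm_apply] at this; exact this.symm
      rw [LinearMap.mem_ker]; ext e
      change x _ + x _ - x _ - x _ = 0
      rw [hx', hx']; ring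
    · have hx' : ∀ h, x (rot.symm h.swap) = x h := fun h => by
        rw [← hface h, Equiv.symm_apply_apply]; exact hx h
      rw [LinearMap.mem_ker]; ext e
      change x _ + x _ - x _ - x _ = 0
      rw [show x (rot.symm (.inl e)) = x (.inr e) from hx' (.inr e),
        show x (rot.symm (.inr e)) = x (.inl e) from hx' (.inl e)]; ring
  -- A function invariant under `rot` and `face` is also invariant under swapping the ends of an
  -- edge. So it descends to the edges, and is constant by connectedness.
  have hinf : Module.finrank ℚ (U ⊓ W : Submodule ℚ (E ⊕ E → ℚ)) ≤ 1 := by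
    refine (Submodule.finrank_mono (t := Submodule.span ℚ {fun _ => (1 : ℚ)}) ?_).trans
      (finrank_span_le_card _ |>.trans (by simp))
    rintro x ⟨hx1, hx2⟩
    have hs : ∀ h, x h.swap = x h := fun h => by
      rw [← hface h]; exact (hx1 _).trans (hx2 h)
    have he : ∀ h, x (.inl (edgeOf h)) = x h := by
      rintro (e | e)
      exacts [rfl, hs (.inr e)]
    obtain ⟨c, hc⟩ := hconn (fun e => x (.inl e)) fun h => by rw [he, he]; exact hx1 h
    refine Submodule.mem_span_singleton.2 ⟨c, funext fun h => ?_⟩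
    simp [← he h, hc]
  -- The kernel of the transpose consists of the potentials without increments, which are constant
  -- by connectedness.
  have hdual : Module.finrank ℚ (LinearMap.ker f.dualMap) ≤ 1 := by
    let ev : Module.Dual ℚ (E → ℚ) := ∑ e, LinearMap.proj e
    refine (Submodule.finrank_mono (t := Submodule.span ℚ {ev}) ?_).trans
      (finrank_span_le_card _ |>.trans (by simp))
    intro ψ hψ
    have hψ' : ∀ h, ψ (Pi.single (edgeOf (rot h)) 1) = ψ (Pi.single (edgeOf h) 1) := fun h => by
      have : ψ (f (Pi.single h 1)) = 0 := LinearMap.congr_fun (LinearMap.mem_ker.1 hψ) _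
      rwa [hf, map_sub, sub_eq_zero] at this
    obtain ⟨c, hc⟩ := hconn (fun e => ψ (Pi.single e 1)) hψ'
    refine Submodule.mem_span_singleton.2 ⟨c, ?_⟩
    refine LinearMap.pi_ext' fun e => LinearMap.ext_ring ?_
    simp [ev, hc, Pi.single_apply]
  -- Dimension count: the kernel of `f` has dimension at most `|E| + 1`, while `U ⊔ W` has dimension
  -- at least `|X| + |Y| - 1`. Euler's formula makes the second bound at least the first.
  have hker : LinearMap.ker f = U ⊔ W := by
    refine (Submodule.eq_of_le_of_finrank_le hUW ?_).symm
    have h1 := f.finrank_range_add_finrank_ker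
    have h2 := f.dualMap.finrank_range_add_finrank_ker
    rw [LinearMap.finrank_range_dualMap_eq_finrank_range, Subspace.dual_finrank_eq,
      Module.finrank_fintype_fun_eq_card] at h2
    rw [Module.finrank_fintype_fun_eq_card, Fintype.card_sum] at h1
    have h3 := Submodule.finrank_sup_add_finrank_inf_eq U W
    have h4 : _ ≤ Module.finrank ℚ U := card_le_finrank_invariantFunctions rot π hπ hπ'
    have h5 : _ ≤ Module.finrank ℚ W := card_le_finrank_invariantFunctions face ρ hρ hρ'
    omega
  -- A functional that vanishes on the kernel of `f` lies in the range of the transpose, and its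
  -- preimage is the potential.
  let β : Module.Dual ℚ (E ⊕ E → ℚ) := ∑ h, b h • LinearMap.proj h
  have hβ (x) : β x = ∑ h, b h * x h := by simp [β]
  have hmem : β ∈ LinearMap.range f.dualMap := by
    rw [LinearMap.range_dualMap_eq_dualAnnihilator_ker, Submodule.mem_dualAnnihilator, hker]
    intro x hx
    obtain ⟨u, hu, w, hw, rfl⟩ := Submodule.mem_sup.1 hx
    rw [map_add, hβ, hβ, hvert u hu, hfc w hw, add_zero]
  obtain ⟨ψ, hψ⟩ := hmem
  refine ⟨fun e => ψ (Pi.single e 1), fun h => ?_⟩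
  have : ψ (f (Pi.single h 1)) = β (Pi.single h 1) := LinearMap.congr_fun hψ _
  rw [hf, map_sub, hβ] at this
  simpa [Pi.single_apply] using this

theorem fin_mk_succ {m : ℕ} [NeZero m] {k : ℕ} (hk : k + 1 < m) :
    (⟨k + 1, hk⟩ : Fin m) = ⟨k, by omega⟩ + 1 := by
  ext
  simp [Fin.val_add, Nat.mod_eq_of_lt hk]

/-! ### The network on the sphere with collapsed boundary circles -/

namespace PerfectCylindricalNetwork

section Levels

variable {m n : ℕ} [NeZero m] [NeZero n] (Γ : PerfectCylindricalNetwork m n)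

/-- The vertex at a half-edge. -/
def vertexAt (h : Γ.E ⊕ Γ.E) : NetVertex m n Γ.V := Sum.elim Γ.src Γ.tgt h

theorem eq_of_vertexAt_source {h : Γ.E ⊕ Γ.E} {i : Fin m} (hh : Γ.vertexAt h = .source i) :
    h = .inl (Γ.sourceEdge i) := by
  rcases h with e | e
  · exact congrArg _ ((Γ.src_eq_source e i).1 hh)
  · exact absurd hh (Γ.tgt_ne_source e i)

theorem eq_of_vertexAt_sink {h : Γ.E ⊕ Γ.E} {j : Fin n} (hh : Γ.vertexAt h = .sink j) :
    h = .inr (Γ.sinkEdge j) := by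
  rcases h with e | e
  · exact absurd hh (Γ.src_ne_sink e j)
  · exact congrArg _ ((Γ.tgt_eq_sink e j).1 hh)

theorem src_sourceEdge (i : Fin m) : Γ.src (Γ.sourceEdge i) = .source i :=
  (Γ.src_eq_source _ i).2 rfl

theorem tgt_sinkEdge (j : Fin n) : Γ.tgt (Γ.sinkEdge j) = .sink j :=
  (Γ.tgt_eq_sink _ j).2 rfl

theorem sourceEdge_injective : Function.Injective Γ.sourceEdge := fun i j h => by
  have := Γ.src_sourceEdge i
  rw [h, Γ.src_sourceEdge] at this
  exact (NetVertex.source.inj this).symm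

theorem sinkEdge_injective : Function.Injective Γ.sinkEdge := fun i j h => by
  have := Γ.tgt_sinkEdge i
  rw [h, Γ.tgt_sinkEdge] at this
  exact (NetVertex.sink.inj this).symm

/-- The vertices of the sphere obtained by collapsing the two boundary circles. -/
def collapse : NetVertex m n Γ.V → Γ.V ⊕ Bool
  | .source _ => .inr false
  | .sink _ => .inr true
  | .inner v => .inl v

theorem collapse_rot (h : Γ.E ⊕ Γ.E) :
    Γ.collapse (Γ.vertexAt (Γ.rot h)) = Γ.collapse (Γ.vertexAt h) := by
  cases hv : Γ.vertexAt h with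
  | source i =>
    rw [Γ.eq_of_vertexAt_source hv]
    obtain ⟨i, rfl⟩ : ∃ i', i = i' + 1 := ⟨i - 1, by simp⟩
    rw [Γ.rot_source]
    simp [vertexAt, src_sourceEdge, collapse]
  | sink j =>
    rw [Γ.eq_of_vertexAt_sink hv, Γ.rot_sink]
    simp [vertexAt, tgt_sinkEdge, collapse]
  | inner v => rw [vertexAt, Γ.rot_inner h v hv]

theorem collapse_surjective : Function.Surjective fun h => Γ.collapse (Γ.vertexAt h) := by
  rintro (v | _ | _)
  · obtain ⟨e, he⟩ := Γ.exists_in v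
    exact ⟨.inr e, by simp [vertexAt, he, collapse]⟩
  · exact ⟨.inl (Γ.sourceEdge 0), by simp [vertexAt, src_sourceEdge, collapse]⟩
  · exact ⟨.inr (Γ.sinkEdge 0), by simp [vertexAt, tgt_sinkEdge, collapse]⟩

/-- A function on half-edges which is invariant under the rotation is constant at each vertex. -/
theorem eq_of_rot_invariant {α : Type*} {x : Γ.E ⊕ Γ.E → α} (hx : ∀ h, x (Γ.rot h) = x h)
    {h h' : Γ.E ⊕ Γ.E} (hh : Γ.vertexAt h = Γ.vertexAt h') : x h = x h' := by
  cases hv : Γ.vertexAt h with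
  | source i => rw [Γ.eq_of_vertexAt_source hv, Γ.eq_of_vertexAt_source (hh.symm.trans hv)]
  | sink j => rw [Γ.eq_of_vertexAt_sink hv, Γ.eq_of_vertexAt_sink (hh.symm.trans hv)]
  | inner v => exact eq_of_sameCycle hx (Γ.rot_cyclic h h' v hv (hh.symm.trans hv))

theorem rot_invariant_source {α : Type*} {x : Γ.E ⊕ Γ.E → α} (hx : ∀ h, x (Γ.rot h) = x h)
    (i : Fin m) : x (.inl (Γ.sourceEdge i)) = x (.inl (Γ.sourceEdge 0)) := by
  obtain ⟨k, hk⟩ := i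
  induction k with
  | zero => rfl
  | succ k ih => rw [← ih (by omega), ← hx, fin_mk_succ, Γ.rot_source]

theorem rot_invariant_sink {α : Type*} {x : Γ.E ⊕ Γ.E → α} (hx : ∀ h, x (Γ.rot h) = x h)
    (j : Fin n) : x (.inr (Γ.sinkEdge j)) = x (.inr (Γ.sinkEdge 0)) := by
  obtain ⟨k, hk⟩ := j
  induction k with
  | zero => rfl
  | succ k ih => rw [← ih (by omega), fin_mk_succ, ← Γ.rot_sink, hx]

/-- The order of the vertices along the edges. -/
def Reach : Γ.Vertex → Γ.Vertex → Prop :=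
  Relation.TransGen fun a b => ∃ e, Γ.src e = a ∧ Γ.tgt e = b

theorem finite_vertex : Finite Γ.Vertex :=
  Finite.of_surjective (fun x : Fin m ⊕ Fin n ⊕ Γ.V =>
    (match x with
      | .inl i => NetVertex.source i
      | .inr (.inl j) => NetVertex.sink j
      | .inr (.inr v) => NetVertex.inner v : NetVertex m n Γ.V)) (by
    rintro (i | j | v)
    exacts [⟨.inl i, rfl⟩, ⟨.inr (.inl j), rfl⟩, ⟨.inr (.inr v), rfl⟩])

theorem wellFounded_reach : WellFounded Γ.Reach := by
  have := Γ.finite_vertex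
  have : Std.Irrefl Γ.Reach := ⟨Γ.acyclic⟩
  have : IsTrans Γ.Vertex Γ.Reach := ⟨fun _ _ _ => Relation.TransGen.trans⟩
  exact Finite.wellFounded_of_trans_of_irrefl Γ.Reach

/-- Connectedness of the collapsed graph. By acyclicity every edge can be followed backwards to a
source, with the value unchanged at each interior vertex, and all sources lie on one collapsed
circle. -/
theorem exists_forall_eq_of_rot_invariant (u : Γ.E → ℚ)
    (hu : ∀ h, u (edgeOf (Γ.rot h)) = u (edgeOf h)) : ∃ c, ∀ e, u e = c := by
  refine ⟨u (Γ.sourceEdge 0), ?_⟩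
  suffices H : ∀ (x : Γ.Vertex) (e : Γ.E), Γ.src e = x → u e = u (Γ.sourceEdge 0) from
    fun e => H _ e rfl
  intro x
  induction x using Γ.wellFounded_reach.induction with
  | _ x ih =>
  intro e he
  match x, he with
  | .source i, he =>
    rw [(Γ.src_eq_source e i).1 he]
    exact Γ.rot_invariant_source (x := fun h => u (edgeOf h)) hu i
  | .sink j, he => exact absurd he (Γ.src_ne_sink e j)
  | .inner v, he =>
    obtain ⟨g, hg⟩ := Γ.exists_in v
    rw [← ih (Γ.src g) (.single ⟨g, rfl, hg⟩) g rfl]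
    exact Γ.eq_of_rot_invariant (x := fun h => u (edgeOf h)) hu (h := .inl e) (h' := .inr g)
      (he.trans hg.symm)

theorem rot_facePerm (h : Γ.E ⊕ Γ.E) : Γ.rot (Γ.facePerm h) = h.swap :=
  Γ.rot.apply_symm_apply _

/-- The network is drawn on a sphere: increments around the vertices which are orthogonal to the
vertices and to the faces can be integrated. -/
theorem exists_potential (b : Γ.E ⊕ Γ.E → ℚ)
    (hvert : ∀ x : Γ.E ⊕ Γ.E → ℚ, (∀ h, x (Γ.rot h) = x h) → ∑ h, b h * x h = 0)
    (hface : ∀ x : Γ.E ⊕ Γ.E → ℚ, (∀ h, x (Γ.facePerm h) = x h) → ∑ h, b h * x h = 0) :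
    ∃ u : Γ.E → ℚ, ∀ h, u (edgeOf (Γ.rot h)) - u (edgeOf h) = b h := by
  classical
  let Y := Quotient (⟨Γ.facePerm.SameCycle, Equiv.Perm.SameCycle.equivalence _⟩ :
    Setoid (Γ.E ⊕ Γ.E))
  have : Finite Y := Quotient.finite _
  have : Fintype Y := Fintype.ofFinite _
  refine exists_edge_potential Γ.rot Γ.facePerm Γ.rot_facePerm
    Γ.exists_forall_eq_of_rot_invariant _ Γ.collapse_surjective Γ.collapse_rot
    (Quotient.mk _ : _ → Y) Quotient.mk_surjective (fun h => ?_) ?_ b hvert hface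
  · exact Quotient.sound (Equiv.Perm.sameCycle_apply_left.2 (Equiv.Perm.SameCycle.refl _ _))
  -- The vertices of the sphere are `Γ.V ⊕ Bool`; the two collapsed circles account for the `2` in
  -- Euler's formula.
  · have h := Γ.euler
    change Nat.card Y + _ = _ at h
    rw [Nat.card_eq_fintype_card] at h
    rw [Fintype.card_sum, Fintype.card_bool]
    change _ ≤ _ + Fintype.card Y
    omega

/-- A function on the faces telescopes along the dual walk: crossing `k` leads from the face on the
left of `k` to the face on its right, which is on the left of `k.swap`. -/
theorem IsDualWalk.sum {l : List (Γ.E ⊕ Γ.E)} {h h' : Γ.E ⊕ Γ.E} (hl : Γ.IsDualWalk h l h')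
    {x : Γ.E ⊕ Γ.E → ℚ} (hx : ∀ h, x (Γ.facePerm h) = x h) :
    (l.map fun k => x k - x k.swap).sum = x h - x h' := by
  induction l generalizing h with
  | nil => simp [eq_of_sameCycle hx hl]
  | cons k l ih =>
    rw [List.map_cons, List.sum_cons, ih hl.2, eq_of_sameCycle hx hl.1]
    change x k - x k.swap + (x k.swap - x h') = _
    ring

end Levels

end PerfectCylindricalNetwork

theorem Sum.lawfulBEq (α β : Type*) [BEq α] [BEq β] [LawfulBEq α] [LawfulBEq β] :
    LawfulBEq (α ⊕ β) where
  rfl {a} := by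
    rcases a with a | a
    exacts [beq_self_eq_true a, beq_self_eq_true a]
  eq_of_beq {a b} h := by
    rcases a with a | a <;> rcases b with b | b
    · exact congrArg _ (eq_of_beq (α := α) h)
    · exact absurd h Bool.false_ne_true
    · exact absurd h Bool.false_ne_true
    · exact congrArg _ (eq_of_beq (α := β) h)

/-! ### Steps of a path and the existence of levels -/

namespace PerfectCylindricalNetwork

noncomputable section Levels

variable {m n : ℕ} [NeZero m] [NeZero n] {Γ : PerfectCylindricalNetwork m n} (κ : Γ.Cut)

/-- The index of a half-edge, viewed as the edge directed away from it, with the cut. -/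
def Cut.halfIndex : Γ.E ⊕ Γ.E → ℚ := Sum.elim (fun e => κ.index e) fun e => -κ.index e

/-- The index cochain is dual to the cut, so pairing it with a face function leaves only the two
faces in which the cut begins and ends. -/
theorem Cut.sum_halfIndex {x : Γ.E ⊕ Γ.E → ℚ} (hx : ∀ h, x (Γ.facePerm h) = x h) :
    ∑ h, κ.halfIndex h * x h = x (.inl (Γ.sourceEdge 0)) - x (.inl (Γ.sinkEdge 0)) := by
  classical
  rw [← IsDualWalk.sum Γ κ.isDualWalk hx, Fintype.sum_sum_type, ← Finset.sum_add_distrib]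
  simp only [Cut.halfIndex, Sum.elim_inl, Sum.elim_inr, Cut.index]
  have := Sum.lawfulBEq Γ.E Γ.E
  generalize κ.crossings = l
  induction l with
  | nil => simp
  | cons k l ih =>
    rw [List.map_cons, List.sum_cons, ← ih, ← sub_eq_iff_eq_add, ← Finset.sum_sub_distrib]
    rcases k with k | k
    · rw [Finset.sum_eq_single k]
      · simp; ring
      · intro e _ he
        simp [he.symm]
      · simp
    · rw [Finset.sum_eq_single k]
      · simp; ring
      · intro e _ he
        simp [he.symm]
      · simp

/-- The edges of a path, each with the intersection index of the preceding part of the path, from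
the last one to the first one. -/
def Cut.steps (κ : Γ.Cut) {a : Γ.Vertex} : ∀ {b : Γ.Vertex}, Quiver.Path a b → List (ℤ × Γ.E)
  | _, .nil => []
  | _, .cons p e => (κ.pathIndex p, e.1) :: κ.steps p

theorem Cut.reach_of_mem_steps {a b : Γ.Vertex} {p : Quiver.Path a b} {x : ℤ × Γ.E}
    (hx : x ∈ κ.steps p) : Γ.tgt x.2 = b ∨ Γ.Reach (Γ.tgt x.2) b := by
  induction p with
  | nil => simp [Cut.steps] at hx
  | cons p e ih =>
    rcases List.mem_cons.1 hx with rfl | hx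
    · exact .inl e.2.2
    · have he : Γ.Reach _ _ := .single ⟨e.1, e.2⟩
      rcases ih hx with h | h
      · exact .inr (h ▸ he)
      · exact .inr (h.trans he)

theorem Cut.tgt_ne_of_mem_steps {a b c : Γ.Vertex} {p : Quiver.Path a b} (e : b ⟶ c)
    {x : ℤ × Γ.E} (hx : x ∈ κ.steps p) : Γ.tgt x.2 ≠ Γ.tgt e.1 := by
  intro h
  have he : Γ.Reach b c := .single ⟨e.1, e.2⟩
  rw [e.2.2] at h
  rcases κ.reach_of_mem_steps hx with h' | h'
  · exact Γ.acyclic b (h.symm.trans h' ▸ he)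
  · rw [h] at h'; exact Γ.acyclic b (he.trans h')

theorem Cut.src_ne_of_mem_steps {a b : Γ.Vertex} {p : Quiver.Path a b}
    {x : ℤ × Γ.E} (hx : x ∈ κ.steps p) : Γ.src x.2 ≠ b := by
  intro h
  have he : Γ.Reach b (Γ.tgt x.2) := .single ⟨x.2, h, rfl⟩
  rcases κ.reach_of_mem_steps hx with h' | h'
  · rw [h'] at he; exact Γ.acyclic b he
  · exact Γ.acyclic b (he.trans h')

/-- By acyclicity a path passes through each vertex at most once, so a vertex determines both the
step of the path and its index there. -/
theorem Cut.eq_of_tgt_eq {a b : Γ.Vertex} {p : Quiver.Path a b} {x y : ℤ × Γ.E}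
    (hx : x ∈ κ.steps p) (hy : y ∈ κ.steps p) (h : Γ.tgt x.2 = Γ.tgt y.2) : x = y := by
  induction p with
  | nil => simp [Cut.steps] at hx
  | cons p e ih =>
    rcases List.mem_cons.1 hx with rfl | hx <;> rcases List.mem_cons.1 hy with rfl | hy
    · rfl
    · exact absurd h.symm (κ.tgt_ne_of_mem_steps e hy)
    · exact absurd h (κ.tgt_ne_of_mem_steps e hx)
    · exact ih hx hy

theorem Cut.eq_of_src_eq {a b : Γ.Vertex} {p : Quiver.Path a b} {x y : ℤ × Γ.E}
    (hx : x ∈ κ.steps p) (hy : y ∈ κ.steps p) (h : Γ.src x.2 = Γ.src y.2) : x = y := by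
  induction p with
  | nil => simp [Cut.steps] at hx
  | cons p e ih =>
    rcases List.mem_cons.1 hx with rfl | hx <;> rcases List.mem_cons.1 hy with rfl | hy
    · rfl
    · exact absurd (h.symm.trans e.2.1) (κ.src_ne_of_mem_steps hy)
    · exact absurd (h.trans e.2.1) (κ.src_ne_of_mem_steps hx)
    · exact ih hx hy

theorem Cut.nodup_steps {a b : Γ.Vertex} (p : Quiver.Path a b) : (κ.steps p).Nodup := by
  induction p with
  | nil => exact List.nodup_nil
  | cons p e ih => exact List.nodup_cons.2 ⟨fun h => (κ.src_ne_of_mem_steps h) e.2.1, ih⟩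

theorem Cut.exists_pred {a b : Γ.Vertex} {p : Quiver.Path a b} {y : ℤ × Γ.E}
    (hy : y ∈ κ.steps p) : (Γ.src y.2 = a ∧ y.1 = 0) ∨
      ∃ x ∈ κ.steps p, Γ.tgt x.2 = Γ.src y.2 ∧ y.1 = x.1 + κ.index x.2 := by
  induction p with
  | nil => simp [Cut.steps] at hy
  | cons p e ih =>
    rcases List.mem_cons.1 hy with rfl | hy
    · cases p with
      | nil => exact .inl ⟨e.2.1, rfl⟩
      | cons p f =>
        exact .inr ⟨(κ.pathIndex p, f.1), by simp [Cut.steps], f.2.2.trans e.2.1.symm, rfl⟩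
    · rcases ih hy with h | ⟨x, hx, h⟩
      · exact .inl h
      · exact .inr ⟨x, List.mem_cons_of_mem _ hx, h⟩

theorem Cut.exists_succ {a b : Γ.Vertex} {p : Quiver.Path a b} {x : ℤ × Γ.E}
    (hx : x ∈ κ.steps p) : (Γ.tgt x.2 = b ∧ x.1 + κ.index x.2 = κ.pathIndex p) ∨
      ∃ y ∈ κ.steps p, Γ.src y.2 = Γ.tgt x.2 ∧ y.1 = x.1 + κ.index x.2 := by
  induction p with
  | nil => simp [Cut.steps] at hx
  | cons p e ih =>
    rcases List.mem_cons.1 hx with rfl | hx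
    · exact .inl ⟨e.2.2, rfl⟩
    · rcases ih hx with h | ⟨y, hy, h⟩
      · exact .inr ⟨_, List.mem_cons_self, e.2.1.trans h.1.symm, h.2.symm⟩
      · exact .inr ⟨y, List.mem_cons_of_mem _ hy, h⟩

/-- A path is a unit flow: against a vertex function the contributions of consecutive edges cancel
at intermediate vertices. -/
theorem Cut.sum_steps_rot_invariant {a : Fin m} {c : Γ.Vertex}
    (p : Quiver.Path (Γ.source a) c) {x : Γ.E ⊕ Γ.E → ℚ} (hx : ∀ h, x (Γ.rot h) = x h)
    {h : Γ.E ⊕ Γ.E} (hh : Γ.vertexAt h = c) :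
    ((κ.steps p).map fun y => x (.inl y.2) - x (.inr y.2)).sum =
      x (.inl (Γ.sourceEdge a)) - x h := by
  induction p generalizing h with
  | nil => rw [Γ.eq_of_vertexAt_source hh]; simp [Cut.steps]
  | cons p e ih =>
    have h1 : x (.inr e.1) = x h := Γ.eq_of_rot_invariant hx (e.2.2.trans hh.symm)
    rw [Cut.steps, List.map_cons, List.sum_cons, ih (h := .inl e.1) e.2.1, ← h1]
    ring

open Classical in
/-- The indicator function of the edges of a path. -/
def Cut.onPath {a b : Γ.Vertex} (p : Quiver.Path a b) (e : Γ.E) : ℚ :=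
  if ∃ x ∈ κ.steps p, x.2 = e then 1 else 0

theorem Cut.sum_onPath {a b : Γ.Vertex} (p : Quiver.Path a b) (f : Γ.E → ℚ) :
    ∑ e, κ.onPath p e * f e = ((κ.steps p).map fun y => f y.2).sum := by
  classical
  rw [← List.sum_toFinset _ (κ.nodup_steps p), ← Finset.sum_image (g := Prod.snd)]
  · simp only [Cut.onPath, ite_mul, one_mul, zero_mul]
    rw [← Finset.sum_filter]
    congr 1
    ext e
    simp
  · intro x hx y hy hxy
    exact κ.eq_of_src_eq (List.mem_toFinset.1 hx) (List.mem_toFinset.1 hy) (by rw [hxy])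

open Classical in
/-- The passage of the cut between the last and the first source, or sink. -/
def seam (Γ : PerfectCylindricalNetwork m n) (h : Γ.E ⊕ Γ.E) : ℚ :=
  (if h = .inl (Γ.sourceEdge 0) then 1 else 0) - if Γ.rot h = .inr (Γ.sinkEdge 0) then 1 else 0

theorem sum_seam (x : Γ.E ⊕ Γ.E → ℚ) : ∑ h, Γ.seam h * x h =
    x (.inl (Γ.sourceEdge 0)) - x (Γ.rot.symm (.inr (Γ.sinkEdge 0))) := by
  classical
  simp only [seam, sub_mul, Finset.sum_sub_distrib, ite_mul, one_mul, zero_mul,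
    ← Equiv.eq_symm_apply]
  simp

/-- The levels of the two sides of the half-edges with respect to a path `p`: the lifts of `p` to
the universal cover of the cylinder divide it into strips, which are numbered from bottom to
top. -/
structure Cut.Levels {a : Fin m} {b : Fin n} (p : Quiver.Path (Γ.source a) (Γ.sink b)) where
  /-- the level on the left of a half-edge, at its vertex -/
  left : Γ.E ⊕ Γ.E → ℚ
  /-- the level on the right of a half-edge, at its vertex -/
  right : Γ.E ⊕ Γ.E → ℚ
  right_inl : ∀ e, right (.inl e) = left (.inl e) - κ.onPath p e
  left_inr : ∀ e, left (.inr e) = right (.inl e) - κ.index e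
  right_inr : ∀ e, right (.inr e) = left (.inl e) - κ.index e
  right_rot : ∀ h, right (Γ.rot h) = left h - Γ.seam h
  left_source : left (.inl (Γ.sourceEdge a)) = 0

/-- The prescribed increments combine the flow of `p`, the intersections with the cut, and a
correction where the cut leaves the boundary circles. They are orthogonal to vertex functions
because `p` and the seam both run from the left circle to the right one, and to face functions
because the cut and the seam have the same end faces. -/
theorem Cut.nonempty_levels {a : Fin m} {b : Fin n}
    (p : Quiver.Path (Γ.source a) (Γ.sink b)) : Nonempty (κ.Levels p) := by
  -- The relations along a single edge determine its four levels from one unknown `u e`, the left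
  -- level at its tail; `l` and `r` are the offsets. Only the relations across the corners remain.
  -- The additive constant is fixed at source `a`.
  let l : Γ.E ⊕ Γ.E → ℚ := Sum.elim (fun _ => 0) fun e => -κ.onPath p e - κ.index e
  let r : Γ.E ⊕ Γ.E → ℚ := Sum.elim (fun e => -κ.onPath p e) fun e => -κ.index e
  suffices h : ∃ u : Γ.E → ℚ, ∀ h, u (edgeOf (Γ.rot h)) - u (edgeOf h) =
      l h - r (Γ.rot h) - Γ.seam h by
    obtain ⟨u, hu⟩ := h
    refine ⟨⟨fun h => u (edgeOf h) + l h - u (Γ.sourceEdge a),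
      fun h => u (edgeOf h) + r h - u (Γ.sourceEdge a), ?_, ?_, ?_, ?_, ?_⟩⟩
    · intro e; simp [l, r]; ring
    · intro e; simp [l, r]; ring
    · intro e; simp [l, r]; ring
    · intro h; linarith [hu h]
    · simp [l]
  refine Γ.exists_potential _ ?_ ?_
  -- Vertex functions: the jump `l - r` at the half-edges is the flow of `p`, cancelled by the seam
  -- since `x` is constant on each boundary circle.
  · intro x hx
    have h1 : ∑ h, r (Γ.rot h) * x h = ∑ h, r h * x h := by
      rw [← Equiv.sum_comp Γ.rot fun h => r h * x h]
      simp only [hx]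
    have h2 : ∑ h, (l h - r h) * x h = x (.inl (Γ.sourceEdge a)) - x (.inr (Γ.sinkEdge b)) := by
      rw [← κ.sum_steps_rot_invariant p hx (h := .inr (Γ.sinkEdge b)) (Γ.tgt_sinkEdge b),
        ← κ.sum_onPath p fun e => x (.inl e) - x (.inr e), Fintype.sum_sum_type,
        ← Finset.sum_add_distrib]
      refine Finset.sum_congr rfl fun e _ => ?_
      simp [l, r]; ring
    have h3 : x (Γ.rot.symm (.inr (Γ.sinkEdge 0))) = x (.inr (Γ.sinkEdge 0)) := by
      rw [← hx, Equiv.apply_symm_apply]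
    simp only [sub_mul, Finset.sum_sub_distrib] at h2 ⊢
    rw [h1, h2, sum_seam, Γ.rot_invariant_source hx, Γ.rot_invariant_sink hx, h3, sub_self]
  -- Face functions: `rot (facePerm h) = h.swap`, so the two sides of an edge are compared at its
  -- opposite ends. The contribution of `p` drops out and the index with the cut remains.
  · intro x hx
    have h1 : ∑ h, r (Γ.rot h) * x h = ∑ h, r h.swap * x h := by
      rw [← Equiv.sum_comp Γ.facePerm]
      simp only [hx, Γ.rot_facePerm]
    have h2 : ∑ h, (l h - r h.swap) * x h = ∑ h, κ.halfIndex h * x h := by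
      refine Finset.sum_congr rfl fun h _ => ?_
      rcases h with e | e
      · simp [l, r, Cut.halfIndex]
      · simp [l, r, Cut.halfIndex]; ring
    have h3 : x (Γ.rot.symm (.inr (Γ.sinkEdge 0))) = x (.inl (Γ.sinkEdge 0)) :=
      hx (.inl (Γ.sinkEdge 0))
    rw [κ.sum_halfIndex hx] at h2
    simp only [sub_mul, Finset.sum_sub_distrib] at h2 ⊢
    rw [h1, h2, sum_seam, h3, sub_self]

end Levels

end PerfectCylindricalNetwork

/-! ### Levels along a path -/

/-- The sign of a rational number, as an element of a field. -/
def signIn (𝕜 : Type*) [Field 𝕜] (x : ℚ) : 𝕜 := (SignType.sign x : SignType)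

theorem signIn_pos {𝕜 : Type*} [Field 𝕜] {x : ℚ} (hx : 0 < x) : signIn 𝕜 x = 1 := by
  simp [signIn, sign_pos hx]

theorem signIn_neg {𝕜 : Type*} [Field 𝕜] {x : ℚ} (hx : x < 0) : signIn 𝕜 x = -1 := by
  simp [signIn, sign_neg hx]

theorem signIn_zero {𝕜 : Type*} [Field 𝕜] : signIn 𝕜 0 = 0 := by
  simp [signIn]

/-- Between an integer and the next half-integer the sign changes only at `0`. This is how a
condition that two indices agree becomes a difference of signs. -/
theorem signIn_add_half {𝕜 : Type*} [Field 𝕜] (z : ℤ) :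
    signIn 𝕜 (z + 1 / 2) - signIn 𝕜 z = if z = 0 then 1 else 0 := by
  rcases lt_trichotomy z 0 with h | rfl | h
  · have : (z : ℚ) ≤ -1 := by exact_mod_cast Int.le_sub_one_of_lt h
    rw [signIn_neg (by linarith), signIn_neg (by linarith), if_neg h.ne, sub_self]
  · rw [Int.cast_zero, signIn_pos (by norm_num), signIn_zero]; simp
  · have : (1 : ℚ) ≤ z := by exact_mod_cast h
    rw [signIn_pos (by linarith), signIn_pos (by linarith), if_neg h.ne', sub_self]

theorem signIn_sub_half {𝕜 : Type*} [Field 𝕜] (z : ℤ) :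
    signIn 𝕜 (z - 1 / 2) - signIn 𝕜 z = if z = 0 then -1 else 0 := by
  rcases lt_trichotomy z 0 with h | rfl | h
  · have : (z : ℚ) ≤ -1 := by exact_mod_cast Int.le_sub_one_of_lt h
    rw [signIn_neg (by linarith), signIn_neg (by linarith), if_neg h.ne, sub_self]
  · rw [Int.cast_zero, signIn_neg (by norm_num), signIn_zero]; simp
  · have : (1 : ℚ) ≤ z := by exact_mod_cast h
    rw [signIn_pos (by linarith), signIn_pos (by linarith), if_neg h.ne', sub_self]

theorem List.sum_map_eq_of_nodup {α M : Type*} [AddCommMonoid M] {l : List α} (hl : l.Nodup)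
    {a : α} (ha : a ∈ l) {f : α → M} (hf : ∀ b ∈ l, b ≠ a → f b = 0) : (l.map f).sum = f a := by
  classical
  rw [← List.sum_toFinset _ hl]
  exact Finset.sum_eq_single a (fun b hb => hf b (List.mem_toFinset.1 hb))
    fun h => absurd (List.mem_toFinset.2 ha) h

namespace PerfectCylindricalNetwork

noncomputable section Levels

variable {m n : ℕ} [NeZero m] [NeZero n] {Γ : PerfectCylindricalNetwork m n} {κ : Γ.Cut}

theorem vertexAt_rot {h : Γ.E ⊕ Γ.E} {v : Γ.V} (hv : Γ.vertexAt h = .inner v) :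
    Γ.vertexAt (Γ.rot h) = .inner v :=
  Γ.rot_inner h v hv

theorem ncard_halfEdges (v : Γ.V) : {h | Γ.vertexAt h = .inner v}.ncard = 3 :=
  Γ.trivalent v

/-- The rotation is transitive on the three half-edges at an interior vertex, so it has neither a
fixed point nor a 2-cycle there. Hence it is a 3-cycle. -/
theorem rot_ne {h : Γ.E ⊕ Γ.E} {v : Γ.V} (hv : Γ.vertexAt h = .inner v) : Γ.rot h ≠ h := by
  intro hh
  have hsub : {k | Γ.vertexAt k = .inner v} ⊆ {h} := fun k hk => by
    have := Γ.eq_of_rot_invariant (x := fun k => k = h)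
      (fun k => by rw [← Γ.rot.apply_eq_iff_eq (x := k), hh]) (hk.trans hv.symm)
    exact this.mpr rfl
  have := Set.ncard_le_ncard hsub
  rw [ncard_halfEdges, Set.ncard_singleton] at this
  omega

theorem rot_rot_ne {h : Γ.E ⊕ Γ.E} {v : Γ.V} (hv : Γ.vertexAt h = .inner v) :
    Γ.rot (Γ.rot h) ≠ h := by
  intro hh
  have hsub : {k | Γ.vertexAt k = .inner v} ⊆ {h, Γ.rot h} := fun k hk => by
    have := Γ.eq_of_rot_invariant (x := fun k => k = h ∨ k = Γ.rot h) (fun k => by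
      rw [← Γ.rot.apply_eq_iff_eq (x := k), ← Γ.rot.apply_eq_iff_eq (x := k) (y := Γ.rot h), hh,
        or_comm]) (hk.trans hv.symm)
    exact this.mpr (.inl rfl)
  have := Set.ncard_le_ncard hsub
  have h2 := Set.ncard_insert_le h {Γ.rot h}
  rw [Set.ncard_singleton] at h2
  rw [ncard_halfEdges] at this
  omega

theorem eq_rot_or_eq_rot_rot {h k : Γ.E ⊕ Γ.E} {v : Γ.V} (hv : Γ.vertexAt h = .inner v)
    (hk : Γ.vertexAt k = .inner v) : k = h ∨ k = Γ.rot h ∨ k = Γ.rot (Γ.rot h) := by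
  have hsub : {h, Γ.rot h, Γ.rot (Γ.rot h)} ⊆ {k | Γ.vertexAt k = .inner v} := by
    rintro _ (rfl | rfl | rfl)
    exacts [hv, vertexAt_rot hv, vertexAt_rot (vertexAt_rot hv)]
  have h3 : ({h, Γ.rot h, Γ.rot (Γ.rot h)} : Set (Γ.E ⊕ Γ.E)).ncard = 3 :=
    Set.ncard_eq_three.2 ⟨_, _, _, (rot_ne hv).symm, (rot_rot_ne hv).symm,
      (rot_ne (vertexAt_rot hv)).symm, rfl⟩
  have := Set.eq_of_subset_of_ncard_le hsub (by rw [h3, ncard_halfEdges])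
  exact this.symm.subset hk

theorem rot_rot_rot {h : Γ.E ⊕ Γ.E} {v : Γ.V} (hv : Γ.vertexAt h = .inner v) :
    Γ.rot (Γ.rot (Γ.rot h)) = h := by
  have hv' := vertexAt_rot hv
  rcases eq_rot_or_eq_rot_rot hv (vertexAt_rot (vertexAt_rot hv')) with h' | h' | h'
  · exact h'
  · exact absurd h' (rot_rot_ne hv')
  · exact absurd h' (rot_ne (vertexAt_rot hv'))

theorem exists_inner_of_tgt_eq_src {e f : Γ.E} (h : Γ.tgt e = Γ.src f) :
    ∃ v, Γ.tgt e = .inner v ∧ Γ.src f = .inner v := by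
  rw [h]
  cases hs : Γ.src f with
  | source i => exact absurd (h.trans hs) (Γ.tgt_ne_source _ _)
  | sink j => exact absurd hs (Γ.src_ne_sink _ _)
  | inner v => exact ⟨v, rfl, rfl⟩

theorem seam_eq_zero {h : Γ.E ⊕ Γ.E} {v : Γ.V} (hv : Γ.vertexAt h = .inner v) :
    Γ.seam h = 0 := by
  have h1 : h ≠ .inl (Γ.sourceEdge 0) := by
    rintro rfl
    rw [vertexAt, Sum.elim_inl, Γ.src_sourceEdge] at hv
    simp at hv
  have h2 : Γ.rot h ≠ .inr (Γ.sinkEdge 0) := by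
    intro h2
    have := vertexAt_rot hv
    rw [h2, vertexAt, Sum.elim_inr, Γ.tgt_sinkEdge] at this
    simp at this
  rw [seam, if_neg h1, if_neg h2, sub_zero]

theorem Cut.onPath_eq_one {a b : Γ.Vertex} {p : Quiver.Path a b} {x : ℤ × Γ.E}
    (hx : x ∈ κ.steps p) : κ.onPath p x.2 = 1 :=
  if_pos ⟨x, hx, rfl⟩

theorem Cut.onPath_eq_zero_of_src {a b : Γ.Vertex} {p : Quiver.Path a b} {x : ℤ × Γ.E} {e : Γ.E}
    (hx : x ∈ κ.steps p) (he : Γ.src e = Γ.src x.2) (hne : e ≠ x.2) : κ.onPath p e = 0 := by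
  refine if_neg ?_
  rintro ⟨y, hy, rfl⟩
  exact hne (congrArg _ (κ.eq_of_src_eq hy hx he))

theorem Cut.onPath_eq_zero_of_tgt {a b : Γ.Vertex} {p : Quiver.Path a b} {x : ℤ × Γ.E} {e : Γ.E}
    (hx : x ∈ κ.steps p) (he : Γ.tgt e = Γ.tgt x.2) (hne : e ≠ x.2) : κ.onPath p e = 0 := by
  refine if_neg ?_
  rintro ⟨y, hy, rfl⟩
  exact hne (congrArg _ (κ.eq_of_tgt_eq hy hx he))

variable {a : Fin m} {b : Fin n} {p : Quiver.Path (Γ.source a) (Γ.sink b)}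

/-- At a vertex through which `p` passes, the third half-edge is not on `p`, so crossing it does not
change the level. -/
theorem Cut.Levels.left_eq_right (Λ : κ.Levels p) {x y : ℤ × Γ.E} (hx : x ∈ κ.steps p)
    (hy : y ∈ κ.steps p) {h : Γ.E ⊕ Γ.E} (h1 : Γ.vertexAt h = Γ.tgt x.2)
    (h2 : Γ.vertexAt h = Γ.src y.2) (hhx : h ≠ .inr x.2) (hhy : h ≠ .inl y.2) :
    Λ.left h = Λ.right h := by
  rcases h with e | e
  · rw [Λ.right_inl, κ.onPath_eq_zero_of_src hy h2 (fun h => hhy (congrArg _ h)), sub_zero]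
  · rw [Λ.right_inr, Λ.left_inr, Λ.right_inl,
      κ.onPath_eq_zero_of_tgt hx h1 (fun h => hhx (congrArg _ h)), sub_zero]

theorem Cut.Levels.right_rot_inner (Λ : κ.Levels p) {h : Γ.E ⊕ Γ.E} {v : Γ.V}
    (hv : Γ.vertexAt h = .inner v) : Λ.right (Γ.rot h) = Λ.left h := by
  rw [Λ.right_rot, seam_eq_zero hv, sub_zero]

/-- Both sides are the level just to the left of `p` at the vertex. The third half-edge lies either
on the right of `p`, and the two corners coincide, or on the left, and the level passes across it
unchanged. -/
theorem Cut.Levels.left_succ (Λ : κ.Levels p) {x y : ℤ × Γ.E} (hx : x ∈ κ.steps p)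
    (hy : y ∈ κ.steps p) {v : Γ.V} (hxv : Γ.tgt x.2 = .inner v) (hyv : Γ.src y.2 = .inner v) :
    Λ.left (.inl y.2) = Λ.right (.inr x.2) := by
  have hv : Γ.vertexAt (.inl y.2) = .inner v := hyv
  have hv' : Γ.vertexAt (.inr x.2) = .inner v := hxv
  rcases eq_rot_or_eq_rot_rot hv hv' with h | h | h
  · simp at h
  · rw [h, Λ.right_rot_inner hv]
  · rw [h, Λ.right_rot_inner (vertexAt_rot hv), Λ.left_eq_right hx hy
      ((vertexAt_rot hv).trans hxv.symm) ((vertexAt_rot hv).trans hyv.symm) ?_ (rot_ne hv),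
      Λ.right_rot_inner hv]
    rw [h]
    exact (rot_ne (vertexAt_rot hv)).symm

/-- The left side of `p` keeps its level through the vertices and changes only by the index with the
cut, starting from `0` at the source. -/
theorem Cut.Levels.left_of_mem_steps (Λ : κ.Levels p) {x : ℤ × Γ.E} (hx : x ∈ κ.steps p) :
    Λ.left (.inl x.2) = -x.1 := by
  -- The induction runs over initial segments `q`, while the levels stay attached to the whole path
  -- `p`.
  suffices H : ∀ {c : Γ.Vertex} (q : Quiver.Path (Γ.source a) c),
      (∀ x ∈ κ.steps q, x ∈ κ.steps p) → ∀ x ∈ κ.steps q, Λ.left (.inl x.2) = -x.1 from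
    H p (fun _ => id) x hx
  intro c q
  induction q with
  | nil => intro _ x hx; simp [Cut.steps] at hx
  | cons q e ih =>
    intro hq x hx
    rcases List.mem_cons.1 hx with rfl | hx
    · cases q with
      | nil =>
        rw [(Γ.src_eq_source e.1 a).1 e.2.1, Λ.left_source]
        simp [Cut.pathIndex]
      | @cons c _ q f =>
        have h1 := ih (fun x hx => hq x (List.mem_cons_of_mem _ hx)) (κ.pathIndex q, f.1)
          List.mem_cons_self
        have hm : (κ.pathIndex q, f.1) ∈ κ.steps p :=
          hq _ (List.mem_cons_of_mem _ List.mem_cons_self)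
        have he := hq _ hx
        obtain ⟨v, hf, hs⟩ := exists_inner_of_tgt_eq_src (f.2.2.trans e.2.1.symm)
        rw [Λ.left_succ hm he hf hs, Λ.right_inr, h1]
        simp [Cut.pathIndex]; ring
    · exact ih (fun x hx => hq x (List.mem_cons_of_mem _ hx)) x hx

/-- The level in the middle of an edge at a half-edge, with the lifts of `p` at the integers. -/
def Cut.Levels.mid (Λ : κ.Levels p) (h : Γ.E ⊕ Γ.E) : ℚ := (Λ.left h + Λ.right h + 1) / 2

theorem Cut.Levels.mid_inr (Λ : κ.Levels p) (e : Γ.E) :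
    Λ.mid (.inr e) = Λ.mid (.inl e) - κ.index e := by
  rw [Cut.Levels.mid, Cut.Levels.mid, Λ.left_inr, Λ.right_inr]; ring

end Levels

/-! ### The local double brackets as changes of level -/

noncomputable section TorusLevels

variable {N : ℕ} [NeZero N] {Γ : PerfectCylindricalNetwork N N} {κ : Γ.Cut} {a b : Fin N}
  {p : Quiver.Path (Γ.source a) (Γ.sink b)}

/-- The sum of the coefficients of the double brackets of the edges of a path with an edge `e` at
the tail of `e`, if the path passes there with index `z`. -/
def Cut.whiteSum (𝕜 : Type*) [Field 𝕜] (κ : Γ.Cut) {a b : Γ.Vertex} (p : Quiver.Path a b)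
    (e : Γ.E) (z : ℤ) : 𝕜 :=
  ((κ.steps p).map fun x => if x.1 = z then Γ.whiteCoeff 𝕜 x.2 e else 0).sum

/-- The sum of the coefficients of the double brackets of an edge `e` with the edges of a path at
the head of `e`, if the path passes there with index `z`. -/
def Cut.blackSum (𝕜 : Type*) [Field 𝕜] (κ : Γ.Cut) {a b : Γ.Vertex} (p : Quiver.Path a b)
    (e : Γ.E) (z : ℤ) : 𝕜 :=
  ((κ.steps p).map fun x => if x.1 + κ.index x.2 = z then Γ.blackCoeff 𝕜 e x.2 else 0).sum

theorem whiteCoeff_eq_zero (𝕜 : Type*) [Field 𝕜] {e f : Γ.E} (h : Γ.src e ≠ Γ.src f) :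
    Γ.whiteCoeff 𝕜 e f = 0 :=
  if_neg fun ⟨_, h1, h2⟩ => h (h1.trans h2.symm)

theorem blackCoeff_eq_zero (𝕜 : Type*) [Field 𝕜] {e f : Γ.E} (h : Γ.tgt e ≠ Γ.tgt f) :
    Γ.blackCoeff 𝕜 e f = 0 :=
  if_neg fun ⟨_, h1, h2⟩ => h (h1.trans h2.symm)

theorem Cut.whiteSum_eq_zero (𝕜 : Type*) [Field 𝕜] {a b : Γ.Vertex} {p : Quiver.Path a b}
    {e : Γ.E} (h : ∀ x ∈ κ.steps p, Γ.src x.2 ≠ Γ.src e) (z : ℤ) : κ.whiteSum 𝕜 p e z = 0 := by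
  refine List.sum_eq_zero fun t ht => ?_
  obtain ⟨x, hx, rfl⟩ := List.mem_map.1 ht
  rw [whiteCoeff_eq_zero 𝕜 (h x hx), ite_self]

theorem Cut.blackSum_eq_zero (𝕜 : Type*) [Field 𝕜] {a b : Γ.Vertex} {p : Quiver.Path a b}
    {e : Γ.E} (h : ∀ x ∈ κ.steps p, Γ.tgt x.2 ≠ Γ.tgt e) (z : ℤ) : κ.blackSum 𝕜 p e z = 0 := by
  refine List.sum_eq_zero fun t ht => ?_
  obtain ⟨x, hx, rfl⟩ := List.mem_map.1 ht
  rw [blackCoeff_eq_zero 𝕜 (h x hx).symm, ite_self]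

theorem Cut.whiteSum_eq (𝕜 : Type*) [Field 𝕜] {a b : Γ.Vertex} {p : Quiver.Path a b}
    {e : Γ.E} {x : ℤ × Γ.E} (hx : x ∈ κ.steps p) (h : Γ.src x.2 = Γ.src e) (z : ℤ) :
    κ.whiteSum 𝕜 p e z = if x.1 = z then Γ.whiteCoeff 𝕜 x.2 e else 0 := by
  refine List.sum_map_eq_of_nodup (κ.nodup_steps p) hx fun y hy hyx => ?_
  rw [whiteCoeff_eq_zero 𝕜 fun hye => hyx (κ.eq_of_src_eq hy hx (hye.trans h.symm)), ite_self]

theorem Cut.blackSum_eq (𝕜 : Type*) [Field 𝕜] {a b : Γ.Vertex} {p : Quiver.Path a b}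
    {e : Γ.E} {x : ℤ × Γ.E} (hx : x ∈ κ.steps p) (h : Γ.tgt x.2 = Γ.tgt e) (z : ℤ) :
    κ.blackSum 𝕜 p e z = if x.1 + κ.index x.2 = z then Γ.blackCoeff 𝕜 e x.2 else 0 := by
  refine List.sum_map_eq_of_nodup (κ.nodup_steps p) hx fun y hy hyx => ?_
  rw [blackCoeff_eq_zero 𝕜 fun hye => hyx (κ.eq_of_tgt_eq hy hx (hye.symm.trans h.symm)),
    ite_self]

theorem whiteCoeff_eq_half (𝕜 : Type*) [Field 𝕜] {e f : Γ.E} {v : Γ.V} (he : Γ.src e = .inner v)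
    (hf : Γ.src f = .inner v) (h : Γ.rot (.inl e) = .inl f) : Γ.whiteCoeff 𝕜 e f = 1 / 2 := by
  rw [whiteCoeff, if_pos ⟨v, he, hf⟩, if_pos h]

theorem whiteCoeff_eq_neg_half (𝕜 : Type*) [Field 𝕜] {e f : Γ.E} {v : Γ.V}
    (he : Γ.src e = .inner v) (hf : Γ.src f = .inner v) (h : Γ.rot (.inl f) = .inl e) :
    Γ.whiteCoeff 𝕜 e f = -1 / 2 := by
  rw [whiteCoeff, if_pos ⟨v, he, hf⟩, if_neg, if_pos h]
  intro h'
  exact rot_rot_ne (h := .inl e) he (h' ▸ h)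

theorem blackCoeff_eq_neg_half (𝕜 : Type*) [Field 𝕜] {e f : Γ.E} {v : Γ.V}
    (he : Γ.tgt e = .inner v) (hf : Γ.tgt f = .inner v) (h : Γ.rot (.inr e) = .inr f) :
    Γ.blackCoeff 𝕜 e f = -1 / 2 := by
  rw [blackCoeff, if_pos ⟨v, he, hf⟩, if_pos h]

theorem blackCoeff_eq_half (𝕜 : Type*) [Field 𝕜] {e f : Γ.E} {v : Γ.V}
    (he : Γ.tgt e = .inner v) (hf : Γ.tgt f = .inner v) (h : Γ.rot (.inr f) = .inr e) :
    Γ.blackCoeff 𝕜 e f = 1 / 2 := by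
  rw [blackCoeff, if_pos ⟨v, he, hf⟩, if_neg, if_pos h]
  intro h'
  exact rot_rot_ne (h := .inr e) he (h' ▸ h)

theorem whiteCoeff_self (𝕜 : Type*) [Field 𝕜] (e : Γ.E) : Γ.whiteCoeff 𝕜 e e = 0 := by
  rw [whiteCoeff]
  split_ifs with h1 h2
  · obtain ⟨v, hv, _⟩ := h1
    exact absurd h2 (rot_ne (h := .inl e) hv)
  all_goals rfl

theorem blackCoeff_self (𝕜 : Type*) [Field 𝕜] (e : Γ.E) : Γ.blackCoeff 𝕜 e e = 0 := by
  rw [blackCoeff]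
  split_ifs with h1 h2
  · obtain ⟨v, hv, _⟩ := h1
    exact absurd h2 (rot_ne (h := .inr e) hv)
  all_goals rfl

/-- A vertex `v` has level `α` with respect to a path `p` if the double brackets at `v` of the
edges of `p` with another path passing through `v` with index `z` measure the changes of the side
of `p` on which the other path runs. -/
structure Cut.Levels.IsLevel (𝕜 : Type*) [Field 𝕜] (Λ : κ.Levels p) (v : NetVertex N N Γ.V)
    (α : ℚ) : Prop where
  whiteSum_eq : ∀ e, Γ.src e = v → ∀ z : ℤ,
    κ.whiteSum 𝕜 p e z = (signIn 𝕜 (Λ.mid (.inl e) + z) - signIn 𝕜 (α + z)) / 2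
  blackSum_eq : ∀ e, Γ.tgt e = v → ∀ z : ℤ,
    κ.blackSum 𝕜 p e z = (signIn 𝕜 (α + z) - signIn 𝕜 (Λ.mid (.inr e) + z)) / 2

theorem Cut.Levels.isLevel_source (𝕜 : Type*) [Field 𝕜] (Λ : κ.Levels p) (i : Fin N) :
    Λ.IsLevel 𝕜 (.source i) (Λ.mid (.inl (Γ.sourceEdge i))) where
  whiteSum_eq e he z := by
    rw [(Γ.src_eq_source e i).1 he, sub_self, zero_div]
    refine List.sum_eq_zero fun t ht => ?_
    obtain ⟨x, hx, rfl⟩ := List.mem_map.1 ht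
    have h : Γ.whiteCoeff 𝕜 x.2 (Γ.sourceEdge i) = 0 := by
      refine if_neg ?_
      rintro ⟨v, _, hv⟩
      rw [Γ.src_sourceEdge] at hv
      simp at hv
    rw [h, ite_self]
  blackSum_eq e he := absurd he (Γ.tgt_ne_source e i)

theorem Cut.Levels.isLevel_sink (𝕜 : Type*) [Field 𝕜] (Λ : κ.Levels p) (j : Fin N) :
    Λ.IsLevel 𝕜 (.sink j) (Λ.mid (.inr (Γ.sinkEdge j))) where
  whiteSum_eq e he := absurd he (Γ.src_ne_sink e j)
  blackSum_eq e he z := by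
    rw [(Γ.tgt_eq_sink e j).1 he, sub_self, zero_div]
    refine List.sum_eq_zero fun t ht => ?_
    obtain ⟨x, hx, rfl⟩ := List.mem_map.1 ht
    have h : Γ.blackCoeff 𝕜 (Γ.sinkEdge j) x.2 = 0 := by
      refine if_neg ?_
      rintro ⟨v, hv, _⟩
      rw [Γ.tgt_sinkEdge] at hv
      simp at hv
    rw [h, ite_self]

/-- On `p` itself the middle level is the integer `-y.1`, and on the third half-edge it is half a
unit higher or lower, according to the side of `p`. The sign of the level plus `z` therefore changes
exactly for `z = y.1`, in the direction given by the cyclic order that also determines the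
coefficient `± 1 / 2`. -/
theorem Cut.Levels.isLevel_of_mem_steps (𝕜 : Type*) [Field 𝕜] (Λ : κ.Levels p) {v : Γ.V}
    {x y : ℤ × Γ.E} (hx : x ∈ κ.steps p) (hy : y ∈ κ.steps p) (hxv : Γ.tgt x.2 = .inner v)
    (hyv : Γ.src y.2 = .inner v) (hxy : y.1 = x.1 + κ.index x.2) :
    Λ.IsLevel 𝕜 (.inner v) (-y.1) := by
  have hx' : Γ.vertexAt (.inr x.2) = .inner v := hxv
  have hy' : Γ.vertexAt (.inl y.2) = .inner v := hyv
  have l1 : Λ.left (.inl y.2) = -y.1 := Λ.left_of_mem_steps hy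
  have r1 : Λ.right (.inl y.2) = -y.1 - 1 := by rw [Λ.right_inl, Cut.onPath_eq_one hy, l1]
  have l2 : Λ.left (.inr x.2) = -y.1 - 1 := by
    rw [Λ.left_inr, Λ.right_inl, Cut.onPath_eq_one hx, Λ.left_of_mem_steps hx, hxy]
    push_cast; ring
  have m1 : Λ.mid (.inl y.2) = -y.1 := by rw [Cut.Levels.mid, l1, r1]; ring
  have m2 : Λ.mid (.inr x.2) = -y.1 := by
    rw [Λ.mid_inr, Cut.Levels.mid, Λ.right_inl, Cut.onPath_eq_one hx, Λ.left_of_mem_steps hx,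
      hxy]
    push_cast; ring
  -- The first alternative is a third half-edge on the left of `p`, the second one on the right.
  have key : ∀ h, Γ.vertexAt h = .inner v → h ≠ .inl y.2 → h ≠ .inr x.2 →
      (Γ.rot (.inl y.2) = h ∧ Γ.rot h = .inr x.2 ∧ Λ.mid h = -y.1 + 1 / 2) ∨
      (Γ.rot (.inr x.2) = h ∧ Γ.rot h = .inl y.2 ∧ Λ.mid h = -y.1 - 1 / 2) := by
    intro h hv hhy hhx
    have hlr := Λ.left_eq_right hx hy (hv.trans hxv.symm) (hv.trans hyv.symm) hhx hhy
    rcases eq_rot_or_eq_rot_rot hv hy' with h1 | h1 | h1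
    · exact absurd h1.symm hhy
    · rcases eq_rot_or_eq_rot_rot hv hx' with h2 | h2 | h2
      · exact absurd h2.symm hhx
      · rw [← h2] at h1; simp at h1
      · have h3 : Γ.rot (.inr x.2) = h := by rw [h2, rot_rot_rot hv]
        refine .inr ⟨h3, h1.symm, ?_⟩
        have := Λ.right_rot_inner hx'
        rw [h3, l2] at this
        rw [Cut.Levels.mid, hlr, this]; ring
    · rcases eq_rot_or_eq_rot_rot hv hx' with h2 | h2 | h2
      · exact absurd h2.symm hhx
      · have h3 : Γ.rot (.inl y.2) = h := by rw [h1, rot_rot_rot hv]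
        refine .inl ⟨h3, h2.symm, ?_⟩
        have := Λ.right_rot_inner hy'
        rw [h3, l1] at this
        rw [Cut.Levels.mid, hlr, this]; ring
      · rw [← h2] at h1; simp at h1
  have e1 : ∀ z : ℤ, -(y.1 : ℚ) + z = (z - y.1 : ℤ) := fun z => by push_cast; ring
  have e2 : ∀ z : ℤ, -(y.1 : ℚ) + 1 / 2 + z = (z - y.1 : ℤ) + 1 / 2 := fun z => by
    push_cast; ring
  have e3 : ∀ z : ℤ, -(y.1 : ℚ) - 1 / 2 + z = (z - y.1 : ℤ) - 1 / 2 := fun z => by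
    push_cast; ring
  have e4 : ∀ z : ℤ, y.1 = z ↔ z - y.1 = 0 := fun z => by omega
  constructor
  · intro e he z
    rw [Cut.whiteSum_eq 𝕜 hy (hyv.trans he.symm)]
    simp only [e4]
    by_cases hey : e = y.2
    · rw [hey, whiteCoeff_self, m1, sub_self, zero_div, ite_self]
    rcases key (.inl e) he (fun h => hey (Sum.inl_injective h)) (by simp) with
      ⟨h1, h2, h3⟩ | ⟨h1, h2, h3⟩
    · rw [h3, whiteCoeff_eq_half 𝕜 hyv he h1, e1, e2, signIn_add_half]
      split_ifs <;> simp
    · rw [h3, whiteCoeff_eq_neg_half 𝕜 hyv he h2, e1, e3, signIn_sub_half]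
      split_ifs <;> simp
  · intro e he z
    rw [Cut.blackSum_eq 𝕜 hx (hxv.trans he.symm), ← hxy]
    simp only [e4]
    by_cases hex : e = x.2
    · rw [hex, blackCoeff_self, m2, sub_self, zero_div, ite_self]
    rcases key (.inr e) he (by simp) (fun h => hex (Sum.inr_injective h)) with
      ⟨h1, h2, h3⟩ | ⟨h1, h2, h3⟩
    · rw [h3, blackCoeff_eq_neg_half 𝕜 he hxv h2, e1, e2, ← neg_sub (signIn 𝕜 _) (signIn 𝕜 _), signIn_add_half]
      split_ifs <;> simp
    · rw [h3, blackCoeff_eq_half 𝕜 he hxv h1, e1, e3, ← neg_sub (signIn 𝕜 _) (signIn 𝕜 _), signIn_sub_half]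
      split_ifs <;> simp

/-- Away from `p` there is no bracket and no jump: all half-edges at the vertex have the same middle
level. -/
theorem Cut.Levels.isLevel_of_forall_ne (𝕜 : Type*) [Field 𝕜] (Λ : κ.Levels p) {v : Γ.V}
    (hsrc : ∀ x ∈ κ.steps p, Γ.src x.2 ≠ .inner v) (htgt : ∀ x ∈ κ.steps p, Γ.tgt x.2 ≠ .inner v) :
    ∃ α, Λ.IsLevel 𝕜 (.inner v) α := by
  have hlr : ∀ h, Γ.vertexAt h = .inner v → Λ.left h = Λ.right h := by
    rintro (e | e) hv
    · rw [Λ.right_inl, Cut.onPath, if_neg, sub_zero]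
      rintro ⟨x, hx, rfl⟩
      exact hsrc x hx hv
    · rw [Λ.right_inr, Λ.left_inr, Λ.right_inl, Cut.onPath, if_neg, sub_zero]
      rintro ⟨x, hx, rfl⟩
      exact htgt x hx hv
  have hmid : ∀ h, Γ.vertexAt h = .inner v → Λ.mid (Γ.rot h) = Λ.mid h := fun h hv => by
    rw [Cut.Levels.mid, Cut.Levels.mid, hlr _ (vertexAt_rot hv), Λ.right_rot_inner hv, hlr h hv]
  obtain ⟨g, hg⟩ := Γ.exists_in v
  have hg' : Γ.vertexAt (.inr g) = .inner v := hg
  have hconst : ∀ h, Γ.vertexAt h = .inner v → Λ.mid h = Λ.mid (.inr g) := fun h hv => by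
    rcases eq_rot_or_eq_rot_rot hg' hv with rfl | rfl | rfl
    · rfl
    · exact hmid _ hg'
    · rw [hmid _ (vertexAt_rot hg'), hmid _ hg']
  refine ⟨Λ.mid (.inr g), fun e he z => ?_, fun e he z => ?_⟩
  · rw [Cut.whiteSum_eq_zero 𝕜 fun x hx => he ▸ hsrc x hx, hconst (.inl e) he, sub_self, zero_div]
  · rw [Cut.blackSum_eq_zero 𝕜 fun x hx => he ▸ htgt x hx, hconst (.inr e) he, sub_self, zero_div]

theorem Cut.Levels.exists_isLevel (𝕜 : Type*) [Field 𝕜] (Λ : κ.Levels p)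
    (v : NetVertex N N Γ.V) : ∃ α, Λ.IsLevel 𝕜 v α := by
  match v with
  | .source i => exact ⟨_, Λ.isLevel_source 𝕜 i⟩
  | .sink j => exact ⟨_, Λ.isLevel_sink 𝕜 j⟩
  | .inner v =>
    -- An interior vertex is not an end point of `p`, so if `p` leaves it, then `p` also enters it,
    -- with matching index, and conversely.
    by_cases hsrc : ∃ y ∈ κ.steps p, Γ.src y.2 = .inner v
    · obtain ⟨y, hy, hyv⟩ := hsrc
      rcases κ.exists_pred hy with ⟨h, _⟩ | ⟨x, hx, h1, h2⟩
      · rw [hyv] at h; simp [source] at h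
      · exact ⟨_, Λ.isLevel_of_mem_steps 𝕜 hx hy (h1.trans hyv) hyv h2⟩
    by_cases htgt : ∃ x ∈ κ.steps p, Γ.tgt x.2 = .inner v
    · obtain ⟨x, hx, hxv⟩ := htgt
      rcases κ.exists_succ hx with ⟨h, _⟩ | ⟨y, hy, h1, h2⟩
      · rw [hxv] at h; simp [sink] at h
      · exact ⟨_, Λ.isLevel_of_mem_steps 𝕜 hx hy hxv (h1.trans hxv) h2⟩
    push Not at hsrc htgt
    exact Λ.isLevel_of_forall_ne 𝕜 hsrc htgt

end TorusLevels

end PerfectCylindricalNetwork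

/-! ### Intersection numbers in the universal cover -/

namespace PerfectCylindricalNetwork

noncomputable section Planar

variable {N : ℕ} [NeZero N] {Γ : PerfectCylindricalNetwork N N} {κ : Γ.Cut}

theorem Cut.exists_mem_steps_src {x y : Γ.Vertex} (p : Quiver.Path x y) (h : x ≠ y) :
    ∃ s ∈ κ.steps p, Γ.src s.2 = x := by
  induction p with
  | nil => exact absurd rfl h
  | @cons c d p e ih =>
    by_cases hc : x = c
    · exact ⟨_, List.mem_cons_self, e.2.1.trans hc.symm⟩
    · obtain ⟨s, hs, hs'⟩ := ih hc
      exact ⟨s, List.mem_cons_of_mem _ hs, hs'⟩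

theorem Cut.exists_mem_steps_tgt {x y : Γ.Vertex} (p : Quiver.Path x y) (h : x ≠ y) :
    ∃ s ∈ κ.steps p, Γ.tgt s.2 = y ∧ s.1 + κ.index s.2 = κ.pathIndex p := by
  cases p with
  | nil => exact absurd rfl h
  | cons p e => exact ⟨_, List.mem_cons_self, e.2.2, rfl⟩

theorem source_ne_sink (a b : Fin N) : Γ.source a ≠ Γ.sink b := fun h => by
  simp [source, sink] at h

variable {a b : Fin N} {p : Quiver.Path (Γ.source a) (Γ.sink b)}

theorem Cut.onPath_sourceEdge (i : Fin N) :
    κ.onPath p (Γ.sourceEdge i) = if i = a then 1 else 0 := by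
  split_ifs with h
  · subst h
    obtain ⟨s, hs, hs'⟩ := κ.exists_mem_steps_src p (source_ne_sink i b)
    rw [← (Γ.src_eq_source s.2 i).1 hs', Cut.onPath_eq_one hs]
  · refine if_neg ?_
    rintro ⟨x, hx, hx'⟩
    rcases κ.exists_pred hx with ⟨h1, _⟩ | ⟨y, _, h1, _⟩
    · rw [hx', Γ.src_sourceEdge] at h1
      exact h (NetVertex.source.inj h1)
    · rw [hx', Γ.src_sourceEdge] at h1
      exact Γ.tgt_ne_source _ _ h1

theorem Cut.onPath_sinkEdge (j : Fin N) :
    κ.onPath p (Γ.sinkEdge j) = if j = b then 1 else 0 := by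
  split_ifs with h
  · subst h
    obtain ⟨s, hs, hs', _⟩ := κ.exists_mem_steps_tgt p (source_ne_sink a j)
    rw [← (Γ.tgt_eq_sink s.2 j).1 hs', Cut.onPath_eq_one hs]
  · refine if_neg ?_
    rintro ⟨x, hx, hx'⟩
    rcases κ.exists_succ hx with ⟨h1, _⟩ | ⟨y, _, h1, _⟩
    · rw [hx', Γ.tgt_sinkEdge] at h1
      exact h (NetVertex.sink.inj h1)
    · rw [hx', Γ.tgt_sinkEdge] at h1
      exact Γ.src_ne_sink _ _ h1

/-- The position of the `i`-th point on a boundary circle relative to the `a`-th point. -/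
def relPos (a i : Fin N) : ℚ := if i < a then 1 / 2 else if i = a then 0 else -1 / 2

theorem fin_succ_ne_zero {k : ℕ} (hk : k + 1 < N) : (⟨k, by omega⟩ + 1 : Fin N) ≠ 0 := by
  rw [← fin_mk_succ hk]
  intro h
  have := congrArg Fin.val h
  simp at this

/-- Going down the left circle, the level drops by one exactly when `p` is crossed at source `a`. -/
theorem Cut.Levels.left_sourceEdge (Λ : κ.Levels p) (i : Fin N) :
    Λ.left (.inl (Γ.sourceEdge i)) = if a < i then -1 else 0 := by
  -- The comparison starts at source `0` because the only corner with a seam is the one between the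
  -- last and the first source. The case `k = a` then shows that the level at source `0` is `0`.
  have H : ∀ (k : ℕ) (hk : k < N), Λ.left (.inl (Γ.sourceEdge ⟨k, hk⟩)) =
      Λ.left (.inl (Γ.sourceEdge 0)) + if a.val < k then -1 else 0 := by
    intro k hk
    induction k with
    | zero => simp
    | succ k ih =>
      have h1 := Λ.right_rot (.inl (Γ.sourceEdge (⟨k, by omega⟩ + 1)))
      have h2 : Γ.seam (.inl (Γ.sourceEdge (⟨k, by omega⟩ + 1))) = 0 := by
        rw [seam, Γ.rot_source, if_neg, if_neg (by simp), sub_zero]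
        intro h
        exact fin_succ_ne_zero hk (Γ.sourceEdge_injective (Sum.inl_injective h))
      rw [Γ.rot_source, h2, sub_zero, Λ.right_inl, Cut.onPath_sourceEdge, ih (by omega)] at h1
      rw [fin_mk_succ hk, ← h1]
      simp only [Fin.ext_iff]
      rcases lt_trichotomy a.val k with h | h | h
      · simp [h, h.ne', h.trans (Nat.lt_succ_self k)]
      · simp [h]; ring
      · simp [h.ne, not_lt.2 h.le, not_lt.2 (Nat.succ_le_of_lt h)]
  have h0 := H a.val a.isLt
  rw [Λ.left_source] at h0
  have h1 := H i.val i.isLt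
  simp only [lt_irrefl, if_false, add_zero] at h0
  rw [← h0, zero_add] at h1
  exact h1

theorem Cut.Levels.right_sinkEdge (Λ : κ.Levels p) (j : Fin N) :
    Λ.right (.inr (Γ.sinkEdge j)) = -κ.pathIndex p + if b < j then -1 else 0 := by
  have H : ∀ (k : ℕ) (hk : k < N), Λ.right (.inr (Γ.sinkEdge ⟨k, hk⟩)) =
      Λ.right (.inr (Γ.sinkEdge 0)) + if b.val < k then -1 else 0 := by
    intro k hk
    induction k with
    | zero => simp
    | succ k ih =>
      have h1 := Λ.right_rot (.inr (Γ.sinkEdge ⟨k, by omega⟩))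
      have h2 : Γ.seam (.inr (Γ.sinkEdge ⟨k, by omega⟩)) = 0 := by
        rw [seam, Γ.rot_sink, if_neg (by simp), if_neg, sub_zero]
        intro h
        exact fin_succ_ne_zero hk (Γ.sinkEdge_injective (Sum.inr_injective h))
      have h3 := Λ.right_inr (Γ.sinkEdge ⟨k, by omega⟩)
      rw [Γ.rot_sink, h2, sub_zero, Λ.left_inr, Λ.right_inl, Cut.onPath_sinkEdge] at h1
      rw [fin_mk_succ hk, h1, sub_right_comm, ← h3, ih (by omega)]
      simp only [Fin.ext_iff]
      rcases lt_trichotomy b.val k with h | h | h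
      · simp [h, h.ne', h.trans (Nat.lt_succ_self k)]
      · simp [h]; ring
      · simp [h.ne, not_lt.2 h.le, not_lt.2 (Nat.succ_le_of_lt h)]
  -- The normalisation at the sinks comes from the last edge of `p`: its left level at the tail is
  -- known, and the index of that edge completes the index of `p`.
  obtain ⟨s, hs, hs', hs''⟩ := κ.exists_mem_steps_tgt p (source_ne_sink a b)
  have h0 := H b.val b.isLt
  have h1 := H j.val j.isLt
  have h2 := Λ.left_of_mem_steps hs
  rw [(Γ.tgt_eq_sink s.2 b).1 hs'] at h2 hs''
  simp only [lt_irrefl, if_false, add_zero] at h0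
  have h3 := Λ.right_inr (Γ.sinkEdge b)
  rw [← h0] at h1
  refine h1.trans ?_
  congr 1
  change Λ.right (.inr (Γ.sinkEdge b)) = _
  rw [h3, h2, ← hs'']
  push_cast; ring

theorem Cut.Levels.mid_sourceEdge (Λ : κ.Levels p) (i : Fin N) :
    Λ.mid (.inl (Γ.sourceEdge i)) = relPos a i := by
  rw [Cut.Levels.mid, Λ.right_inl, Cut.onPath_sourceEdge, Λ.left_sourceEdge, relPos]
  rcases lt_trichotomy a i with h | h | h
  · simp [h, h.ne', not_lt.2 h.le]
  · simp [h]
  · simp [h, h.ne, not_lt.2 h.le]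

theorem Cut.Levels.mid_sinkEdge (Λ : κ.Levels p) (j : Fin N) :
    Λ.mid (.inr (Γ.sinkEdge j)) = relPos b j - κ.pathIndex p := by
  have h := Λ.right_inr (Γ.sinkEdge j)
  rw [Cut.Levels.mid, Λ.left_inr, Λ.right_inl, Cut.onPath_sinkEdge, sub_right_comm, ← h,
    Λ.right_sinkEdge, relPos]
  rcases lt_trichotomy b j with h | h | h
  · simp [h, h.ne', not_lt.2 h.le]; ring
  · simp [h]; ring
  · simp [h, h.ne, not_lt.2 h.le]; ring

theorem Cut.Levels.exists_vertex_levels (𝕜 : Type*) [Field 𝕜] (Λ : κ.Levels p) :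
    ∃ α : NetVertex N N Γ.V → ℚ, (∀ v, Λ.IsLevel 𝕜 v (α v)) ∧
      (∀ i, α (.source i) = relPos a i) ∧ ∀ j, α (.sink j) = relPos b j - κ.pathIndex p := by
  choose α hα using Λ.exists_isLevel 𝕜
  -- A vertex level is not unique, so at the boundary vertices the middle level of the only edge is
  -- taken, whose value is known.
  refine ⟨fun
    | .source i => Λ.mid (.inl (Γ.sourceEdge i))
    | .sink j => Λ.mid (.inr (Γ.sinkEdge j))
    | .inner v => α (.inner v), ?_, Λ.mid_sourceEdge, Λ.mid_sinkEdge⟩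
  rintro (i | j | v)
  exacts [Λ.isLevel_source 𝕜 i, Λ.isLevel_sink 𝕜 j, hα _]

/-- The intersection number of two paths, the second one lifted `δ` sheets higher than the first
one to the universal cover of the cylinder, as a sum of local contributions. -/
def Cut.crossing (𝕜 : Type*) [Field 𝕜] (κ : Γ.Cut) {x y x' y' : Γ.Vertex} (p : Quiver.Path x y)
    (q : Quiver.Path x' y') (δ : ℤ) : 𝕜 :=
  ((κ.steps q).map fun s =>
    κ.whiteSum 𝕜 p s.2 (s.1 - δ) + κ.blackSum 𝕜 p s.2 (s.1 + κ.index s.2 - δ)).sum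

/-- The intersection number of two paths is determined by the order of their end points. -/
theorem Cut.crossing_eq (𝕜 : Type*) [Field 𝕜] (κ : Γ.Cut) {a b i j : Fin N}
    (p : Quiver.Path (Γ.source a) (Γ.sink b)) (q : Quiver.Path (Γ.source i) (Γ.sink j)) (δ : ℤ) :
    κ.crossing 𝕜 p q δ =
      (signIn 𝕜 (relPos b j - (δ + κ.pathIndex p - κ.pathIndex q : ℤ)) -
        signIn 𝕜 (relPos a i - δ)) / 2 := by
  obtain ⟨Λ⟩ := κ.nonempty_levels p
  obtain ⟨α, hα, h1, h2⟩ := Λ.exists_vertex_levels 𝕜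
  -- The telescoping holds for a path `q` between arbitrary vertices, which allows induction on its
  -- last edge.
  have H : ∀ {x y : Γ.Vertex} (q : Quiver.Path x y), κ.crossing 𝕜 p q δ =
      (signIn 𝕜 (α y + (κ.pathIndex q - δ : ℤ)) - signIn 𝕜 (α x - δ)) / 2 := by
    intro x y q
    induction q with
    | nil => simp [Cut.crossing, Cut.steps, Cut.pathIndex, sub_eq_add_neg]
    | @cons c d q e ih =>
      rw [Cut.crossing, Cut.steps, List.map_cons, List.sum_cons]
      rw [Cut.crossing] at ih
      -- Along one edge the middle level drops by the index of the edge while the index of `q` rises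
      -- by it. So the sign at the tail end of the edge equals the sign at its head end, and the two
      -- cancel.
      rw [ih, (hα c).whiteSum_eq e.1 e.2.1, (hα d).blackSum_eq e.1 e.2.2, Λ.mid_inr,
        show Λ.mid (.inl e.1) - (κ.index e.1 : ℚ) + (κ.pathIndex q + κ.index e.1 - δ : ℤ) =
          Λ.mid (.inl e.1) + (κ.pathIndex q - δ : ℤ) by push_cast; ring, Cut.pathIndex]
      ring
  rw [H q]
  change (signIn 𝕜 (α (.sink j) + _) - signIn 𝕜 (α (.source i) - _)) / 2 = _
  rw [h1, h2]
  congr 4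
  push_cast; ring

end Planar

end PerfectCylindricalNetwork

/-! ### Sums over splittings of paths and the exchange of ends -/

section Splitting

variable {V : Type*} [Quiver V]

/-- The sum over all decompositions of a path as a path followed by an arrow and a path. -/
def splitSum {M : Type*} [AddCommMonoid M] {a : V} : ∀ {b : V}, Quiver.Path a b →
    (∀ c d : V, Quiver.Path a c → (c ⟶ d) → Quiver.Path d b → M) → M
  | _, .nil, _ => 0
  | _, .cons p e, g =>
    g _ _ p e .nil + splitSum p fun c d p₁ e₁ p₂ => g c d p₁ e₁ (p₂.cons e)

theorem map_splitSum {M M' : Type*} [AddCommMonoid M] [AddCommMonoid M'] (φ : M →+ M') {a b : V}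
    (p : Quiver.Path a b) (g : ∀ c d : V, Quiver.Path a c → (c ⟶ d) → Quiver.Path d b → M) :
    φ (splitSum p g) = splitSum p fun c d p₁ e p₂ => φ (g c d p₁ e p₂) := by
  induction p with
  | nil => exact map_zero φ
  | cons p e ih => rw [splitSum, splitSum, map_add, ih]

/-- Keeping the equation that recomposes the path allows conditions on the whole path to be
expressed through its pieces. -/
theorem splitSum_congr {M : Type*} [AddCommMonoid M] {a b : V} (p : Quiver.Path a b)
    {g g' : ∀ c d : V, Quiver.Path a c → (c ⟶ d) → Quiver.Path d b → M}
    (h : ∀ c d (p₁ : Quiver.Path a c) (e : c ⟶ d) (p₂ : Quiver.Path d b),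
      (p₁.cons e).comp p₂ = p → g c d p₁ e p₂ = g' c d p₁ e p₂) : splitSum p g = splitSum p g' := by
  induction p with
  | nil => rfl
  | cons p e ih =>
    rw [splitSum, splitSum, h _ _ p e .nil rfl, ih]
    intro c d p₁ e₁ p₂ h'
    exact h _ _ _ _ _ (by rw [Quiver.Path.comp_cons, h'])

theorem splitSum_add {M : Type*} [AddCommMonoid M] {a b : V} (p : Quiver.Path a b)
    (g g' : ∀ c d : V, Quiver.Path a c → (c ⟶ d) → Quiver.Path d b → M) :
    splitSum p (fun c d p₁ e p₂ => g c d p₁ e p₂ + g' c d p₁ e p₂) =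
      splitSum p g + splitSum p g' := by
  induction p with
  | nil => simp [splitSum]
  | cons p e ih => simp only [splitSum, ih]; abel

theorem splitSum_sum {M ι : Type*} [AddCommMonoid M] (s : Finset ι) {a b : V}
    (p : Quiver.Path a b)
    (g : ι → ∀ c d : V, Quiver.Path a c → (c ⟶ d) → Quiver.Path d b → M) :
    splitSum p (fun c d p₁ e p₂ => ∑ i ∈ s, g i c d p₁ e p₂) = ∑ i ∈ s, splitSum p (g i) := by
  induction p with
  | nil => simp [splitSum]
  | cons p e ih => simp only [splitSum, ih, Finset.sum_add_distrib]

end Splitting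

/-- Exchanging the first parts of pairs of splittings at a common point. -/
theorem sum_exchange {W M : Type*} [Fintype W] [DecidableEq W] [AddCommMonoid M]
    {L L' R R' : W → Type*} [∀ w, Fintype (L w)] [∀ w, Fintype (L' w)] [∀ w, Fintype (R w)]
    [∀ w, Fintype (R' w)] (K : ∀ w, L w → L' w → R w → R' w → M) :
    ∑ w, ∑ l : L w, ∑ r : R w, ∑ w', ∑ l' : L' w', ∑ r' : R' w',
      (if h : w' = w then K w l (h ▸ l') r (h ▸ r') else 0) =
    ∑ w, ∑ l' : L' w, ∑ r : R w, ∑ w', ∑ l : L w', ∑ r' : R' w',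
      (if h : w' = w then K w (h ▸ l) l' r (h ▸ r') else 0) := by
  refine Finset.sum_congr rfl fun w _ => ?_
  have h1 : ∀ (l : L w) (r : R w), ∑ w', ∑ l' : L' w', ∑ r' : R' w',
      (if h : w' = w then K w l (h ▸ l') r (h ▸ r') else 0) =
      ∑ l' : L' w, ∑ r' : R' w, K w l l' r r' := fun l r => by
    rw [Fintype.sum_eq_single w fun w' hw' => by simp [hw']]
    simp
  have h2 : ∀ (l' : L' w) (r : R w), ∑ w', ∑ l : L w', ∑ r' : R' w',
      (if h : w' = w then K w (h ▸ l) l' r (h ▸ r') else 0) =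
      ∑ l : L w, ∑ r' : R' w, K w l l' r r' := fun l r => by
    rw [Fintype.sum_eq_single w fun w' hw' => by simp [hw']]
    simp
  simp only [h1, h2]
  rw [Finset.sum_comm]
  conv_rhs => rw [Finset.sum_comm]
  exact Finset.sum_congr rfl fun r _ => Finset.sum_comm

/-! ### Closing up a tensor to a cyclic class -/

noncomputable section CloseUp

variable {𝕜 : Type*} [CommRing 𝕜] {V ι : Type*} [Quiver V]

/-- The class of a loop in the cyclic space. -/
def loopClass (𝕜 : Type*) [CommRing 𝕜] (pt : ι → V) {c : ι} (w : Quiver.Path (pt c) (pt c)) :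
    CyclicSpace 𝕜 pt :=
  cyclicClass pt (loop pt c (pathElt 𝕜 w))

theorem loopClass_comm (pt : ι → V) {c d : ι} (w : Quiver.Path (pt c) (pt d))
    (w' : Quiver.Path (pt d) (pt c)) :
    loopClass 𝕜 pt (w.comp w') = loopClass 𝕜 pt (w'.comp w) := by
  rw [loopClass, loopClass, pathElt_comp, pathElt_comp, cyclicClass_comm]

/-- The class of the loop `x u y v` for `x ⊗ y`. -/
def closeUp (pt : ι → V) {a b c d : ι} (u : Quiver.Path (pt b) (pt a))
    (v : Quiver.Path (pt d) (pt c)) :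
    LinPath 𝕜 (pt c) (pt b) ⊗[𝕜] LinPath 𝕜 (pt a) (pt d) →ₗ[𝕜] CyclicSpace 𝕜 pt :=
  cyclicClass pt ∘ₗ loop pt c ∘ₗ concatTensor ∘ₗ rmul₂ (pathElt 𝕜 v) ∘ₗ rmul₁ (pathElt 𝕜 u)

theorem closeUp_apply (pt : ι → V) {a b c d : ι} (u : Quiver.Path (pt b) (pt a))
    (v : Quiver.Path (pt d) (pt c))
    (t : LinPath 𝕜 (pt c) (pt b) ⊗[𝕜] LinPath 𝕜 (pt a) (pt d)) :
    closeUp pt u v t = cyclicClass pt (loop pt c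
      (concatTensor (rmul₂ (pathElt 𝕜 v) (rmul₁ (pathElt 𝕜 u) t)))) :=
  rfl

theorem closeUp_nil (pt : ι → V) {a c : ι}
    (t : LinPath 𝕜 (pt c) (pt a) ⊗[𝕜] LinPath 𝕜 (pt a) (pt c)) :
    closeUp pt .nil .nil t = cyclicClass pt (loop pt c (concatTensor t)) := by
  rw [closeUp_apply, rmul₁_nil, rmul₂_nil]

theorem closeUp_tmul (pt : ι → V) {a b c d : ι} (u : Quiver.Path (pt b) (pt a))
    (v : Quiver.Path (pt d) (pt c)) (x : Quiver.Path (pt c) (pt b))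
    (y : Quiver.Path (pt a) (pt d)) :
    closeUp pt u v (pathElt 𝕜 x ⊗ₜ pathElt 𝕜 y) =
      loopClass 𝕜 pt ((x.comp u).comp (y.comp v)) := by
  rw [closeUp_apply, loopClass, pathElt_comp, pathElt_comp, pathElt_comp]
  rfl

/-- In the loop `x u y v` a factor next to `u` or `v` can be absorbed into it. This and the next
three rules turn the four terms of the Leibniz identities into brackets closed up by longer paths.
-/
theorem closeUp_lmul₂ (pt : ι → V) {a a' b c d : ι} (u : Quiver.Path (pt b) (pt a))
    (v : Quiver.Path (pt d) (pt c)) (f : Quiver.Path (pt a) (pt a'))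
    (t : LinPath 𝕜 (pt c) (pt b) ⊗[𝕜] LinPath 𝕜 (pt a') (pt d)) :
    closeUp pt u v (lmul₂ (pathElt 𝕜 f) t) = closeUp pt (u.comp f) v t := by
  rw [closeUp_apply, closeUp_apply, ← lmul₂_rmul₁, ← lmul₂_rmul₂, concatTensor_lmul₂,
    rmul₁_rmul₂, pathElt_comp, rmul₁_comp]

theorem closeUp_rmul₁ (pt : ι → V) {a b b' c d : ι} (u : Quiver.Path (pt b') (pt a))
    (v : Quiver.Path (pt d) (pt c)) (f : Quiver.Path (pt b) (pt b'))
    (t : LinPath 𝕜 (pt c) (pt b) ⊗[𝕜] LinPath 𝕜 (pt a) (pt d)) :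
    closeUp pt u v (rmul₁ (pathElt 𝕜 f) t) = closeUp pt (f.comp u) v t := by
  rw [closeUp_apply, closeUp_apply, pathElt_comp, rmul₁_comp]

theorem closeUp_rmul₂ (pt : ι → V) {a b c d d' : ι} (u : Quiver.Path (pt b) (pt a))
    (v : Quiver.Path (pt d') (pt c)) (f : Quiver.Path (pt d) (pt d'))
    (t : LinPath 𝕜 (pt c) (pt b) ⊗[𝕜] LinPath 𝕜 (pt a) (pt d)) :
    closeUp pt u v (rmul₂ (pathElt 𝕜 f) t) = closeUp pt u (f.comp v) t := by
  rw [closeUp_apply, closeUp_apply, pathElt_comp, rmul₂_comp, rmul₁_rmul₂]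

/-- The only one of the four rules that uses cyclicity: a factor at the beginning of the loop is
moved to the end, behind `v`. -/
theorem closeUp_lmul₁ (pt : ι → V) {a b c c' d : ι} (u : Quiver.Path (pt b) (pt a))
    (v : Quiver.Path (pt d) (pt c)) (f : Quiver.Path (pt c) (pt c'))
    (t : LinPath 𝕜 (pt c') (pt b) ⊗[𝕜] LinPath 𝕜 (pt a) (pt d)) :
    closeUp pt u v (lmul₁ (pathElt 𝕜 f) t) = closeUp pt u (v.comp f) t := by
  rw [closeUp_apply, closeUp_apply, ← lmul₁_rmul₁, ← lmul₁_rmul₂, concatTensor_lmul₁,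
    cyclicClass_comm, pathElt_comp, rmul₂_comp, concatTensor_rmul₂ (pathElt 𝕜 f)]

theorem lmul₁_tmul {a b c d e : V} (f : Quiver.Path a b) (x : Quiver.Path b c)
    (y : LinPath 𝕜 d e) :
    lmul₁ (pathElt 𝕜 f) (pathElt 𝕜 x ⊗ₜ[𝕜] y) = pathElt 𝕜 (f.comp x) ⊗ₜ y := by
  rw [pathElt_comp]; rfl

theorem lmul₂_tmul {a b c d e : V} (f : Quiver.Path a b) (x : Quiver.Path b c)
    (y : LinPath 𝕜 d e) :
    lmul₂ (pathElt 𝕜 f) (y ⊗ₜ[𝕜] pathElt 𝕜 x) = y ⊗ₜ pathElt 𝕜 (f.comp x) := by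
  rw [pathElt_comp]; rfl

theorem rmul₁_tmul {a b c d e : V} (f : Quiver.Path b c) (x : Quiver.Path a b)
    (y : LinPath 𝕜 d e) :
    rmul₁ (pathElt 𝕜 f) (pathElt 𝕜 x ⊗ₜ[𝕜] y) = pathElt 𝕜 (x.comp f) ⊗ₜ y := by
  rw [pathElt_comp]; rfl

theorem rmul₂_tmul {a b c d e : V} (f : Quiver.Path b c) (x : Quiver.Path a b)
    (y : LinPath 𝕜 d e) :
    rmul₂ (pathElt 𝕜 f) (y ⊗ₜ[𝕜] pathElt 𝕜 x) = y ⊗ₜ pathElt 𝕜 (x.comp f) := by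
  rw [pathElt_comp]; rfl

/-- The class of the loop `(q₁ s p₂) u (p₁ t q₂) v` for `s ⊗ t`. -/
def insertTensor (pt : ι → V) {a b c d : ι} {x y x' y' : V} (u : Quiver.Path (pt b) (pt a))
    (v : Quiver.Path (pt d) (pt c)) (q₁ : Quiver.Path (pt c) x') (q₂ : Quiver.Path y' (pt d))
    (p₁ : Quiver.Path (pt a) x) (p₂ : Quiver.Path y (pt b)) :
    LinPath 𝕜 x' y ⊗[𝕜] LinPath 𝕜 x y' →ₗ[𝕜] CyclicSpace 𝕜 pt :=
  closeUp pt u v ∘ₗ rmul₂ (pathElt 𝕜 q₂) ∘ₗ lmul₁ (pathElt 𝕜 q₁) ∘ₗ rmul₁ (pathElt 𝕜 p₂) ∘ₗ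
    lmul₂ (pathElt 𝕜 p₁)

theorem insertTensor_apply (pt : ι → V) {a b c d : ι} {x y x' y' : V}
    (u : Quiver.Path (pt b) (pt a)) (v : Quiver.Path (pt d) (pt c))
    (q₁ : Quiver.Path (pt c) x') (q₂ : Quiver.Path y' (pt d)) (p₁ : Quiver.Path (pt a) x)
    (p₂ : Quiver.Path y (pt b)) (t : LinPath 𝕜 x' y ⊗[𝕜] LinPath 𝕜 x y') :
    insertTensor pt u v q₁ q₂ p₁ p₂ t = closeUp pt u v (rmul₂ (pathElt 𝕜 q₂)
      (lmul₁ (pathElt 𝕜 q₁) (rmul₁ (pathElt 𝕜 p₂) (lmul₂ (pathElt 𝕜 p₁) t)))) :=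
  rfl

theorem insertTensor_tmul (pt : ι → V) {a b c d : ι} {x y x' y' : V}
    (u : Quiver.Path (pt b) (pt a)) (v : Quiver.Path (pt d) (pt c))
    (q₁ : Quiver.Path (pt c) x') (q₂ : Quiver.Path y' (pt d)) (p₁ : Quiver.Path (pt a) x)
    (p₂ : Quiver.Path y (pt b)) (s : Quiver.Path x' y) (t : Quiver.Path x y') :
    insertTensor pt u v q₁ q₂ p₁ p₂ (pathElt 𝕜 s ⊗ₜ pathElt 𝕜 t) =
      loopClass 𝕜 pt ((((q₁.comp s).comp p₂).comp u).comp (((p₁.comp t).comp q₂).comp v)) := by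
  rw [insertTensor_apply, lmul₂_tmul, rmul₁_tmul, lmul₁_tmul, rmul₂_tmul, closeUp_tmul]
  simp only [Quiver.Path.comp_assoc]

variable {V' : Type*} [Quiver V'] (Φ : V' ⥤q V)

theorem pathArrowBracket_mapPath (ε : ArrowBracket 𝕜 V) {a b : V'} (p : Quiver.Path a b)
    {c d : V} (f : c ⟶ d) : pathArrowBracket ε f (Φ.mapPath p) =
      splitSum p fun _ _ p₁ e p₂ => rmul₁ (pathElt 𝕜 (Φ.mapPath p₂))
        (lmul₂ (pathElt 𝕜 (Φ.mapPath p₁)) (ε (Φ.map e) f)) := by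
  induction p with
  | nil => rfl
  | cons p e ih =>
    rw [Prefunctor.mapPath_cons, pathArrowBracket, splitSum, ih, Prefunctor.mapPath_nil,
      rmul₁_nil]
    congr 1
    refine (map_splitSum (LinearMap.toAddMonoidHom (rmul₁ _)) _ _).trans ?_
    refine splitSum_congr _ fun c d p₁ e₁ p₂ _ => ?_
    rw [Prefunctor.mapPath_cons,
      show (Φ.mapPath p₂).cons (Φ.map e) = (Φ.mapPath p₂).comp (Φ.map e).toPath from rfl,
      pathElt_comp, rmul₁_comp]
    rfl

/-- The Leibniz recursion written out for paths that come from another quiver. For the gluing map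
the pieces then remain paths on the acyclic cylinder, where sums over all paths are finite. -/
theorem pathBracket_mapPath (ε : ArrowBracket 𝕜 V) {a b a' b' : V'} (p : Quiver.Path a b)
    (q : Quiver.Path a' b') : pathBracket ε (Φ.mapPath p) (Φ.mapPath q) =
      splitSum q fun _ _ q₁ f q₂ => splitSum p fun _ _ p₁ e p₂ =>
        rmul₂ (pathElt 𝕜 (Φ.mapPath q₂)) (lmul₁ (pathElt 𝕜 (Φ.mapPath q₁))
        (rmul₁ (pathElt 𝕜 (Φ.mapPath p₂))
        (lmul₂ (pathElt 𝕜 (Φ.mapPath p₁)) (ε (Φ.map e) (Φ.map f))))) := by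
  suffices H : pathBracket ε (Φ.mapPath p) (Φ.mapPath q) =
      splitSum q fun _ _ q₁ f q₂ => rmul₂ (pathElt 𝕜 (Φ.mapPath q₂))
        (lmul₁ (pathElt 𝕜 (Φ.mapPath q₁)) (pathArrowBracket ε (Φ.map f) (Φ.mapPath p))) by
    rw [H]
    refine splitSum_congr _ fun c d q₁ f q₂ _ => ?_
    rw [pathArrowBracket_mapPath]
    exact map_splitSum (LinearMap.toAddMonoidHom (rmul₂ _ ∘ₗ lmul₁ _)) _ _
  induction q with
  | nil => rfl
  | cons q f ih =>
    rw [Prefunctor.mapPath_cons, pathBracket, splitSum, ih, Prefunctor.mapPath_nil,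
      rmul₂_nil]
    congr 1
    refine (map_splitSum (LinearMap.toAddMonoidHom (rmul₂ _)) _ _).trans ?_
    refine splitSum_congr _ fun c d p₁ e₁ p₂ _ => ?_
    rw [Prefunctor.mapPath_cons,
      show (Φ.mapPath p₂).cons (Φ.map f) = (Φ.mapPath p₂).comp (Φ.map f).toPath from rfl,
      pathElt_comp, rmul₂_comp]
    rfl

end CloseUp

theorem splitSum_ite {V M : Type*} [Quiver V] [AddCommMonoid M] (P : Prop) [Decidable P] {a b : V}
    (p : Quiver.Path a b) (g : ∀ c d : V, Quiver.Path a c → (c ⟶ d) → Quiver.Path d b → M) :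
    (if P then splitSum p g else 0) =
      splitSum p fun c d p₁ e p₂ => if P then g c d p₁ e p₂ else 0 := by
  split_ifs
  · rfl
  · exact map_splitSum (0 : M →+ M) p g

/-! ### Finite sums over paths on the cylinder -/

namespace PerfectCylindricalNetwork

noncomputable section PathSums

variable {N : ℕ} [NeZero N] {Γ : PerfectCylindricalNetwork N N}

instance : Fintype Γ.Vertex := @Fintype.ofFinite _ Γ.finite_vertex

instance : DecidableEq Γ.Vertex := Classical.decEq _

instance (a b : Γ.Vertex) : Fintype (a ⟶ b) :=
  @Fintype.ofFinite _ (inferInstanceAs (Finite {e : Γ.E // Γ.src e = a ∧ Γ.tgt e = b}))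

/-- The paths from `a` to `b` with a distinguished last edge. -/
abbrev PathStep (a b : Γ.Vertex) : Type := Σ c : Γ.Vertex, Quiver.Path a c × (c ⟶ b)

/-- The paths from `a` to `b` with a distinguished first edge. -/
abbrev StepPath (a b : Γ.Vertex) : Type := Σ c : Γ.Vertex, (a ⟶ c) × Quiver.Path c b

/-- A path is either trivial or has a last edge. -/
def pathEquiv (a b : Γ.Vertex) : Quiver.Path a b ≃ PLift (a = b) ⊕ PathStep a b where
  toFun p := match b, p with
    | _, .nil => .inl ⟨rfl⟩
    | _, .cons p e => .inr ⟨_, p, e⟩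
  invFun := Sum.elim (fun h => (Quiver.Path.nil : Quiver.Path a a).cast rfl h.down)
    fun x => x.2.1.cons x.2.2
  left_inv p := by cases p <;> rfl
  right_inv x := by
    rcases x with ⟨⟨rfl⟩⟩ | x <;> rfl

theorem sum_path {M : Type*} [AddCommMonoid M] {a b : Γ.Vertex} (F : Quiver.Path a b → M) :
    ∑ p, F p = (if h : a = b then F ((Quiver.Path.nil : Quiver.Path a a).cast rfl h) else 0) +
      ∑ x : PathStep a b, F (x.2.1.cons x.2.2) := by
  rw [← Equiv.sum_comp (pathEquiv a b).symm, Fintype.sum_sum_type]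
  congr 1
  split_ifs with h
  · rw [Fintype.sum_eq_single ⟨h⟩ fun x hx => absurd (Subsingleton.elim _ _) hx]; rfl
  · exact Finset.sum_eq_zero fun x => absurd x.down h

/-- A path with a distinguished edge is a path up to and including that edge, followed by an
arbitrary path. The induction on the end point removes the last edge, which either is the
distinguished one or belongs to the second piece. This form cuts at the head of the distinguished
edge, as needed at black vertices. -/
theorem sum_splitSum {M : Type*} [AddCommMonoid M] {a b : Γ.Vertex}
    (g : ∀ c d : Γ.Vertex, Quiver.Path a c → (c ⟶ d) → Quiver.Path d b → M) :
    ∑ p, splitSum p g =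
      ∑ w, ∑ l : PathStep a w, ∑ r : Quiver.Path w b, g l.1 w l.2.1 l.2.2 r := by
  induction b using Γ.wellFounded_reach.induction with
  | _ b ih =>
  have h1 : ∑ w, ∑ l : PathStep a w, ∑ r : Quiver.Path w b, g l.1 w l.2.1 l.2.2 r =
      (∑ l : PathStep a b, g l.1 b l.2.1 l.2.2 .nil) +
      ∑ w, ∑ l : PathStep a w, ∑ x : PathStep w b, g l.1 w l.2.1 l.2.2 (x.2.1.cons x.2.2) := by
    simp only [sum_path (b := b), Finset.sum_add_distrib]
    congr 1
    rw [Fintype.sum_eq_single b fun w hw => by simp [hw]]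
    simp
  have h2 : ∑ x : PathStep a b, splitSum x.2.1 (fun c d p₁ e₁ p₂ => g c d p₁ e₁ (p₂.cons x.2.2)) =
      ∑ w, ∑ l : PathStep a w, ∑ x : PathStep w b, g l.1 w l.2.1 l.2.2 (x.2.1.cons x.2.2) := by
    calc _ = ∑ c : Γ.Vertex, ∑ e : c ⟶ b, ∑ w, ∑ l : PathStep a w, ∑ r : Quiver.Path w c,
          g l.1 w l.2.1 l.2.2 (r.cons e) := by
          rw [Fintype.sum_sigma]
          refine Finset.sum_congr rfl fun c _ => ?_
          rw [Fintype.sum_prod_type_right]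
          refine Finset.sum_congr rfl fun e _ => ?_
          exact ih c (.single ⟨e.1, e.2⟩) fun c d p₁ e₁ p₂ => g c d p₁ e₁ (p₂.cons e)
      _ = ∑ c : Γ.Vertex, ∑ w, ∑ e : c ⟶ b, ∑ l : PathStep a w, ∑ r : Quiver.Path w c,
          g l.1 w l.2.1 l.2.2 (r.cons e) := Finset.sum_congr rfl fun c _ => Finset.sum_comm
      _ = ∑ w, ∑ c : Γ.Vertex, ∑ l : PathStep a w, ∑ e : c ⟶ b, ∑ r : Quiver.Path w c,
          g l.1 w l.2.1 l.2.2 (r.cons e) := by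
          rw [Finset.sum_comm]
          exact Finset.sum_congr rfl fun w _ => Finset.sum_congr rfl fun c _ => Finset.sum_comm
      _ = _ := by
          refine Finset.sum_congr rfl fun w _ => ?_
          rw [Finset.sum_comm]
          refine Finset.sum_congr rfl fun l _ => ?_
          rw [Fintype.sum_sigma]
          refine Finset.sum_congr rfl fun c _ => ?_
          rw [Fintype.sum_prod_type_right]
  rw [h1, ← h2, sum_path, ← Finset.sum_add_distrib]
  refine (congrArg (· + _) ?_).trans (zero_add _)
  split_ifs with h
  · subst h; rfl
  · rfl

/-- The same sum cut at the tail of the distinguished edge, as needed at white vertices. -/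
theorem sum_splitSum' {M : Type*} [AddCommMonoid M] {a b : Γ.Vertex}
    (g : ∀ c d : Γ.Vertex, Quiver.Path a c → (c ⟶ d) → Quiver.Path d b → M) :
    ∑ p, splitSum p g =
      ∑ w, ∑ l : Quiver.Path a w, ∑ r : StepPath w b, g w r.1 l r.2.1 r.2.2 := by
  rw [sum_splitSum]
  calc _ = ∑ w, ∑ c : Γ.Vertex, ∑ p : Quiver.Path a c, ∑ e : c ⟶ w, ∑ r : Quiver.Path w b,
        g c w p e r := by
        refine Finset.sum_congr rfl fun w _ => ?_
        rw [Fintype.sum_sigma]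
        exact Finset.sum_congr rfl fun c _ => Fintype.sum_prod_type _
    _ = ∑ c : Γ.Vertex, ∑ p : Quiver.Path a c, ∑ w, ∑ e : c ⟶ w, ∑ r : Quiver.Path w b,
        g c w p e r := by
        rw [Finset.sum_comm]
        exact Finset.sum_congr rfl fun c _ => Finset.sum_comm
    _ = _ := by
        refine Finset.sum_congr rfl fun c _ => Finset.sum_congr rfl fun p _ => ?_
        rw [Fintype.sum_sigma]
        exact Finset.sum_congr rfl fun w _ => by rw [Fintype.sum_prod_type]

theorem Cut.pathIndex_comp (κ : Γ.Cut) {a b c : Γ.Vertex} (p : Quiver.Path a b)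
    (q : Quiver.Path b c) : κ.pathIndex (p.comp q) = κ.pathIndex p + κ.pathIndex q := by
  induction q with
  | nil => simp [Cut.pathIndex]
  | cons q e ih => rw [Quiver.Path.comp_cons, Cut.pathIndex, Cut.pathIndex, ih, add_assoc]

theorem Cut.splitSum_eq_sum_steps {M : Type*} [AddCommMonoid M] (κ : Γ.Cut) {a b : Γ.Vertex}
    (p : Quiver.Path a b) (φ : ℤ × Γ.E → M) :
    splitSum p (fun _ _ p₁ e _ => φ (κ.pathIndex p₁, e.1)) = ((κ.steps p).map φ).sum := by
  induction p with
  | nil => rfl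
  | cons p e ih => rw [splitSum, Cut.steps, List.map_cons, List.sum_cons, ih]

theorem doubleBracket_pathElt (𝕜 : Type*) [Field 𝕜] {a b c d : Γ.TorusVertex}
    (p : Quiver.Path a b) (q : Quiver.Path c d) :
    (Γ.doubleBracket 𝕜).br (pathElt 𝕜 p) (pathElt 𝕜 q) =
      pathBracket (Γ.edgeBracket 𝕜) p q :=
  bilinearExt_single ..

section Exchange

variable {a b a' b' : Fin N}

/-- The class of the loop `r P r' Q`. -/
def exchangeClass (𝕜 : Type*) [Field 𝕜] (P : Quiver.Path (Γ.marked b) (Γ.marked a))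
    (Q : Quiver.Path (Γ.marked b') (Γ.marked a')) (r : Quiver.Path (Γ.source a') (Γ.sink b))
    (r' : Quiver.Path (Γ.source a) (Γ.sink b')) : CyclicSpace 𝕜 Γ.marked :=
  loopClass 𝕜 Γ.marked (c := a')
    (Quiver.Path.comp (V := Γ.TorusVertex) (Quiver.Path.comp (V := Γ.TorusVertex)
      (Γ.gluing.mapPath r) P) (Quiver.Path.comp (V := Γ.TorusVertex) (Γ.gluing.mapPath r') Q))

variable (𝕜 : Type*) [Field 𝕜] (P : Quiver.Path (Γ.marked b) (Γ.marked a))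
    (Q : Quiver.Path (Γ.marked b') (Γ.marked a'))

/-- The contribution of a white vertex to a double bracket. -/
def whiteTerm (w : Γ.Vertex) (q₁ : Quiver.Path (Γ.source a') w) (p₁ : Quiver.Path (Γ.source a) w)
    (y : StepPath w (Γ.sink b')) (x : StepPath w (Γ.sink b)) : CyclicSpace 𝕜 Γ.marked :=
  Γ.whiteCoeff 𝕜 x.2.1.1 y.2.1.1 •
    exchangeClass 𝕜 P Q ((q₁.cons x.2.1).comp x.2.2) ((p₁.cons y.2.1).comp y.2.2)

/-- The contribution of a black vertex to a double bracket. -/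
def blackTerm (w : Γ.Vertex) (y : PathStep (Γ.source a') w) (x : PathStep (Γ.source a) w)
    (q₂ : Quiver.Path w (Γ.sink b')) (p₂ : Quiver.Path w (Γ.sink b)) : CyclicSpace 𝕜 Γ.marked :=
  Γ.blackCoeff 𝕜 x.2.2.1 y.2.2.1 •
    exchangeClass 𝕜 P Q ((y.2.1.cons y.2.2).comp p₂) ((x.2.1.cons x.2.2).comp q₂)

open Classical in
theorem insertTensor_edgeBracket {x y x' y' : Γ.TorusVertex}
    (q₁ : Quiver.Path (Γ.marked a') x') (q₂ : Quiver.Path y' (Γ.marked b'))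
    (p₁ : Quiver.Path (Γ.marked a) x) (p₂ : Quiver.Path y (Γ.marked b))
    (e : x ⟶ y) (f : x' ⟶ y') :
    insertTensor Γ.marked P Q q₁ q₂ p₁ p₂ (Γ.edgeBracket 𝕜 e f) =
      (if h : x = x' then Γ.whiteCoeff 𝕜 e.1 f.1 • loopClass 𝕜 Γ.marked
        ((((q₁.comp (e.toPath.cast h rfl)).comp p₂).comp P).comp
          (((p₁.comp (f.toPath.cast h.symm rfl)).comp q₂).comp Q)) else 0) +
      (if h : y = y' then Γ.blackCoeff 𝕜 e.1 f.1 • loopClass 𝕜 Γ.marked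
        ((((q₁.comp (f.toPath.cast rfl h.symm)).comp p₂).comp P).comp
          (((p₁.comp (e.toPath.cast rfl h)).comp q₂).comp Q)) else 0) := by
  rw [edgeBracket, map_add]
  congr 1
  · split_ifs
    · rw [map_smul, insertTensor_tmul]
    · exact map_zero _
  · split_ifs
    · rw [map_smul, insertTensor_tmul]
    · exact map_zero _

theorem dite_smul_eq_zero {R M : Type*} [Semiring R] [AddCommMonoid M] [Module R M] {P : Prop}
    {_ : Decidable P} {k : R} (hk : k = 0) (m : P → M) : (if h : P then k • m h else 0) = 0 := by
  split_ifs
  · rw [hk, zero_smul]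
  · rfl

theorem mapPath_cons_comp {x u v y : Γ.Vertex} (s : Quiver.Path x u) (g : u ⟶ v)
    (t : Quiver.Path v y) : Γ.gluing.mapPath ((s.cons g).comp t) =
      ((Γ.gluing.mapPath s).comp (Γ.gluing.map g).toPath).comp (Γ.gluing.mapPath t) := by
  rw [Prefunctor.mapPath_comp]; rfl

/-- On the torus the edge bracket compares glued vertices, so a source could be confused with a
sink. The coefficients vanish unless the edges already meet on the cylinder, so the comparison can
be made there. -/
theorem insertTensor_edgeBracket_gluing {c d c' d' : Γ.Vertex}
    (q₁ : Quiver.Path (Γ.source a') c) (f : c ⟶ d) (q₂ : Quiver.Path d (Γ.sink b'))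
    (p₁ : Quiver.Path (Γ.source a) c') (e : c' ⟶ d') (p₂ : Quiver.Path d' (Γ.sink b)) :
    insertTensor Γ.marked (a := a) (b := b) (c := a') (d := b') P Q (Γ.gluing.mapPath q₁)
      (Γ.gluing.mapPath q₂) (Γ.gluing.mapPath p₁) (Γ.gluing.mapPath p₂)
      (Γ.edgeBracket 𝕜 (Γ.gluing.map e) (Γ.gluing.map f)) =
    (if h : c' = c then
      whiteTerm 𝕜 P Q c q₁ (h ▸ p₁) ⟨d, f, q₂⟩ (h ▸ ⟨d', e, p₂⟩) else 0) +
    (if h : d' = d then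
      blackTerm 𝕜 P Q d ⟨c, q₁, f⟩ (h ▸ ⟨c', p₁, e⟩) q₂ (h ▸ p₂) else 0) := by
  refine (insertTensor_edgeBracket 𝕜 P Q (Γ.gluing.mapPath q₁) (Γ.gluing.mapPath q₂)
    (Γ.gluing.mapPath p₁) (Γ.gluing.mapPath p₂) (Γ.gluing.map e) (Γ.gluing.map f)).trans ?_
  congr 1
  · by_cases h : c' = c
    · subst h
      rw [dif_pos rfl, dif_pos rfl, whiteTerm, exchangeClass, mapPath_cons_comp,
        mapPath_cons_comp]
      rfl
    · rw [dif_neg h]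
      exact dite_smul_eq_zero
        (whiteCoeff_eq_zero 𝕜 fun h' => h (e.2.1.symm.trans (h'.trans f.2.1))) _
  · by_cases h : d' = d
    · subst h
      rw [dif_pos rfl, dif_pos rfl, blackTerm, exchangeClass, mapPath_cons_comp,
        mapPath_cons_comp]
      rfl
    · rw [dif_neg h]
      exact dite_smul_eq_zero
        (blackCoeff_eq_zero 𝕜 fun h' => h (e.2.2.symm.trans (h'.trans f.2.2))) _

end Exchange

end PathSums

end PerfectCylindricalNetwork

/-! ### Brackets of boundary paths as intersection numbers -/

namespace PerfectCylindricalNetwork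

noncomputable section Exchange

variable {N : ℕ} [NeZero N] {Γ : PerfectCylindricalNetwork N N} {a b a' b' : Fin N}

theorem sum_sum_splitSum {M : Type*} [AddCommMonoid M] {a b a' b' : Γ.Vertex}
    (G : ∀ c d : Γ.Vertex, Quiver.Path a' c → (c ⟶ d) → Quiver.Path d b' →
      ∀ c d : Γ.Vertex, Quiver.Path a c → (c ⟶ d) → Quiver.Path d b → M) :
    ∑ q : Quiver.Path a' b', ∑ p : Quiver.Path a b,
      splitSum q (fun c d q₁ f q₂ => splitSum p (G c d q₁ f q₂)) =
    ∑ w, ∑ l : PathStep a' w, ∑ r : Quiver.Path w b', ∑ w', ∑ l' : PathStep a w',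
      ∑ r' : Quiver.Path w' b, G l.1 w l.2.1 l.2.2 r l'.1 w' l'.2.1 l'.2.2 r' := by
  simp_rw [← splitSum_sum, sum_splitSum]

theorem sum_sum_splitSum' {M : Type*} [AddCommMonoid M] {a b a' b' : Γ.Vertex}
    (G : ∀ c d : Γ.Vertex, Quiver.Path a' c → (c ⟶ d) → Quiver.Path d b' →
      ∀ c d : Γ.Vertex, Quiver.Path a c → (c ⟶ d) → Quiver.Path d b → M) :
    ∑ q : Quiver.Path a' b', ∑ p : Quiver.Path a b,
      splitSum q (fun c d q₁ f q₂ => splitSum p (G c d q₁ f q₂)) =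
    ∑ w, ∑ l : Quiver.Path a' w, ∑ r : StepPath w b', ∑ w', ∑ l' : Quiver.Path a w',
      ∑ r' : StepPath w' b, G w r.1 l r.2.1 r.2.2 w' r'.1 l' r'.2.1 r'.2.2 := by
  simp_rw [← splitSum_sum, sum_splitSum']

theorem Cut.crossing_eq_splitSum (𝕜 : Type*) [Field 𝕜] (κ : Γ.Cut) {a b i j : Γ.Vertex}
    (p : Quiver.Path a b) (q : Quiver.Path i j) (δ : ℤ) :
    κ.crossing 𝕜 p q δ = splitSum q fun _ _ q₁ f _ => splitSum p fun _ _ p₁ e _ =>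
      (if κ.pathIndex p₁ = κ.pathIndex q₁ - δ then Γ.whiteCoeff 𝕜 e.1 f.1 else 0) +
      if κ.pathIndex p₁ + κ.index e.1 = κ.pathIndex q₁ + κ.index f.1 - δ then
        Γ.blackCoeff 𝕜 f.1 e.1 else 0 := by
  rw [Cut.crossing, ← Cut.splitSum_eq_sum_steps]
  refine splitSum_congr _ fun c d q₁ f q₂ _ => ?_
  rw [splitSum_add, Cut.whiteSum, Cut.blackSum, ← Cut.splitSum_eq_sum_steps,
    ← Cut.splitSum_eq_sum_steps]

/-- A path from a source to a sink, on the torus. -/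
abbrev torusPath (p : Quiver.Path (Γ.source a) (Γ.sink b)) :
    Quiver.Path (Γ.marked a) (Γ.marked b) :=
  Γ.gluing.mapPath p

variable (𝕜 : Type*) [Field 𝕜] (P : Quiver.Path (Γ.marked b) (Γ.marked a))
    (Q : Quiver.Path (Γ.marked b') (Γ.marked a'))

theorem closeUp_doubleBracket (p : Quiver.Path (Γ.source a) (Γ.sink b))
    (q : Quiver.Path (Γ.source a') (Γ.sink b')) :
    closeUp Γ.marked P Q
      ((Γ.doubleBracket 𝕜).br (pathElt 𝕜 (torusPath p)) (pathElt 𝕜 (torusPath q))) =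
    (splitSum q fun c d q₁ f q₂ => splitSum p fun c' d' p₁ e p₂ =>
      if h : c' = c then
        whiteTerm 𝕜 P Q c q₁ (h ▸ p₁) ⟨d, f, q₂⟩ (h ▸ ⟨d', e, p₂⟩) else 0) +
    splitSum q fun c d q₁ f q₂ => splitSum p fun c' d' p₁ e p₂ =>
      if h : d' = d then
        blackTerm 𝕜 P Q d ⟨c, q₁, f⟩ (h ▸ ⟨c', p₁, e⟩) q₂ (h ▸ p₂) else 0 := by
  rw [doubleBracket_pathElt, ← splitSum_add]
  refine (congrArg (closeUp Γ.marked P Q)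
    (pathBracket_mapPath Γ.gluing (Γ.edgeBracket 𝕜) p q)).trans ?_
  refine (map_splitSum (closeUp Γ.marked P Q).toAddMonoidHom q _).trans ?_
  refine splitSum_congr _ fun c d q₁ f q₂ _ => ?_
  refine (map_splitSum (closeUp Γ.marked P Q).toAddMonoidHom p _).trans ?_
  rw [← splitSum_add]
  refine splitSum_congr _ fun c' d' p₁ e p₂ _ => ?_
  exact insertTensor_edgeBracket_gluing 𝕜 P Q q₁ f q₂ p₁ e p₂

variable (κ : Γ.Cut) (A B : ℤ)

/-- Splitting `p = p₁ e p₂` and `q = q₁ f q₂` at a common tail and exchanging `p₁` with `q₁` is a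
bijection onto the splittings of `r = q₁ e p₂` and `r' = p₁ f q₂`. The total index is preserved, and
the remaining condition says which lift of `r'` meets `r` at the vertex. -/
theorem sum_whiteTerm :
    ∑ q : Quiver.Path (Γ.source a') (Γ.sink b'), ∑ p : Quiver.Path (Γ.source a) (Γ.sink b),
      (if κ.pathIndex p = A ∧ κ.pathIndex q = B then
        splitSum q fun c d q₁ f q₂ => splitSum p fun c' d' p₁ e p₂ =>
          if h : c' = c then
            whiteTerm 𝕜 P Q c q₁ (h ▸ p₁) ⟨d, f, q₂⟩ (h ▸ ⟨d', e, p₂⟩) else 0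
      else 0) =
    ∑ r' : Quiver.Path (Γ.source a) (Γ.sink b'), ∑ r : Quiver.Path (Γ.source a') (Γ.sink b),
      splitSum r' fun _ _ p₁ f _ => splitSum r fun _ _ q₁ e _ =>
        if κ.pathIndex r + κ.pathIndex r' = A + B then
          (if κ.pathIndex q₁ = κ.pathIndex p₁ - (A - κ.pathIndex r) then
            Γ.whiteCoeff 𝕜 e.1 f.1 else 0) • exchangeClass 𝕜 P Q r r' else 0 := by
  -- For the exchange the summand, including the conditions on the indices, is written as a function
  -- of the four independent pieces at the vertex.
  let K : ∀ w : Γ.Vertex, Quiver.Path (Γ.source a') w → Quiver.Path (Γ.source a) w →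
      StepPath w (Γ.sink b') → StepPath w (Γ.sink b) → CyclicSpace 𝕜 Γ.marked :=
    fun w q₁ p₁ y x =>
      if κ.pathIndex ((p₁.cons x.2.1).comp x.2.2) = A ∧
        κ.pathIndex ((q₁.cons y.2.1).comp y.2.2) = B then whiteTerm 𝕜 P Q w q₁ p₁ y x else 0
  have h1 := sum_sum_splitSum' (a := Γ.source a) (b := Γ.sink b) (a' := Γ.source a')
    (b' := Γ.sink b') fun c d q₁ f q₂ c' d' p₁ e p₂ =>
      if h : c' = c then K c q₁ (h ▸ p₁) ⟨d, f, q₂⟩ (h ▸ ⟨d', e, p₂⟩) else 0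
  have h2 := sum_sum_splitSum' (a := Γ.source a') (b := Γ.sink b) (a' := Γ.source a)
    (b' := Γ.sink b') fun c d p₁ f q₂ c' d' q₁ e p₂ =>
      if h : c' = c then K c (h ▸ q₁) p₁ ⟨d, f, q₂⟩ (h ▸ ⟨d', e, p₂⟩) else 0
  refine (Eq.trans ?_ h1).trans ((sum_exchange K).trans (h2.symm.trans ?_))
  · refine Finset.sum_congr rfl fun q _ => Finset.sum_congr rfl fun p _ => ?_
    rw [splitSum_ite]
    refine splitSum_congr _ fun c d q₁ f q₂ hq => ?_
    rw [splitSum_ite]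
    refine splitSum_congr _ fun c' d' p₁ e p₂ hp => ?_
    by_cases h : c' = c
    · subst h hp hq
      simp only [dif_pos, K]
    · simp only [dif_neg h, ite_self]
  · refine Finset.sum_congr rfl fun r' _ => Finset.sum_congr rfl fun r _ => ?_
    refine splitSum_congr _ fun c d p₁ f q₂ hq => splitSum_congr _ fun c' d' q₁ e p₂ hp => ?_
    by_cases h : c' = c
    · subst h
      simp only [dif_pos, K, whiteTerm, hp, hq]
      -- Given that the indices of `p` and `q` add up to `A + B`, prescribing that of `p` suffices.
      -- Since `p` consists of `p₁` and the part of `r` after `q₁`, this is a condition on the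
      -- indices of `p₁` and `q₁`.
      rw [ite_smul, zero_smul, ← ite_and]
      refine if_congr ?_ rfl rfl
      subst hp hq
      simp only [Cut.pathIndex_comp, Cut.pathIndex]
      omega
    · rw [dif_neg h, whiteCoeff_eq_zero 𝕜 fun h' => h (e.2.1.symm.trans (h'.trans f.2.1))]
      simp

/-- The same exchange at a common head: the distinguished edges now travel with the first pieces, so
`r = q₁ f p₂` and `r' = p₁ e q₂`. -/
theorem sum_blackTerm :
    ∑ q : Quiver.Path (Γ.source a') (Γ.sink b'), ∑ p : Quiver.Path (Γ.source a) (Γ.sink b),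
      (if κ.pathIndex p = A ∧ κ.pathIndex q = B then
        splitSum q fun c d q₁ f q₂ => splitSum p fun c' d' p₁ e p₂ =>
          if h : d' = d then
            blackTerm 𝕜 P Q d ⟨c, q₁, f⟩ (h ▸ ⟨c', p₁, e⟩) q₂ (h ▸ p₂) else 0
      else 0) =
    ∑ r' : Quiver.Path (Γ.source a) (Γ.sink b'), ∑ r : Quiver.Path (Γ.source a') (Γ.sink b),
      splitSum r' fun _ _ p₁ e _ => splitSum r fun _ _ q₁ f _ =>
        if κ.pathIndex r + κ.pathIndex r' = A + B then
          (if κ.pathIndex q₁ + κ.index f.1 =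
              κ.pathIndex p₁ + κ.index e.1 - (A - κ.pathIndex r) then
            Γ.blackCoeff 𝕜 e.1 f.1 else 0) • exchangeClass 𝕜 P Q r r' else 0 := by
  let K : ∀ w : Γ.Vertex, PathStep (Γ.source a') w → PathStep (Γ.source a) w →
      Quiver.Path w (Γ.sink b') → Quiver.Path w (Γ.sink b) → CyclicSpace 𝕜 Γ.marked :=
    fun w y x q₂ p₂ =>
      if κ.pathIndex ((x.2.1.cons x.2.2).comp p₂) = A ∧
        κ.pathIndex ((y.2.1.cons y.2.2).comp q₂) = B then blackTerm 𝕜 P Q w y x q₂ p₂ else 0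
  have h1 := sum_sum_splitSum (a := Γ.source a) (b := Γ.sink b) (a' := Γ.source a')
    (b' := Γ.sink b') fun c d q₁ f q₂ c' d' p₁ e p₂ =>
      if h : d' = d then K d ⟨c, q₁, f⟩ (h ▸ ⟨c', p₁, e⟩) q₂ (h ▸ p₂) else 0
  have h2 := sum_sum_splitSum (a := Γ.source a') (b := Γ.sink b) (a' := Γ.source a)
    (b' := Γ.sink b') fun c d p₁ e q₂ c' d' q₁ f p₂ =>
      if h : d' = d then K d (h ▸ ⟨c', q₁, f⟩) ⟨c, p₁, e⟩ q₂ (h ▸ p₂) else 0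
  refine (Eq.trans ?_ h1).trans ((sum_exchange K).trans (h2.symm.trans ?_))
  · refine Finset.sum_congr rfl fun q _ => Finset.sum_congr rfl fun p _ => ?_
    rw [splitSum_ite]
    refine splitSum_congr _ fun c d q₁ f q₂ hq => ?_
    rw [splitSum_ite]
    refine splitSum_congr _ fun c' d' p₁ e p₂ hp => ?_
    by_cases h : d' = d
    · subst h hp hq
      simp only [dif_pos, K]
    · simp only [dif_neg h, ite_self]
  · refine Finset.sum_congr rfl fun r' _ => Finset.sum_congr rfl fun r _ => ?_
    refine splitSum_congr _ fun c d p₁ e q₂ hq => splitSum_congr _ fun c' d' q₁ f p₂ hp => ?_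
    by_cases h : d' = d
    · subst h
      simp only [dif_pos, K, blackTerm, hp, hq]
      rw [ite_smul, zero_smul, ← ite_and]
      refine if_congr ?_ rfl rfl
      subst hp hq
      simp only [Cut.pathIndex_comp, Cut.pathIndex]
      omega
    · rw [dif_neg h, blackCoeff_eq_zero 𝕜 fun h' => h (f.2.2.symm.trans (h'.symm.trans e.2.2))]
      simp

/-- The bracket of two closed up boundary paths, summed over all paths of given indices, in terms
of the crossings of the paths obtained by exchanging the ends. -/
theorem sum_closeUp_doubleBracket :
    ∑ q : Quiver.Path (Γ.source a') (Γ.sink b'), ∑ p : Quiver.Path (Γ.source a) (Γ.sink b),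
      (if κ.pathIndex p = A ∧ κ.pathIndex q = B then closeUp Γ.marked P Q
        ((Γ.doubleBracket 𝕜).br (pathElt 𝕜 (torusPath p)) (pathElt 𝕜 (torusPath q))) else 0) =
    ∑ r' : Quiver.Path (Γ.source a) (Γ.sink b'), ∑ r : Quiver.Path (Γ.source a') (Γ.sink b),
      if κ.pathIndex r + κ.pathIndex r' = A + B then
        κ.crossing 𝕜 r r' (A - κ.pathIndex r) • exchangeClass 𝕜 P Q r r' else 0 := by
  simp_rw [closeUp_doubleBracket, ite_add_zero, Finset.sum_add_distrib]
  rw [sum_whiteTerm, sum_blackTerm]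
  simp_rw [← Finset.sum_add_distrib, ← splitSum_add]
  refine Finset.sum_congr rfl fun r' _ => Finset.sum_congr rfl fun r _ => ?_
  rw [Cut.crossing_eq_splitSum]
  split_ifs
  · rw [← LinearMap.toSpanSingleton_apply 𝕜 _ (exchangeClass 𝕜 P Q r r')]
    refine Eq.symm ((map_splitSum
      (LinearMap.toSpanSingleton 𝕜 _ (exchangeClass 𝕜 P Q r r')).toAddMonoidHom _ _).trans ?_)
    refine splitSum_congr _ fun _ _ p₁ f _ _ => ?_
    refine (map_splitSum
      (LinearMap.toSpanSingleton 𝕜 _ (exchangeClass 𝕜 P Q r r')).toAddMonoidHom _ _).trans ?_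
    refine splitSum_congr _ fun _ _ q₁ e _ _ => ?_
    rw [← add_smul]
    rfl
  · simp only [add_zero]
    refine (splitSum_congr _ fun _ _ p₁ f _ _ => ?_).trans
      (map_splitSum (0 : CyclicSpace 𝕜 Γ.marked →+ CyclicSpace 𝕜 Γ.marked) r' fun _ _ _ _ _ =>
        0).symm
    exact (map_splitSum (0 : CyclicSpace 𝕜 Γ.marked →+ CyclicSpace 𝕜 Γ.marked) r
      fun _ _ _ _ _ => 0).symm

end Exchange

end PerfectCylindricalNetwork

/-! ### Cyclic words in boundary paths -/

namespace PerfectCylindricalNetwork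

noncomputable section Words

variable {N : ℕ} [NeZero N] {Γ : PerfectCylindricalNetwork N N}

variable (Γ) in
/-- Paths between marked points on the torus together with an intersection index. -/
abbrev IndexedPath (a b : Fin N) : Type := Quiver.Path (Γ.marked a) (Γ.marked b) × ℤ

namespace IndexedPath

/-- The trivial path. -/
def nil {a : Fin N} : Γ.IndexedPath a a := (Quiver.Path.nil, 0)

/-- Concatenation. -/
def comp {a b c : Fin N} (x : Γ.IndexedPath a b) (y : Γ.IndexedPath b c) : Γ.IndexedPath a c :=
  (x.1.comp y.1, x.2 + y.2)

theorem comp_nil {a b : Fin N} (x : Γ.IndexedPath a b) : x.comp nil = x :=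
  Prod.ext rfl (add_zero _)

theorem nil_comp {a b : Fin N} (x : Γ.IndexedPath a b) : nil.comp x = x :=
  Prod.ext (Quiver.Path.nil_comp _) (zero_add _)

theorem comp_assoc {a b c d : Fin N} (x : Γ.IndexedPath a b) (y : Γ.IndexedPath b c)
    (z : Γ.IndexedPath c d) : (x.comp y).comp z = x.comp (y.comp z) :=
  Prod.ext (Quiver.Path.comp_assoc ..) (add_assoc ..)

end IndexedPath

/-- A path on the cylinder as an indexed path on the torus. -/
def Cut.indexed (κ : Γ.Cut) {a b : Fin N} (p : Quiver.Path (Γ.source a) (Γ.sink b)) :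
    Γ.IndexedPath a b :=
  (torusPath p, κ.pathIndex p)

variable (Γ) in
/-- Sequences of `k` consecutive boundary paths. -/
def Word : ℕ → Fin N → Fin N → Type
  | 0, a, b => PLift (a = b)
  | k + 1, a, b => Σ c, Word k a c × Quiver.Path (Γ.source c) (Γ.sink b)

instance instFintypeWord : ∀ (k : ℕ) (a b : Fin N), Fintype (Γ.Word k a b)
  | 0, a, b => inferInstanceAs (Fintype (PLift (a = b)))
  | k + 1, a, b =>
    have := instFintypeWord k
    inferInstanceAs (Fintype (Σ c, Γ.Word k a c × Quiver.Path (Γ.source c) (Γ.sink b)))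

/-- The concatenation of the paths in a word. -/
def Word.eval (κ : Γ.Cut) {a : Fin N} : ∀ {k : ℕ} {b : Fin N}, Γ.Word k a b → Γ.IndexedPath a b
  | 0, _, w => w.down ▸ IndexedPath.nil
  | _ + 1, _, w => (Word.eval κ w.2.1).comp (κ.indexed w.2.2)

variable (κ : Γ.Cut) {M : Type*} [AddCommMonoid M]

theorem sum_word_zero {a b : Fin N} (F : Γ.IndexedPath a b → M) :
    ∑ w : Γ.Word 0 a b, F (w.eval κ) = if h : a = b then F (h ▸ IndexedPath.nil) else 0 := by
  split_ifs with h
  · exact Fintype.sum_eq_single (α := PLift (a = b)) (f := fun w => F (Word.eval κ (k := 0) w))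
      ⟨h⟩ fun x hx => absurd (Subsingleton.elim _ _) hx
  · exact Finset.sum_eq_zero fun x => absurd (PLift.down x) h

theorem sum_word_succ {k : ℕ} {a b : Fin N} (F : Γ.IndexedPath a b → M) :
    ∑ w : Γ.Word (k + 1) a b, F (w.eval κ) = ∑ c, ∑ x : Γ.Word k a c,
      ∑ p : Quiver.Path (Γ.source c) (Γ.sink b), F ((x.eval κ).comp (κ.indexed p)) := by
  refine (Fintype.sum_sigma
    (fun w : Σ c, Γ.Word k a c × Quiver.Path (Γ.source c) (Γ.sink b) =>
      F ((w.2.1.eval κ).comp (κ.indexed w.2.2)))).trans ?_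
  exact Finset.sum_congr rfl fun c _ => Fintype.sum_prod_type _

theorem sum_word_comp {s t : ℕ} {a b : Fin N} (F : Γ.IndexedPath a b → M) :
    ∑ w : Γ.Word (s + t) a b, F (w.eval κ) =
      ∑ c, ∑ x : Γ.Word s a c, ∑ y : Γ.Word t c b, F ((x.eval κ).comp (y.eval κ)) := by
  induction t generalizing b with
  | zero =>
    symm
    simp only [fun c (x : Γ.IndexedPath a c) =>
      sum_word_zero κ (a := c) (b := b) fun y => F (x.comp y)]
    rw [Fintype.sum_eq_single b fun c hc => by simp [hc]]
    simp [IndexedPath.comp_nil]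
  | succ t ih =>
    rw [← add_assoc, sum_word_succ]
    simp only [fun c x => sum_word_succ κ (k := t) (a := c) (b := b)
      fun y => F (IndexedPath.comp x y)]
    calc _ = ∑ c, ∑ p : Quiver.Path (Γ.source c) (Γ.sink b), ∑ d, ∑ x : Γ.Word s a d,
          ∑ y : Γ.Word t d c, F (((x.eval κ).comp (y.eval κ)).comp (κ.indexed p)) := by
          refine Finset.sum_congr rfl fun c _ => ?_
          rw [Finset.sum_comm]
          exact Finset.sum_congr rfl fun p _ => ih fun w => F (w.comp (κ.indexed p))
      _ = ∑ c, ∑ d, ∑ x : Γ.Word s a d, ∑ p : Quiver.Path (Γ.source c) (Γ.sink b),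
          ∑ y : Γ.Word t d c, F ((x.eval κ).comp ((y.eval κ).comp (κ.indexed p))) := by
          simp only [IndexedPath.comp_assoc]
          refine Finset.sum_congr rfl fun c _ => ?_
          rw [Finset.sum_comm]
          exact Finset.sum_congr rfl fun d _ => Finset.sum_comm
      _ = _ := by
          rw [Finset.sum_comm]
          refine Finset.sum_congr rfl fun d _ => ?_
          rw [Finset.sum_comm]
          exact Finset.sum_congr rfl fun x _ => Finset.sum_congr rfl fun c _ => Finset.sum_comm

theorem sum_word_one {a b : Fin N} (F : Γ.IndexedPath a b → M) :
    ∑ w : Γ.Word 1 a b, F (w.eval κ) =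
      ∑ p : Quiver.Path (Γ.source a) (Γ.sink b), F (κ.indexed p) := by
  rw [sum_word_succ]
  simp only [sum_word_zero κ fun x => ∑ p, F (IndexedPath.comp x (κ.indexed p))]
  rw [Fintype.sum_eq_single a fun c hc => by simp [hc.symm]]
  simp [IndexedPath.nil_comp]

theorem sum_word_one_add {m : ℕ} {a b : Fin N} (F : Γ.IndexedPath a b → M) :
    ∑ w : Γ.Word (m + 1) a b, F (w.eval κ) = ∑ c, ∑ p : Quiver.Path (Γ.source a) (Γ.sink c),
      ∑ y : Γ.Word m c b, F ((κ.indexed p).comp (y.eval κ)) := by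
  rw [add_comm, sum_word_comp]
  exact Finset.sum_congr rfl fun c _ =>
    sum_word_one κ fun x => ∑ y : Γ.Word m c b, F (x.comp (y.eval κ))

/-- The sum over all pairs of words of lengths `i` and `m` which compose to a loop. -/
def Cut.pairSum (i m : ℕ) (C : ∀ a b, Γ.IndexedPath a b → Γ.IndexedPath b a → M) : M :=
  ∑ a, ∑ b, ∑ w : Γ.Word i a b, ∑ y : Γ.Word m b a, C a b (w.eval κ) (y.eval κ)

theorem Cut.pairSum_add (i m : ℕ) (C C' : ∀ a b, Γ.IndexedPath a b → Γ.IndexedPath b a → M) :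
    κ.pairSum i m (fun a b w y => C a b w y + C' a b w y) =
      κ.pairSum i m C + κ.pairSum i m C' := by
  simp only [Cut.pairSum, Finset.sum_add_distrib]

theorem Cut.pairSum_sigma (i m : ℕ) (C : ∀ a b, Γ.IndexedPath a b → Γ.IndexedPath b a → M) :
    κ.pairSum i m C = ∑ t : Σ a b, Γ.Word i a b × Γ.Word m b a,
      C t.1 t.2.1 (t.2.2.1.eval κ) (t.2.2.2.eval κ) := by
  simp only [Cut.pairSum, Fintype.sum_sigma, Fintype.sum_prod_type]

theorem Cut.pairSum_comm (i m k n : ℕ)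
    (C : ∀ a b, Γ.IndexedPath a b → Γ.IndexedPath b a →
      ∀ c d, Γ.IndexedPath c d → Γ.IndexedPath d c → M) :
    κ.pairSum i m (fun a b w y => κ.pairSum k n (C a b w y)) =
      κ.pairSum k n fun c d z x => κ.pairSum i m fun a b w y => C a b w y c d z x := by
  simp only [Cut.pairSum_sigma]
  exact Finset.sum_comm

theorem Cut.pairSum_zero_right (i : ℕ)
    (C : ∀ a b, Γ.IndexedPath a b → Γ.IndexedPath b a → M) :
    κ.pairSum i 0 C = ∑ a, ∑ w : Γ.Word i a a, C a a (w.eval κ) .nil := by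
  rw [Cut.pairSum]
  refine Finset.sum_congr rfl fun a _ => ?_
  simp only [fun b w => sum_word_zero κ fun y => C a b w y]
  rw [Fintype.sum_eq_single a fun c hc => by simp [hc]]
  simp

/-- Cyclic Leibniz rule: a function on pairs of words which is a derivation in the first word has
vanishing sums as soon as this holds for first words of length one. -/
theorem Cut.pairSum_eq_zero {M : Type*} [AddCommGroup M]
    (C : ∀ a b, Γ.IndexedPath a b → Γ.IndexedPath b a → M)
    (hC : ∀ a b c (w : Γ.IndexedPath a b) (p : Γ.IndexedPath b c) (y : Γ.IndexedPath c a),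
      C a c (w.comp p) y = C b c p (y.comp w) + C a b w (p.comp y))
    (h : ∀ m, κ.pairSum 1 m C = 0) (i m : ℕ) : κ.pairSum i m C = 0 := by
  induction i generalizing m with
  | zero =>
    -- A derivation vanishes on the trivial path, by the Leibniz rule for `nil` times `nil`.
    have h0 : ∀ a (y : Γ.IndexedPath a a), C a a .nil y = 0 := fun a y => by
      have := hC a a a .nil .nil y
      rwa [IndexedPath.comp_nil, IndexedPath.comp_nil, IndexedPath.nil_comp,
        left_eq_add] at this
    refine Finset.sum_eq_zero fun a _ => Finset.sum_eq_zero fun b _ => ?_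
    refine (sum_word_zero κ fun w => ∑ y : Γ.Word m b a, C a b w (y.eval κ)).trans ?_
    split_ifs with hab
    · subst hab
      exact Finset.sum_eq_zero fun y _ => h0 a _
    · rfl
  | succ i ih =>
    -- The last letter `p` of the first word is split off. Its complement in the loop has length `m
    -- + i`; the complement of the remaining word has length `m + 1`.
    have h1 : κ.pairSum (i + 1) m C = κ.pairSum 1 (m + i) C + κ.pairSum i (m + 1) C := by
      have e1 : κ.pairSum (i + 1) m C = ∑ a, ∑ c, ∑ b, ∑ w : Γ.Word i a b,
          ∑ p : Quiver.Path (Γ.source b) (Γ.sink c), ∑ y : Γ.Word m c a,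
          (C b c (κ.indexed p) ((y.eval κ).comp (w.eval κ)) +
            C a b (w.eval κ) ((κ.indexed p).comp (y.eval κ))) := by
        refine Finset.sum_congr rfl fun a _ => Finset.sum_congr rfl fun c _ => ?_
        simp only [← hC]
        exact sum_word_succ κ fun w => ∑ y : Γ.Word m c a, C a c w (y.eval κ)
      have e2 : κ.pairSum 1 (m + i) C = ∑ b, ∑ c, ∑ p : Quiver.Path (Γ.source b) (Γ.sink c),
          ∑ a, ∑ y : Γ.Word m c a, ∑ w : Γ.Word i a b,
            C b c (κ.indexed p) ((y.eval κ).comp (w.eval κ)) := by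
        refine Finset.sum_congr rfl fun b _ => Finset.sum_congr rfl fun c _ => ?_
        refine (sum_word_one κ fun p => ∑ y : Γ.Word (m + i) c b, C b c p (y.eval κ)).trans ?_
        exact Finset.sum_congr rfl fun p _ => sum_word_comp κ fun y => C b c (κ.indexed p) y
      have e3 : κ.pairSum i (m + 1) C = ∑ a, ∑ b, ∑ w : Γ.Word i a b, ∑ c,
          ∑ p : Quiver.Path (Γ.source b) (Γ.sink c), ∑ y : Γ.Word m c a,
            C a b (w.eval κ) ((κ.indexed p).comp (y.eval κ)) := by
        refine Finset.sum_congr rfl fun a _ => Finset.sum_congr rfl fun b _ => ?_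
        exact Finset.sum_congr rfl fun w _ => sum_word_one_add κ fun y => C a b (w.eval κ) y
      rw [e1, e2, e3]
      simp only [Finset.sum_add_distrib]
      congr 1
      · have := Fintype.sum_equiv (⟨fun t => ⟨t.2.2.1, t.2.1, t.2.2.2.2.1, t.1, t.2.2.2.2.2,
            t.2.2.2.1⟩, fun t => ⟨t.2.2.2.1, t.2.1, t.1, t.2.2.2.2.2, t.2.2.1, t.2.2.2.2.1⟩,
            fun _ => rfl, fun _ => rfl⟩ :
            (Σ a c b, Γ.Word i a b × Quiver.Path (Γ.source b) (Γ.sink c) × Γ.Word m c a) ≃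
            Σ b c, Quiver.Path (Γ.source b) (Γ.sink c) × Σ a, Γ.Word m c a × Γ.Word i a b)
          (fun t => C t.2.2.1 t.2.1 (κ.indexed t.2.2.2.2.1)
            ((t.2.2.2.2.2.eval κ).comp (t.2.2.2.1.eval κ)))
          (fun t => C t.1 t.2.1 (κ.indexed t.2.2.1)
            ((t.2.2.2.2.1.eval κ).comp (t.2.2.2.2.2.eval κ))) fun _ => rfl
        simpa only [Fintype.sum_sigma, Fintype.sum_prod_type] using this
      · refine Finset.sum_congr rfl fun a _ => ?_
        rw [Finset.sum_comm]
        exact Finset.sum_congr rfl fun b _ => Finset.sum_comm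
    rw [h1, h, ih, add_zero]

end Words

end PerfectCylindricalNetwork

/-! ### Cancellation of the boundary terms -/

namespace PerfectCylindricalNetwork

noncomputable section Hamiltonians

variable {N : ℕ} [NeZero N] {Γ : PerfectCylindricalNetwork N N} (𝕜 : Type*) [Field 𝕜] (κ : Γ.Cut)

theorem Cut.pairSum_one {M : Type*} [AddCommMonoid M] (m : ℕ)
    (C : ∀ a b, Γ.IndexedPath a b → Γ.IndexedPath b a → M) :
    κ.pairSum 1 m C = ∑ a, ∑ b, ∑ p : Quiver.Path (Γ.source a) (Γ.sink b), ∑ y : Γ.Word m b a,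
      C a b (κ.indexed p) (y.eval κ) :=
  Finset.sum_congr rfl fun a _ => Finset.sum_congr rfl fun b _ =>
    sum_word_one κ fun w => ∑ y : Γ.Word m b a, C a b w (y.eval κ)

/-- The bracket of the first and the third path, closed up by the other two, if the two loops have
indices `j` and `l`. -/
def bracketTerm (j l : ℤ) {a b c d : Fin N} (w : Γ.IndexedPath a b) (y : Γ.IndexedPath b a)
    (z : Γ.IndexedPath c d) (x : Γ.IndexedPath d c) : CyclicSpace 𝕜 Γ.marked :=
  if w.2 + y.2 = j ∧ z.2 + x.2 = l then
    closeUp Γ.marked y.1 x.1 ((Γ.doubleBracket 𝕜).br (pathElt 𝕜 w.1) (pathElt 𝕜 z.1)) else 0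

theorem bracketTerm_comp_left (j l : ℤ) {a b b' c d : Fin N} (w : Γ.IndexedPath a b)
    (p : Γ.IndexedPath b b') (y : Γ.IndexedPath b' a) (z : Γ.IndexedPath c d)
    (x : Γ.IndexedPath d c) : bracketTerm 𝕜 j l (w.comp p) y z x =
      bracketTerm 𝕜 j l p (y.comp w) z x + bracketTerm 𝕜 j l w (p.comp y) z x := by
  have h1 : (w.comp p).2 + y.2 = p.2 + (y.comp w).2 := by simp only [IndexedPath.comp]; ring
  have h2 : w.2 + (p.comp y).2 = p.2 + (y.comp w).2 := by simp only [IndexedPath.comp]; ring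
  rw [bracketTerm, bracketTerm, bracketTerm, h1, h2]
  split_ifs
  · simp only [IndexedPath.comp, pathElt_comp, Biderivation.leibniz_left, map_add,
      closeUp_lmul₂, closeUp_rmul₁]
  · exact (add_zero 0).symm

theorem bracketTerm_comp_right (j l : ℤ) {a b c d d' : Fin N} (w : Γ.IndexedPath a b)
    (y : Γ.IndexedPath b a) (z : Γ.IndexedPath c d) (p : Γ.IndexedPath d d')
    (x : Γ.IndexedPath d' c) : bracketTerm 𝕜 j l w y (z.comp p) x =
      bracketTerm 𝕜 j l w y p (x.comp z) + bracketTerm 𝕜 j l w y z (p.comp x) := by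
  have h1 : (z.comp p).2 + x.2 = p.2 + (x.comp z).2 := by simp only [IndexedPath.comp]; ring
  have h2 : z.2 + (p.comp x).2 = p.2 + (x.comp z).2 := by simp only [IndexedPath.comp]; ring
  rw [bracketTerm, bracketTerm, bracketTerm, h1, h2]
  split_ifs
  · simp only [IndexedPath.comp, pathElt_comp, Biderivation.leibniz_right, map_add,
      closeUp_lmul₁, closeUp_rmul₂]
  · exact (add_zero 0).symm

/-- The class of the loop `u v` weighted by the position of its marked points on the boundary
circle. -/
def signTerm (j l : ℤ) (a c : Fin N) (u : Γ.IndexedPath a c) (v : Γ.IndexedPath c a) :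
    CyclicSpace 𝕜 Γ.marked :=
  if u.2 + v.2 = j + l then
    (signIn 𝕜 (relPos a c - (j - u.2 : ℤ)) / 2) • loopClass 𝕜 Γ.marked (u.1.comp v.1) else 0

/-- The shift `j - P.2 - κ.pathIndex r` is chosen so that both signs take the same form. At the
sinks the loop is cut into `P r'` and `Q r`, at the sources into `r P` and `r' Q`, and in each case
the shift becomes `j` minus the index of the first half. -/
theorem crossing_smul_exchangeClass (j l : ℤ) {a b a' b' : Fin N} (P : Γ.IndexedPath b a)
    (Q : Γ.IndexedPath b' a') (r : Quiver.Path (Γ.source a') (Γ.sink b))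
    (r' : Quiver.Path (Γ.source a) (Γ.sink b')) :
    (if κ.pathIndex r + κ.pathIndex r' = j - P.2 + (l - Q.2) then
      κ.crossing 𝕜 r r' (j - P.2 - κ.pathIndex r) • exchangeClass 𝕜 P.1 Q.1 r r' else 0) =
    signTerm 𝕜 j l b b' (P.comp (κ.indexed r')) (Q.comp (κ.indexed r)) -
      signTerm 𝕜 j l a' a ((κ.indexed r).comp P) ((κ.indexed r').comp Q) := by
  have h1 : loopClass 𝕜 Γ.marked (((P.comp (κ.indexed r')).1.comp (Q.comp (κ.indexed r)).1)) =
      exchangeClass 𝕜 P.1 Q.1 r r' := by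
    rw [show (P.comp (κ.indexed r')).1.comp (Q.comp (κ.indexed r)).1 =
      ((P.1.comp (torusPath r')).comp Q.1).comp (torusPath r) by
        simp only [IndexedPath.comp, Cut.indexed, Quiver.Path.comp_assoc], loopClass_comm,
      Quiver.Path.comp_assoc P.1, ← Quiver.Path.comp_assoc (torusPath r)]
    rfl
  have h2 : (P.comp (κ.indexed r')).2 = P.2 + κ.pathIndex r' := rfl
  have h3 : (Q.comp (κ.indexed r)).2 = Q.2 + κ.pathIndex r := rfl
  have h4 : ((κ.indexed r).comp P).2 = κ.pathIndex r + P.2 := rfl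
  have h5 : ((κ.indexed r').comp Q).2 = κ.pathIndex r' + Q.2 := rfl
  rw [signTerm, signTerm, h1, h2, h3, h4, h5, Cut.crossing_eq]
  by_cases h : κ.pathIndex r + κ.pathIndex r' = j - P.2 + (l - Q.2)
  · rw [if_pos h, if_pos (by omega), if_pos (by omega), sub_div, sub_smul,
      show j - P.2 - κ.pathIndex r + κ.pathIndex r - κ.pathIndex r' =
        j - (P.2 + κ.pathIndex r') by ring,
      show j - P.2 - κ.pathIndex r = j - (κ.pathIndex r + P.2) by ring]
    rfl
  · rw [if_neg h, if_neg (by omega), if_neg (by omega), sub_zero]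

/-- Appending the letters `r'` and `r` to `P` and `Q` produces every pair of words of lengths `m +
1` and `n + 1` composing to a loop exactly once. -/
theorem sum_signTerm_left (j l : ℤ) (m n : ℕ) :
    ∑ a, ∑ b, ∑ a', ∑ b', ∑ P : Γ.Word m b a, ∑ Q : Γ.Word n b' a',
      ∑ r' : Quiver.Path (Γ.source a) (Γ.sink b'), ∑ r : Quiver.Path (Γ.source a') (Γ.sink b),
        signTerm 𝕜 j l b b' ((P.eval κ).comp (κ.indexed r')) ((Q.eval κ).comp (κ.indexed r)) =
      κ.pairSum (m + 1) (n + 1) (signTerm 𝕜 j l) := by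
  have e : κ.pairSum (m + 1) (n + 1) (signTerm 𝕜 j l) =
      ∑ b, ∑ b', ∑ a, ∑ P : Γ.Word m b a, ∑ r' : Quiver.Path (Γ.source a) (Γ.sink b'),
      ∑ a', ∑ Q : Γ.Word n b' a', ∑ r : Quiver.Path (Γ.source a') (Γ.sink b),
        signTerm 𝕜 j l b b' ((P.eval κ).comp (κ.indexed r'))
          ((Q.eval κ).comp (κ.indexed r)) := by
    refine Finset.sum_congr rfl fun b _ => Finset.sum_congr rfl fun b' _ => ?_
    refine (sum_word_succ κ fun u => ∑ v : Γ.Word (n + 1) b' b,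
      signTerm 𝕜 j l b b' u (v.eval κ)).trans ?_
    refine Finset.sum_congr rfl fun a _ => Finset.sum_congr rfl fun P _ =>
      Finset.sum_congr rfl fun r' _ => ?_
    exact sum_word_succ κ fun v => signTerm 𝕜 j l b b' _ v
  rw [e]
  have := Fintype.sum_equiv (⟨fun t => ⟨t.2.1, t.2.2.2.1, t.1, t.2.2.2.2.1, t.2.2.2.2.2.2.1,
      t.2.2.1, t.2.2.2.2.2.1, t.2.2.2.2.2.2.2⟩,
    fun t => ⟨t.2.2.1, t.1, t.2.2.2.2.2.1, t.2.1, t.2.2.2.1, t.2.2.2.2.2.2.1, t.2.2.2.2.1,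
      t.2.2.2.2.2.2.2⟩, fun _ => rfl, fun _ => rfl⟩ :
    (Σ a b a' b', Γ.Word m b a × Γ.Word n b' a' × Quiver.Path (Γ.source a) (Γ.sink b') ×
      Quiver.Path (Γ.source a') (Γ.sink b)) ≃
    (Σ b b' a, Γ.Word m b a × Quiver.Path (Γ.source a) (Γ.sink b') × Σ a', Γ.Word n b' a' ×
      Quiver.Path (Γ.source a') (Γ.sink b)))
    (fun t => signTerm 𝕜 j l t.2.1 t.2.2.2.1
      ((t.2.2.2.2.1.eval κ).comp (κ.indexed t.2.2.2.2.2.2.1))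
      ((t.2.2.2.2.2.1.eval κ).comp (κ.indexed t.2.2.2.2.2.2.2)))
    (fun t => signTerm 𝕜 j l t.1 t.2.1 ((t.2.2.2.1.eval κ).comp (κ.indexed t.2.2.2.2.1))
      ((t.2.2.2.2.2.2.1.eval κ).comp (κ.indexed t.2.2.2.2.2.2.2))) fun _ => rfl
  simpa only [Fintype.sum_sigma, Fintype.sum_prod_type] using this

/-- The same pairs arise by prepending the letters, with the sources in place of the sinks as
cutting points; hence the sum equals the previous one. -/
theorem sum_signTerm_right (j l : ℤ) (m n : ℕ) :
    ∑ a, ∑ b, ∑ a', ∑ b', ∑ P : Γ.Word m b a, ∑ Q : Γ.Word n b' a',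
      ∑ r' : Quiver.Path (Γ.source a) (Γ.sink b'), ∑ r : Quiver.Path (Γ.source a') (Γ.sink b),
        signTerm 𝕜 j l a' a ((κ.indexed r).comp (P.eval κ)) ((κ.indexed r').comp (Q.eval κ)) =
      κ.pairSum (m + 1) (n + 1) (signTerm 𝕜 j l) := by
  have e : κ.pairSum (m + 1) (n + 1) (signTerm 𝕜 j l) =
      ∑ a', ∑ a, ∑ b, ∑ r : Quiver.Path (Γ.source a') (Γ.sink b), ∑ P : Γ.Word m b a,
      ∑ b', ∑ r' : Quiver.Path (Γ.source a) (Γ.sink b'), ∑ Q : Γ.Word n b' a',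
        signTerm 𝕜 j l a' a ((κ.indexed r).comp (P.eval κ))
          ((κ.indexed r').comp (Q.eval κ)) := by
    refine Finset.sum_congr rfl fun a' _ => Finset.sum_congr rfl fun a _ => ?_
    refine (sum_word_one_add κ fun u => ∑ v : Γ.Word (n + 1) a a',
      signTerm 𝕜 j l a' a u (v.eval κ)).trans ?_
    refine Finset.sum_congr rfl fun b _ => Finset.sum_congr rfl fun r _ =>
      Finset.sum_congr rfl fun P _ => ?_
    exact sum_word_one_add κ fun v => signTerm 𝕜 j l a' a _ v
  rw [e]
  have := Fintype.sum_equiv (⟨fun t => ⟨t.2.2.1, t.1, t.2.1, t.2.2.2.2.2.2.2, t.2.2.2.2.1,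
      t.2.2.2.1, t.2.2.2.2.2.2.1, t.2.2.2.2.2.1⟩,
    fun t => ⟨t.2.1, t.2.2.1, t.1, t.2.2.2.2.2.1, t.2.2.2.2.1, t.2.2.2.2.2.2.2,
      t.2.2.2.2.2.2.1, t.2.2.2.1⟩, fun _ => rfl, fun _ => rfl⟩ :
    (Σ a b a' b', Γ.Word m b a × Γ.Word n b' a' × Quiver.Path (Γ.source a) (Γ.sink b') ×
      Quiver.Path (Γ.source a') (Γ.sink b)) ≃
    (Σ a' a b, Quiver.Path (Γ.source a') (Γ.sink b) × Γ.Word m b a × Σ b',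
      Quiver.Path (Γ.source a) (Γ.sink b') × Γ.Word n b' a'))
    (fun t => signTerm 𝕜 j l t.2.2.1 t.1
      ((κ.indexed t.2.2.2.2.2.2.2).comp (t.2.2.2.2.1.eval κ))
      ((κ.indexed t.2.2.2.2.2.2.1).comp (t.2.2.2.2.2.1.eval κ)))
    (fun t => signTerm 𝕜 j l t.1 t.2.1 ((κ.indexed t.2.2.2.1).comp (t.2.2.2.2.1.eval κ))
      ((κ.indexed t.2.2.2.2.2.2.1).comp (t.2.2.2.2.2.2.2.eval κ))) fun _ => rfl
  simpa only [Fintype.sum_sigma, Fintype.sum_prod_type] using this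

theorem pairSum_one_bracketTerm (j l : ℤ) (m n : ℕ) :
    κ.pairSum 1 m (fun _ _ w y => κ.pairSum 1 n fun _ _ z x => bracketTerm 𝕜 j l w y z x) = 0 := by
  have e : κ.pairSum 1 m (fun _ _ w y =>
      κ.pairSum 1 n fun _ _ z x => bracketTerm 𝕜 j l w y z x) =
      ∑ a, ∑ b, ∑ a', ∑ b', ∑ P : Γ.Word m b a, ∑ Q : Γ.Word n b' a',
      ∑ q : Quiver.Path (Γ.source a') (Γ.sink b'), ∑ p : Quiver.Path (Γ.source a) (Γ.sink b),
        bracketTerm 𝕜 j l (κ.indexed p) (P.eval κ) (κ.indexed q) (Q.eval κ) := by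
    simp only [Cut.pairSum_one]
    have := Fintype.sum_equiv (⟨fun t => ⟨t.1, t.2.1, t.2.2.2.2.1, t.2.2.2.2.2.1, t.2.2.2.1,
        t.2.2.2.2.2.2.2, t.2.2.2.2.2.2.1, t.2.2.1⟩,
      fun t => ⟨t.1, t.2.1, t.2.2.2.2.2.2.2, t.2.2.2.2.1, t.2.2.1, t.2.2.2.1, t.2.2.2.2.2.2.1,
        t.2.2.2.2.2.1⟩, fun _ => rfl, fun _ => rfl⟩ :
      (Σ a b, Quiver.Path (Γ.source a) (Γ.sink b) × Γ.Word m b a × Σ a' b',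
        Quiver.Path (Γ.source a') (Γ.sink b') × Γ.Word n b' a') ≃
      (Σ a b a' b', Γ.Word m b a × Γ.Word n b' a' × Quiver.Path (Γ.source a') (Γ.sink b') ×
        Quiver.Path (Γ.source a) (Γ.sink b)))
      (fun t => bracketTerm 𝕜 j l (κ.indexed t.2.2.1) (t.2.2.2.1.eval κ)
        (κ.indexed t.2.2.2.2.2.2.1) (t.2.2.2.2.2.2.2.eval κ))
      (fun t => bracketTerm 𝕜 j l (κ.indexed t.2.2.2.2.2.2.2) (t.2.2.2.2.1.eval κ)
        (κ.indexed t.2.2.2.2.2.2.1) (t.2.2.2.2.2.1.eval κ)) fun _ => rfl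
    simpa only [Fintype.sum_sigma, Fintype.sum_prod_type] using this
  -- Zero is written as the sum over sinks minus the sum over sources, which is then compared with
  -- the bracket for fixed end points and fixed words `P`, `Q`.
  rw [e, ← sub_self (κ.pairSum (m + 1) (n + 1) (signTerm 𝕜 j l))]
  nth_rw 1 [← sum_signTerm_left]
  rw [← sum_signTerm_right]
  simp only [← Finset.sum_sub_distrib]
  refine Finset.sum_congr rfl fun a _ => Finset.sum_congr rfl fun b _ =>
    Finset.sum_congr rfl fun a' _ => Finset.sum_congr rfl fun b' _ =>
    Finset.sum_congr rfl fun P _ => Finset.sum_congr rfl fun Q _ => ?_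
  simp only [← crossing_smul_exchangeClass]
  rw [← sum_closeUp_doubleBracket]
  refine Finset.sum_congr rfl fun q _ => Finset.sum_congr rfl fun p _ => ?_
  refine if_congr (and_congr ?_ ?_) rfl rfl
  · exact eq_sub_iff_add_eq.symm
  · exact eq_sub_iff_add_eq.symm

/-- The cyclic Leibniz rule is applied to each argument in turn, after interchanging the two sums,
which leaves single letters in both. -/
theorem pairSum_bracketTerm (j l : ℤ) (i m k n : ℕ) :
    κ.pairSum i m (fun _ _ w y => κ.pairSum k n fun _ _ z x => bracketTerm 𝕜 j l w y z x) = 0 := by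
  refine κ.pairSum_eq_zero _ (fun a b c w p y => ?_) (fun m => ?_) i m
  · simp only [bracketTerm_comp_left, Cut.pairSum_add]
  · rw [Cut.pairSum_comm]
    refine κ.pairSum_eq_zero _ (fun a b c w p y => ?_) (fun n => ?_) k n
    · simp only [bracketTerm_comp_right, Cut.pairSum_add]
    · rw [Cut.pairSum_comm]
      exact pairSum_one_bracketTerm 𝕜 κ j l m n

theorem boundaryMeasurement_pow (k : ℕ) (a b : Fin N) :
    (Γ.boundaryMeasurement 𝕜 κ).pow k a b =
      ∑ w : Γ.Word k a b, Finsupp.single (w.eval κ).2 (pathElt 𝕜 (w.eval κ).1) := by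
  induction k generalizing b with
  | zero =>
    rw [sum_word_zero κ fun x => Finsupp.single x.2 (pathElt 𝕜 x.1)]
    refine dite_congr rfl (fun h => ?_) fun _ => rfl
    subst h
    rfl
  | succ k ih =>
    rw [sum_word_succ κ fun x => Finsupp.single x.2 (pathElt 𝕜 x.1), LaurentMatrix.pow,
      LaurentMatrix.mul]
    refine Finset.sum_congr rfl fun c _ => ?_
    rw [ih]
    have h1 : ∀ (n : ℤ) (x : LinPath 𝕜 (Γ.marked a) (Γ.marked c)),
        ((Γ.boundaryMeasurement 𝕜 κ c b).sum fun n' y =>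
          Finsupp.single (n + n') (concat 𝕜 x y)) =
        ∑ p : Quiver.Path (Γ.source c) (Γ.sink b), Finsupp.single (n + κ.pathIndex p)
          (concat 𝕜 x (pathElt 𝕜 (torusPath p))) := fun n x => by
      rw [boundaryMeasurement, ← Finsupp.sum_finsetSum_index (fun _ => by simp)
        fun _ _ _ => by simp]
      exact Finset.sum_congr rfl fun p _ => Finsupp.sum_single_index (by simp)
    simp only [h1]
    rw [← Finsupp.sum_finsetSum_index (fun _ => by simp)
        fun _ _ _ => by simp [Finset.sum_add_distrib]]
    refine Finset.sum_congr rfl fun w _ => (Finsupp.sum_single_index (by simp)).trans ?_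
    refine Finset.sum_congr rfl fun p _ => ?_
    rw [← pathElt_comp]
    rfl

theorem cyclicClass_hamiltonian (i : ℕ) (j : ℤ) :
    cyclicClass Γ.marked (Γ.hamiltonian 𝕜 κ i j) = ∑ a, ∑ w : Γ.Word i a a,
      if (w.eval κ).2 = j then loopClass 𝕜 Γ.marked (w.eval κ).1 else 0 := by
  rw [hamiltonian, LaurentMatrix.traceCoeff, map_sum]
  refine Finset.sum_congr rfl fun a _ => ?_
  rw [boundaryMeasurement_pow, Finsupp.finsetSum_apply, map_sum, map_sum]
  refine Finset.sum_congr rfl fun w _ => ?_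
  rw [Finsupp.single_apply]
  split_ifs
  · rfl
  · rw [map_zero, map_zero]

end Hamiltonians

end PerfectCylindricalNetwork

theorem mainTheorem4 {𝕜 : Type*} [Field 𝕜] [CharZero 𝕜] {N : ℕ} [NeZero N]
    (Γ : PerfectCylindricalNetwork N N) (κ : Γ.Cut) (i k : ℕ) (j l : ℤ) :
    cyclicBracket (Γ.doubleBracket 𝕜) Γ.marked
      (cyclicClass Γ.marked (Γ.hamiltonian 𝕜 κ i j))
      (cyclicClass Γ.marked (Γ.hamiltonian 𝕜 κ k l)) = 0 := by
  -- Complementary words of length `0` force the words of lengths `i` and `k` to be loops, so these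
  -- sums are the traces that define the Hamiltonians.
  rw [← PerfectCylindricalNetwork.pairSum_bracketTerm 𝕜 κ j l i 0 k 0,
    PerfectCylindricalNetwork.cyclicClass_hamiltonian,
    PerfectCylindricalNetwork.cyclicClass_hamiltonian]
  simp only [PerfectCylindricalNetwork.Cut.pairSum_zero_right]
  rw [LinearMap.map_sum₂]
  refine Finset.sum_congr rfl fun a _ => ?_
  rw [LinearMap.map_sum₂]
  refine Finset.sum_congr rfl fun w _ => ?_
  rw [map_sum]
  refine Finset.sum_congr rfl fun c _ => ?_
  rw [map_sum]
  refine Finset.sum_congr rfl fun z _ => ?_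
  rw [PerfectCylindricalNetwork.bracketTerm]
  simp only [PerfectCylindricalNetwork.IndexedPath.nil, add_zero, closeUp_nil, ite_and]
  split_ifs
  · exact cyclicBracket_mk ..
  · exact map_zero _
  · rw [map_zero, LinearMap.zero_apply]
  · exact map_zero _
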